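/- **Conventions.** Let $L,n\ge 0$ be integers. A binary $L\times n$ matrix is written $B=(B_1,\dots,B_L)$ with $B_r\subseteq[n]$ the set of columns of the $1$'s ("balls") of row $r$; rows are numbered from bottom to top, and a matrix is identified with the one obtained by adding empty rows on top. Put $x^B=\prod_{r}\prod_{b\in B_r}x_b$. Let $\mathcal M(L,n)$ be the set of these matrices. Partitions may be empty; $\mu'$ is the conjugate of $\mu$ and $\ell(\mu)$ its number of parts. Let $\mathrm{SSYT}(\nu,L)$ be the set of semistandard Young tableaux of shape $\nu$ with entries in $\{1,\dots,L\}$ (French notation: rows weakly increasing to the right, columns strictly increasing upwards), and $\mathrm{SSYT}(\nu,\kappa)$ the set of those of shape $\nu$ with $\kappa_k$ entries $k$ for every $k\ge 1$. **Collapsing.** Read the columns of $B$ from left to right and record in each column first "(" if it contains a ball of row $i+1$, then ")" if it contains a ball of row $i$; match parentheses as usual. The operator $e_i^\star$ moves all balls of row $i+1$ whose parenthesis is unmatched to row $i$. Let $e^\star_{[1,k]}=e_1^\star e_2^\star\cdots e_k^\star$ (rightmost operator first), and $$\rho_N(B)=e^\star_{[1,L-1]}\cdots e^\star_{[1,2]}e^\star_{[1,1]}(B).$$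 For $0\le k\le L$ let $N_k$ be obtained in the same way from the matrix formed by the bottom $k$ rows of $B$. The recording tableau $\rho_Q(B)$ is built row by row: for $k=1,\dots,L$ in turn, as many entries $k$ are appended to row $r$ as row $r$ of $N_k$ has more balls than row $r$ of $N_{k-1}$. Let $\rho(B)=(\rho_N(B),\rho_Q(B))$. **Multiline queues.** For a partition $\mu$, $\mathrm{MLQ}(\mu,n)$ is the set of $M=(M_1,\dots,M_{\mu_1})$ with $M_j\subseteq[n]$ and $|M_j|=\mu'_j$. Label and pair its balls as follows, for $r=\mu_1,\dots,2$: every unlabelled ball of row $r$ gets the label $r$; then the balls of row $r$, from the largest label to the smallest and from left to right among equal labels, are paired one by one to the first unlabelled ball of row $r-1$ weakly to the right, wrapping around from column $n$ to column $1$ if necessary, and the ball found receives the same label. Then $\mathrm{maj}(M)$ is the sum of $\ell-r+1$ over all wrapping pairings, where $\ell$ is the label of the pairing and $r$ the row of its upper ball. $M$ is nonwrapping if $\mathrm{maj}(M)=0$; $\mathrm{MLQ}_0(\mu,n)$ is the set of nonwrapping elements of $\mathrm{MLQ}(\mu,n)$. **Charge.** The charge of a permutation $\tau$ of $\{1,\dots,k\}$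 in one-line notation is the sum of $k-i$ over all $i<k$ such that $i$ stands to the left of $i+1$. For a word whose content is a partition, extract charge subwords one after another: start at the first occurrence of the largest remaining letter $k$, from there scan cyclically to the right for $k-1$, and so on down to $1$, and remove these letters. The charge of the word is the sum of the charges of its charge subwords, and the charge of a tableau is that of its row reading word (rows from top to bottom, each from left to right). **Theorem.** (1) For all $L,n$, collapsing is a bijection $$\rho\colon \mathcal M(L,n)\longrightarrow\bigcup_\mu \mathrm{MLQ}_0(\mu,n)\times\mathrm{SSYT}(\mu',L),$$ where $\mu$ runs over all partitions. For every $B\in\mathcal M(L,n)$, the tableau $\rho_Q(B)$ has content $(|B_1|,\dots,|B_L|)$, and $x^{\rho_N(B)}=x^B$. (2) For every partition $\mu$ and every $n\ge\ell(\mu)$, collapsing (with $L=\mu_1$) restricts to a bijection $$\rho\colon \mathrm{MLQ}(\mu,n)\longrightarrow\bigcup_\lambda \mathrm{MLQ}_0(\lambda,n)\times\mathrm{SSYT}(\lambda',\mu'),$$ where $\lambda$ runs over all partitions, and for every $M\in\mathrm{MLQ}(\mu,n)$ we have $x^{\rho_N(M)}=x^M$ and $\mathrm{maj}(M)=\mathrm{charge}(\rho_Q(M))$.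 -/

import Mathlib

namespace MLQueue

/-! ### Ball arrangements

A ball arrangement on `n` columns is given by its rows `B 1, B 2, …` (numbered from bottom to
top), each a set of columns.  Row `0` is never used and is required to be empty. -/

/-- A tuple `(B 1, B 2, …)` of subsets of the `n` columns. -/
abbrev Arrangement (n : ℕ) : Type := ℕ → Finset (Fin n)

/-- Binary matrices with `L` rows and `n` columns: all the balls lie in rows `1, …, L`. -/
def BinaryMatrices (L n : ℕ) : Set (Arrangement n) :=
  {B | ∀ r, r ∉ Finset.Icc 1 L → B r = ∅}

/-- The monomial `x^B = ∏_{r=1}^{L} ∏_{b ∈ B_r} x_b`, which records the column content. -/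
noncomputable def xMonomial {n : ℕ} (L : ℕ) (B : Arrangement n) : MvPolynomial (Fin n) ℤ :=
  ∏ r ∈ Finset.Icc 1 L, ∏ b ∈ B r, MvPolynomial.X b

/-! ### Parenthesis matching and the dropping operators -/

/-- The bracketing rule, run from left to right with a stack of the currently unmatched open
parentheses.  A letter `(true, a)` is an open parenthesis at site `a`, a letter `(false, a)` a
closed parenthesis at site `a`.  A closed parenthesis is matched with the latest unmatched open
parenthesis before it, if there is one.  The output lists the sites of the open parentheses which
are unmatched at the end. -/
def unmatchedOpen {α : Type*} : List α → List (Bool × α) → List α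
  | st, [] => st
  | st, (true, a) :: w => unmatchedOpen (a :: st) w
  | [], (false, _) :: w => unmatchedOpen [] w
  | _ :: st, (false, _) :: w => unmatchedOpen st w

/-- The parenthesis word of two adjacent rows, `A` above `C`: the columns are read from left to
right, and from top to bottom within a column, and each ball of `A` is recorded as an open
parenthesis, each ball of `C` as a closed one. -/
def par {n : ℕ} (A C : Finset (Fin n)) : List (Bool × Fin n) :=
  (List.finRange n).flatMap fun j =>
    (if j ∈ A then [(true, j)] else []) ++ (if j ∈ C then [(false, j)] else [])

/-- The balls of the upper row `A` which are unmatched in the parenthesis word of `A` and `C`. -/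
def unmatchedAbove {n : ℕ} (A C : Finset (Fin n)) : Finset (Fin n) :=
  (unmatchedOpen [] (par A C)).toFinset

/-- The operator `e_i^⋆`: all the unmatched balls of row `i + 1` are moved to row `i`. -/
def eStar {n : ℕ} (i : ℕ) (B : Arrangement n) : Arrangement n := fun r =>
  if r = i + 1 then B (i + 1) \ unmatchedAbove (B (i + 1)) (B i)
  else if r = i then B i ∪ unmatchedAbove (B (i + 1)) (B i)
  else B r

/-- The operator `e^⋆_{[1,k]} = e_1^⋆ e_2^⋆ ⋯ e_k^⋆` (so `e_k^⋆` acts first). -/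
def eStarSweep {n : ℕ} : ℕ → Arrangement n → Arrangement n
  | 0, B => B
  | k + 1, B => eStarSweep k (eStar (k + 1) B)

/-- The operator `e^⋆_{[1,k-1]} ⋯ e^⋆_{[1,2]} e^⋆_{[1,1]}`, which collapses the bottom `k`
rows. -/
def collapseRows {n : ℕ} : ℕ → Arrangement n → Arrangement n
  | 0, B => B
  | k + 1, B => eStarSweep k (collapseRows k B)

/-- The arrangement `ρ_N(B)`, for a binary matrix with `L` rows. -/
def rhoN {n : ℕ} (L : ℕ) (B : Arrangement n) : Arrangement n := collapseRows L B

/-- The arrangement `N_k` obtained by collapsing the submatrix formed by the bottom `k` rows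
of `B`. -/
def partialN {n : ℕ} (k : ℕ) (B : Arrangement n) : Arrangement n :=
  collapseRows k fun r => if r ≤ k then B r else ∅

/-- Row `r` of the recording tableau: for `k = 1, …, L` in turn, as many boxes with entry `k` are
appended as row `r` of `N_k` has more balls than row `r` of `N_{k-1}`. -/
def rhoQRow {n : ℕ} (L : ℕ) (B : Arrangement n) (r : ℕ) : List ℕ :=
  (List.range' 1 L).flatMap fun k =>
    List.replicate ((partialN k B r).card - (partialN (k - 1) B r).card) k

/-! ### Tableaux -/

/-- A filling of a diagram with positive integers.  Rows (from bottom to top) and columns are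
indexed from `0` as in `YoungDiagram`; the value `0` means that there is no box. -/
abbrev Filling : Type := ℕ → ℕ → ℕ

/-- The recording tableau `ρ_Q(B)`, for a binary matrix with `L` rows. -/
def rhoQ {n : ℕ} (L : ℕ) (B : Arrangement n) : Filling :=
  fun i c => (rhoQRow L B (i + 1)).getD c 0

/-- Collapsing: `ρ(B) = (ρ_N(B), ρ_Q(B))`. -/
def rho {n : ℕ} (L : ℕ) (B : Arrangement n) : Arrangement n × Filling := (rhoN L B, rhoQ L B)

/-- The number of boxes with entry `k`. -/
noncomputable def content (T : Filling) (k : ℕ) : ℕ := {p : ℕ × ℕ | T p.1 p.2 = k}.ncard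

/-- Semistandard Young tableaux of shape `ν`, with positive entries. -/
def SSYT (ν : YoungDiagram) : Set Filling :=
  {T | ∃ S : SemistandardYoungTableau ν, (∀ i c, T i c = S i c) ∧ ∀ p ∈ ν, 1 ≤ S p.1 p.2}

/-- Semistandard Young tableaux of shape `ν` whose entries are at most `L`. -/
def SSYTMax (ν : YoungDiagram) (L : ℕ) : Set Filling :=
  {T | T ∈ SSYT ν ∧ ∀ i c, T i c ≤ L}

/-- Semistandard Young tableaux of shape `ν` whose content is the partition `κ`, that is, with
`κ_k` entries `k` for each `k ≥ 1`. -/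
def SSYTContent (ν κ : YoungDiagram) : Set Filling :=
  {T | T ∈ SSYT ν ∧ ∀ k, content T (k + 1) = κ.rowLen k}

/-- The row reading word: rows from top to bottom, each read from left to right. -/
noncomputable def rowReadingWord (T : Filling) : List ℕ :=
  (List.range {i | T i 0 ≠ 0}.ncard).reverse.flatMap fun i =>
    (List.range {c | T i c ≠ 0}.ncard).map (T i)

/-! ### Charge -/

/-- The first element of `S` found when one looks to the right from `x` (`x` included), going
around cyclically to the smallest element of `S` if there is none. -/
def cyclicNext {α : Type*} [LinearOrder α] (S : Finset α) (x : α) : Option α :=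
  if h : (S.filter fun y => x ≤ y).Nonempty then some ((S.filter fun y => x ≤ y).min' h)
  else if h : S.Nonempty then some (S.min' h)
  else none

/-- In the word `w`, of which only the positions in `S` remain, scan cyclically from position `p`
for the letter `k`, from there for the letter `k - 1`, and so on down to the letter `1`; the output
lists the positions found. -/
def chargeScan (w : List ℕ) (S : Finset ℕ) : ℕ → ℕ → List ℕ
  | 0, _ => []
  | k + 1, p =>
    match cyclicNext (S.filter fun q => w.getD q 0 = k + 1) p with
    | none => []
    | some q => q :: chargeScan w S k q

/-- The charge of a permutation of `1, …, k`, given as the list `[p_k, …, p_2, p_1]` of the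
positions of its letters: the sum of `k - i` over all `i < k` with `p_i < p_{i+1}`. -/
def permCharge (ps : List ℕ) : ℕ :=
  ∑ i ∈ Finset.Ico 1 ps.length,
    if ps.getD (ps.length - i) 0 < ps.getD (ps.length - (i + 1)) 0 then ps.length - i else 0

/-- The total charge of the first `m` charge subwords extracted from the positions `S` of `w`: a
charge subword starts at the first occurrence of the largest remaining letter. -/
def chargeAux (w : List ℕ) : ℕ → Finset ℕ → ℕ
  | 0, _ => 0
  | m + 1, S =>
    let ps := chargeScan w S (S.sup fun q => w.getD q 0) 0
    permCharge ps + chargeAux w m (S \ ps.toFinset)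

/-- The charge of a word with partition content: the sum of the charges of its charge subwords, of
which there are as many as letters `1`. -/
def wordCharge (w : List ℕ) : ℕ := chargeAux w (w.count 1) (Finset.range w.length)

/-- The charge of a tableau with partition content. -/
noncomputable def charge (T : Filling) : ℕ := wordCharge (rowReadingWord T)

/-! ### Multiline queues -/

/-- Multiline queues of shape `(μ, n)`: row `j` has `μ'_j` balls, for each `j ≥ 1`. -/
def MLQ (μ : YoungDiagram) (n : ℕ) : Set (Arrangement n) :=
  {M | M 0 = ∅ ∧ ∀ j, (M (j + 1)).card = μ.colLen j}

/-- The balls of a labelled row in order of priority: from the largest label `L` to the smallest,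
and from left to right among the balls with the same label.  Vacancies have label `0`. -/
def priorityList {n : ℕ} (L : ℕ) (lab : Fin n → ℕ) : List (ℕ × Fin n) :=
  (List.range' 1 L).reverse.flatMap fun ℓ =>
    ((List.finRange n).filter fun x => lab x = ℓ).map fun x => (ℓ, x)

/-- Each labelled ball in turn is paired to the first unlabelled ball of the row below weakly to
its right, wrapping around if necessary; `S` is the set of the unlabelled balls of the row below.
A pairing is recorded as (label, column of the upper ball, column of the lower ball). -/
def pairBalls {n : ℕ} : List (ℕ × Fin n) → Finset (Fin n) → List (ℕ × Fin n × Fin n)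
  | [], _ => []
  | (ℓ, x) :: w, S =>
    match cyclicNext S x with
    | none => pairBalls w S
    | some y => (ℓ, x, y) :: pairBalls w (S.erase y)

/-- The labels of row `r`, where row `r` is the first of the top `k` rows `r, …, r + k - 1` of
`M` (`0` for a vacancy).  A ball paired from the row above gets the label of that pairing, and any
other ball of row `r` gets the label `r`. -/
def fmLabel {n : ℕ} (M : Arrangement n) : ℕ → ℕ → Fin n → ℕ
  | 0, _ => fun _ => 0
  | k + 1, r => fun y =>
    match (pairBalls (priorityList (r + k) (fmLabel M k (r + 1))) (M r)).find?
        (fun p => p.2.2 = y) with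
    | some p => p.1
    | none => if y ∈ M r then r else 0

/-- The pairings from row `r` to row `r - 1` of a multiline queue `M` with `L` rows. -/
def fmPairs {n : ℕ} (L : ℕ) (M : Arrangement n) (r : ℕ) : List (ℕ × Fin n × Fin n) :=
  pairBalls (priorityList L (fmLabel M (L + 1 - r) r)) (M (r - 1))

/-- The major index of a multiline queue with `L` rows: a pairing of label `ℓ` from row `r` to row
`r - 1` contributes `ℓ - r + 1` if it wraps. -/
def maj {n : ℕ} (L : ℕ) (M : Arrangement n) : ℕ :=
  ∑ r ∈ Finset.Icc 2 L,
    ((fmPairs L M r).map fun p => if p.2.2 < p.2.1 then p.1 - r + 1 else 0).sum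

/-- Nonwrapping multiline queues of shape `(μ, n)`. -/
def MLQ₀ (μ : YoungDiagram) (n : ℕ) : Set (Arrangement n) :=
  {M | M ∈ MLQ μ n ∧ maj (μ.rowLen 0) M = 0}

end MLQueue

open MLQueue

/-!
Collapsing is studied through suffix counts.  For a row `A` above a row `C`, the number of balls of
`A` at columns `≥ x` whose parenthesis is unmatched is
`excess A C x = max (0, max_{y ≥ x} (#{a ∈ A, a ≥ y} - #{c ∈ C, c ≥ y}))`,
so an operator `e_i^⋆` is given by explicit formulas for the suffix counts of the two new rows.
These formulas show that a drop can be undone once the number of dropped balls is known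
(`drop_injective`, `exists_drop_eq`).  A multiline queue is nonwrapping exactly if the suffix counts
of each row are bounded by those of the row below (`mem_MLQ₀_iff`).

*The bijection.*  If the bottom `k` rows are nonwrapping, the sweep `e_1^⋆ ⋯ e_k^⋆` produces rows
which interlace with them (`sweep_interlace`).  Hence every stage of the collapsing is nonwrapping,
and the row sizes of the successive stages form an interlacing chain of partitions, that is, a
semistandard tableau, which is the recording tableau (`records_rhoQ`, `Records.mem_SSYTMax`).  The
sizes before and after a sweep determine those in between, so that sweeps can be undone one after
another, with any prescribed interlacing sizes (`eq_of_stage_eq`, `exists_stage_eq`).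

*The statistics.*  Define the energy of a sequence of rows of weakly decreasing sizes as follows:
for each row, its balls are paired cyclically to the row below, the balls found are paired to the
next row, and so on, and all the wrapping pairings are counted.  The set of the balls found does not
depend on the order of pairing, and the number of wrapping pairings is the excess at column `0`
(`CyclicPairing.eq_matched`).  The major index of a multiline queue is its energy, since a wrapping
pairing of label `ℓ` from row `r` is counted once for each of the rows `r, …, ℓ` (`maj_eq_energy`).
The charge of a word is the energy of the rows formed by the positions of its letters, since a
charge subword is a chain of cyclic successors that can be removed first (`wordCharge_eq_energy`).

The energy depends only on the row sizes along the collapsing (`energy_eq_of_sameSizes`).  The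
operators `e_i^⋆` satisfy the braid relations, and in these the numbers of dropped balls along the
two sides determine each other (`braid_excess`); therefore the collapsing absorbs each `e_i^⋆` with
`i < L` (`wordEquiv_absorb`), and the number of balls that an initial `e_i^⋆` would drop is
determined by the sizes.  Moving up the balls of row `i` that are not used in the cyclic pairing
from row `i + 1` does not change the result of `e_i^⋆`, so this exchange preserves the relation of
having the same sizes; successive exchanges carry the balls of a given row downwards along its
strand, and each summand of the energy is a number of dropped balls.

Finally, collapsing the positions of the letters of the row reading word of a tableau gives back the
sizes recorded by this tableau, because at each stage the rows are blocks of consecutive positions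
(`Records.card_stage`).  So a multiline queue and the reading word of its recording tableau have
equal energies, which is `maj_eq_charge`.
-/

namespace MLQueue

/-! ### Suffix counts and unmatched parentheses -/

theorem downward_induction {P : ℕ → Prop} (N : ℕ) (base : ∀ x, N ≤ x → P x)
    (step : ∀ x, P (x + 1) → P x) (x : ℕ) : P x := by
  by_cases hx : N ≤ x
  · exact base x hx
  · have key : ∀ d, d ≤ N → P (N - d) := by
      intro d
      induction d with
      | zero => intro _; exact base _ (by omega)
      | succ d ih =>
        intro hd
        apply step
        have := ih (by omega)
        rwa [show N - (d + 1) + 1 = N - d by omega]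
    have := key (N - x) (by omega)
    rwa [show N - (N - x) = x by omega] at this

/-- The number of elements of `A` which are at least `x`. -/
def sufCount (A : Finset ℕ) (x : ℕ) : ℕ := (A.filter (x ≤ ·)).card

theorem sufCount_succ (A : Finset ℕ) (x : ℕ) :
    sufCount A x = sufCount A (x + 1) + if x ∈ A then 1 else 0 := by
  unfold sufCount
  have : A.filter (x ≤ ·) = A.filter (x + 1 ≤ ·) ∪ A.filter (· = x) := by
    ext y; simp only [Finset.mem_filter, Finset.mem_union]
    constructor
    · rintro ⟨h1, h2⟩
      by_cases h : y = x
      · exact Or.inr ⟨h1, h⟩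
      · exact Or.inl ⟨h1, by omega⟩
    · rintro (⟨h1, h2⟩ | ⟨h1, h2⟩)
      · exact ⟨h1, by omega⟩
      · exact ⟨h1, by omega⟩
  rw [this, Finset.card_union_of_disjoint]
  · congr 1
    rw [Finset.filter_eq']
    split_ifs <;> simp
  · rw [Finset.disjoint_left]
    intro y; simp only [Finset.mem_filter]; omega

theorem sufCount_zero (A : Finset ℕ) : sufCount A 0 = A.card := by simp [sufCount]

theorem sufCount_eq_zero (A : Finset ℕ) {x : ℕ} (hx : A.sup id + 1 ≤ x) : sufCount A x = 0 := by
  rw [sufCount, Finset.card_eq_zero, Finset.filter_eq_empty_iff]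
  intro y hy
  have : id y ≤ A.sup id := Finset.le_sup hy
  simp at this ⊢
  omega

theorem sufCount_mono {A C : Finset ℕ} (h : A ⊆ C) (x : ℕ) : sufCount A x ≤ sufCount C x :=
  Finset.card_le_card (Finset.filter_subset_filter _ h)

theorem sufCount_empty (x : ℕ) : sufCount ∅ x = 0 := by simp [sufCount]

theorem mem_iff_sufCount (A : Finset ℕ) (x : ℕ) :
    x ∈ A ↔ sufCount A x = sufCount A (x + 1) + 1 := by
  rw [sufCount_succ]
  split_ifs <;> simp_all

theorem sufCount_injective : Function.Injective sufCount := fun A C h => by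
  ext x; rw [mem_iff_sufCount, mem_iff_sufCount, h]

theorem sufCount_union {A C : Finset ℕ} (h : Disjoint A C) (x : ℕ) :
    sufCount (A ∪ C) x = sufCount A x + sufCount C x := by
  unfold sufCount
  rw [Finset.filter_union, Finset.card_union_of_disjoint]
  exact Finset.disjoint_filter_filter h

theorem sufCount_sdiff {A C : Finset ℕ} (h : C ⊆ A) (x : ℕ) :
    sufCount (A \ C) x + sufCount C x = sufCount A x := by
  rw [← sufCount_union Finset.sdiff_disjoint, Finset.sdiff_union_of_subset h]

/-- A finite set with prescribed suffix counts. -/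
theorem exists_sufCount_eq (f : ℕ → ℕ) (N : ℕ) (h0 : ∀ x, N ≤ x → f x = 0)
    (h1 : ∀ x, f (x + 1) ≤ f x ∧ f x ≤ f (x + 1) + 1) : ∃ A, ∀ x, sufCount A x = f x := by
  refine ⟨(Finset.range N).filter fun x => f (x + 1) < f x, fun x => ?_⟩
  induction x using downward_induction (N := N) with
  | base x hx =>
    rw [h0 x hx, sufCount, Finset.card_eq_zero, Finset.filter_eq_empty_iff]
    intro y; simp only [Finset.mem_filter, Finset.mem_range]; omega
  | step x ih =>
    rw [sufCount_succ, ih]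
    have := h1 x
    have h2 := h0 x
    have h3 := h0 (x + 1)
    simp only [Finset.mem_filter, Finset.mem_range]
    split_ifs with h <;> omega

/-- The number of parentheses of `A` at columns at least `x` which are unmatched when `A` is placed
above `C`: the maximum of `0` and all `sufCount A y - sufCount C y` with `x ≤ y`. -/
def excess (A C : Finset ℕ) (x : ℕ) : ℕ :=
  (Finset.Ico x (A.sup id + 1)).sup fun y => sufCount A y - sufCount C y

theorem excess_eq_zero (A C : Finset ℕ) {x : ℕ} (hx : A.sup id + 1 ≤ x) : excess A C x = 0 := by
  simp [excess, Finset.Ico_eq_empty_of_le hx]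

theorem excess_succ (A C : Finset ℕ) (x : ℕ) :
    excess A C x = max (excess A C (x + 1)) (sufCount A x - sufCount C x) := by
  by_cases h : x < A.sup id + 1
  · rw [excess, ← Finset.insert_Ico_add_one_left_eq_Ico h, Finset.sup_insert, excess, sup_comm]
  · rw [excess_eq_zero _ _ (by omega), excess_eq_zero _ _ (by omega), sufCount_eq_zero A (by omega)]
    simp

theorem excess_antitone (A C : Finset ℕ) : Antitone (excess A C) :=
  antitone_nat_of_succ_le fun x => by rw [excess_succ A C x]; exact le_max_left _ _

theorem sufCount_le_add_excess (A C : Finset ℕ) (x : ℕ) :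
    sufCount A x ≤ sufCount C x + excess A C x := by
  rw [excess_succ]; omega

/-- The excess is the only function satisfying its recursion. -/
theorem excess_eq_of_rec (A C : Finset ℕ) (f : ℕ → ℕ) (N : ℕ) (h0 : ∀ x, N ≤ x → f x = 0)
    (h1 : ∀ x, f x = max (f (x + 1)) (sufCount A x - sufCount C x)) (x : ℕ) :
    excess A C x = f x := by
  induction x using downward_induction (N := max N (A.sup id + 1)) with
  | base x hx => rw [excess_eq_zero _ _ (by omega), h0 x (by omega)]
  | step x ih => rw [excess_succ, ih, ← h1]

theorem excess_le_succ (A C : Finset ℕ) (x : ℕ) : excess A C x ≤ excess A C (x + 1) + 1 := by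
  have h1 := sufCount_le_add_excess A C (x + 1)
  have h2 := sufCount_succ A x
  have h3 := sufCount_succ C x
  rw [excess_succ]
  split_ifs at h2 h3 <;> omega

/-- The suffix counts of `A` are bounded by those of `C`: all the balls of `A` are matched when `A`
is placed above `C`. -/
def Dominated (A C : Finset ℕ) : Prop := ∀ x, sufCount A x ≤ sufCount C x

theorem Dominated.trans {A C E : Finset ℕ} (h : Dominated A C) (h' : Dominated C E) :
    Dominated A E := fun x => (h x).trans (h' x)

theorem Dominated.card_le {A C : Finset ℕ} (h : Dominated A C) : A.card ≤ C.card := by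
  simpa [sufCount_zero] using h 0

theorem excess_zero_eq_zero_iff {A C : Finset ℕ} : excess A C 0 = 0 ↔ Dominated A C := by
  constructor
  · intro h x
    have h1 := excess_antitone A C (Nat.zero_le x)
    have h2 := sufCount_le_add_excess A C x
    omega
  · intro h
    refine excess_eq_of_rec A C (fun _ => 0) 0 (fun _ _ => rfl) (fun x => ?_) 0
    have := h x
    simp; omega

/-- The unmatched elements of `A` when `A` is placed above `C`. -/
def unmatched (A C : Finset ℕ) : Finset ℕ := A.filter fun x => excess A C (x + 1) < excess A C x

theorem unmatched_subset (A C : Finset ℕ) : unmatched A C ⊆ A := Finset.filter_subset _ _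

theorem excess_lt_imp {A C : Finset ℕ} {x : ℕ} (h : excess A C (x + 1) < excess A C x) :
    x ∈ A ∧ x ∉ C := by
  have h1 := sufCount_le_add_excess A C (x + 1)
  have h2 := sufCount_succ A x
  have h3 := sufCount_succ C x
  rw [excess_succ A C x] at h
  split_ifs at h2 h3 <;> simp_all <;> omega

theorem disjoint_unmatched (A C : Finset ℕ) : Disjoint C (unmatched A C) := by
  rw [Finset.disjoint_right]
  intro x hx
  exact (excess_lt_imp (Finset.mem_filter.1 hx).2).2

theorem sufCount_unmatched (A C : Finset ℕ) (x : ℕ) :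
    sufCount (unmatched A C) x = excess A C x := by
  induction x using downward_induction (N := A.sup id + 1) with
  | base x hx =>
    rw [excess_eq_zero _ _ hx]
    have := sufCount_mono (unmatched_subset A C) x
    rw [sufCount_eq_zero A hx] at this
    omega
  | step x ih =>
    rw [sufCount_succ, ih]
    have h1 := excess_le_succ A C x
    have h2 := excess_antitone A C (Nat.le_succ x)
    simp only [Nat.succ_eq_add_one] at h2
    by_cases h : excess A C (x + 1) < excess A C x
    · have hx : x ∈ unmatched A C := Finset.mem_filter.2 ⟨(excess_lt_imp h).1, h⟩
      rw [if_pos hx]; omega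
    · have hx : x ∉ unmatched A C := fun hh => h (Finset.mem_filter.1 hh).2
      rw [if_neg hx]; omega

/-- The upper row after the unmatched balls of `A` have dropped to the row `C` below. -/
def upperRow (A C : Finset ℕ) : Finset ℕ := A \ unmatched A C

/-- The lower row after the unmatched balls of `A` have dropped to the row `C` below. -/
def lowerRow (A C : Finset ℕ) : Finset ℕ := C ∪ unmatched A C

theorem sufCount_upperRow (A C : Finset ℕ) (x : ℕ) :
    sufCount (upperRow A C) x + excess A C x = sufCount A x := by
  rw [← sufCount_unmatched]; exact sufCount_sdiff (unmatched_subset A C) x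

theorem sufCount_lowerRow (A C : Finset ℕ) (x : ℕ) :
    sufCount (lowerRow A C) x = sufCount C x + excess A C x := by
  rw [← sufCount_unmatched]; exact sufCount_union (disjoint_unmatched A C) x

theorem card_upperRow (A C : Finset ℕ) : (upperRow A C).card + excess A C 0 = A.card := by
  rw [← sufCount_zero, sufCount_upperRow, sufCount_zero]

theorem card_lowerRow (A C : Finset ℕ) : (lowerRow A C).card = C.card + excess A C 0 := by
  rw [← sufCount_zero, sufCount_lowerRow, sufCount_zero]

theorem upperRow_dominated (A C : Finset ℕ) : Dominated (upperRow A C) C := fun x => by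
  have := sufCount_upperRow A C x
  have := sufCount_le_add_excess A C x
  omega

theorem dominated_lowerRow (A C : Finset ℕ) : Dominated C (lowerRow A C) := fun x => by
  rw [sufCount_lowerRow]; omega

theorem upperRow_dominated_lowerRow (A C : Finset ℕ) : Dominated (upperRow A C) (lowerRow A C) :=
  (upperRow_dominated A C).trans (dominated_lowerRow A C)

/-- Nothing drops onto a dominating row. -/
theorem drop_of_dominated {A C : Finset ℕ} (h : Dominated A C) :
    upperRow A C = A ∧ lowerRow A C = C := by
  have h0 : unmatched A C = ∅ := by
    rw [← Finset.card_eq_zero, ← sufCount_zero, sufCount_unmatched, excess_zero_eq_zero_iff]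
    exact h
  simp [upperRow, lowerRow, h0]

/-- The excess can be read from the two rows after the drop, up to the number of dropped balls. -/
theorem excess_succ_eq_min (A C : Finset ℕ) (x : ℕ) :
    excess A C (x + 1) = min (excess A C x)
      (sufCount (lowerRow A C) (x + 1) - sufCount (upperRow A C) (x + 1)) := by
  have h1 := sufCount_le_add_excess A C (x + 1)
  have h2 := sufCount_succ A x
  have h3 := sufCount_succ C x
  have h4 := excess_succ A C x
  have h5 := sufCount_upperRow A C (x + 1)
  have h6 := sufCount_lowerRow A C (x + 1)
  split_ifs at h2 h3 <;> omega

/-- Dropping is injective once the number of dropped balls is known. -/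
theorem drop_injective {A C A' C' : Finset ℕ} (hu : upperRow A C = upperRow A' C')
    (hl : lowerRow A C = lowerRow A' C') (h0 : excess A C 0 = excess A' C' 0) :
    A = A' ∧ C = C' := by
  have h : ∀ x, excess A C x = excess A' C' x := by
    intro x
    induction x with
    | zero => exact h0
    | succ x ih => rw [excess_succ_eq_min, excess_succ_eq_min A', ih, hu, hl]
  constructor <;> apply sufCount_injective <;> funext x
  · rw [← sufCount_upperRow A C, ← sufCount_upperRow A' C', hu, h]
  · have h1 := sufCount_lowerRow A C x
    have h2 := sufCount_lowerRow A' C' x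
    rw [hl, h] at h1
    omega

/-- Undoing a drop of `s` balls.  The number `m x` of balls at columns at least `x` which are moved
up is the minimum of `s` and of the differences of the suffix counts at the columns `y ≤ x`. -/
theorem exists_drop_eq {A C : Finset ℕ} (h : Dominated A C) {s : ℕ} (hs : A.card + s ≤ C.card) :
    ∃ A₀ C₀, upperRow A₀ C₀ = A ∧ lowerRow A₀ C₀ = C ∧ excess A₀ C₀ 0 = s := by
  let d : ℕ → ℕ := fun x => sufCount C x - sufCount A x
  let m : ℕ → ℕ := fun x => Nat.rec s (fun x mx => min mx (d (x + 1))) x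
  have m0 : m 0 = s := rfl
  have m1 : ∀ x, m (x + 1) = min (m x) (d (x + 1)) := fun x => rfl
  have hdd : ∀ x, sufCount C x = sufCount A x + d x := fun x => by have := h x; simp only [d]; omega
  have hd0 : d 0 = C.card - A.card := by simp only [d, sufCount_zero]
  have hmd : ∀ x, m x ≤ d x := by
    intro x
    cases x with
    | zero => omega
    | succ x => rw [m1]; exact min_le_right _ _
  have hd : ∀ x, d x ≤ d (x + 1) + 1 := fun x => by
    have h1 := hdd x
    have h2 := hdd (x + 1)
    have h3 := sufCount_succ A x
    have h4 := sufCount_succ C x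
    split_ifs at h3 h4 <;> omega
  have hN : ∀ x, C.sup id + 1 ≤ x → m x = 0 := by
    intro x hx
    have h1 := hmd x
    have h2 : d x = 0 := by simp [d, sufCount_eq_zero C hx]
    omega
  obtain ⟨V, hV⟩ := exists_sufCount_eq m _ hN (fun x => by
    have := m1 x; have := hmd x; have := hd x; omega)
  have hVm : ∀ x ∈ V, x ∈ C ∧ x ∉ A := by
    intro x hx
    rw [mem_iff_sufCount, hV, hV] at hx
    have h1 := hdd x
    have h2 := hdd (x + 1)
    have h3 := sufCount_succ A x
    have h4 := sufCount_succ C x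
    have h5 := m1 x
    have h6 := hmd x
    split_ifs at h3 h4 with h7 h8 h8
    · omega
    · omega
    · exact ⟨h8, h7⟩
    · omega
  have hVC : V ⊆ C := fun x hx => (hVm x hx).1
  have hVA : Disjoint A V := Finset.disjoint_right.2 fun x hx => (hVm x hx).2
  have hexc : ∀ x, excess (A ∪ V) (C \ V) x = m x := by
    apply excess_eq_of_rec _ _ _ _ hN
    intro x
    have h1 := sufCount_union hVA x
    have h2 := sufCount_sdiff hVC x
    rw [hV] at h1 h2
    have h3 := m1 x
    have h4 := hmd x
    have h5 := hd x
    have h6 := hdd x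
    omega
  refine ⟨A ∪ V, C \ V, ?_, ?_, by rw [hexc, m0]⟩
  · apply sufCount_injective
    funext x
    have h1 := sufCount_union hVA x
    have h2 := sufCount_upperRow (A ∪ V) (C \ V) x
    rw [hexc] at h2
    rw [hV] at h1
    omega
  · apply sufCount_injective
    funext x
    have h1 := sufCount_sdiff hVC x
    have h2 := sufCount_lowerRow (A ∪ V) (C \ V) x
    rw [hexc] at h2
    rw [hV] at h1
    omega

/-- A lower bound for the excess in terms of the rows after the drop. -/
theorem le_excess_of_le {A C : Finset ℕ} (f : ℕ → ℕ) (hf : Antitone f) (h0 : f 0 ≤ excess A C 0)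
    (h : ∀ x, sufCount (upperRow A C) x + f x ≤ sufCount (lowerRow A C) x) (x : ℕ) :
    f x ≤ excess A C x := by
  induction x with
  | zero => exact h0
  | succ x ih =>
    rw [excess_succ_eq_min]
    have h1 := h (x + 1)
    have h2 := hf (Nat.le_succ x)
    simp only [Nat.succ_eq_add_one] at h2
    omega

/-- If `A` is dominated by `C`, then at most `f` of the balls added to `A` drop out again. -/
theorem excess_le_of_dominated {A A' C : Finset ℕ} (f : ℕ → ℕ) (hf : Antitone f)
    (hA : ∀ x, sufCount A' x = sufCount A x + f x) (h : Dominated A C) (x : ℕ) :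
    excess A' C x ≤ f x := by
  induction x using downward_induction (N := A'.sup id + 1) with
  | base x hx => rw [excess_eq_zero _ _ hx]; omega
  | step x ih =>
    rw [excess_succ]
    have h1 := h x
    have h2 := hA x
    have h3 := hf (Nat.le_succ x)
    simp only [Nat.succ_eq_add_one] at h3
    omega

/-! ### The braid relation -/

/-- One column of the braid relation.  The column has `α`, `β`, `γ` balls in the three rows, the
numbers `k` count the unmatched balls of the lower row to the right of this column, and the numbers
`u` and `v` tell whether the ball of this column drops, along the two sides of the relation. -/
theorem braid_column {k₁ k₂ k₃ α β γ u₁ u₂ u₃ v₁ v₂ v₃ : ℕ} (hα : α ≤ 1) (hβ : β ≤ 1) (hγ : γ ≤ 1)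
    (hu₁ : (u₁ = 1 ∧ β = 1 ∧ γ = 0 ∧ k₁ = 0) ∨ (u₁ = 0 ∧ (β = 0 ∨ γ = 1 ∨ 0 < k₁)))
    (hu₂ : (u₂ = 1 ∧ α = 1 ∧ β - u₁ = 0 ∧ k₂ = 0) ∨ (u₂ = 0 ∧ (α = 0 ∨ β - u₁ = 1 ∨ 0 < k₂)))
    (hu₃ : (u₃ = 1 ∧ β - u₁ + u₂ = 1 ∧ γ + u₁ = 0 ∧ k₃ = 0) ∨
      (u₃ = 0 ∧ (β - u₁ + u₂ = 0 ∨ γ + u₁ = 1 ∨ 0 < k₃)))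
    (hv₁ : (v₁ = 1 ∧ α = 1 ∧ β = 0 ∧ k₂ + (k₃ - k₁) = 0) ∨
      (v₁ = 0 ∧ (α = 0 ∨ β = 1 ∨ 0 < k₂ + (k₃ - k₁))))
    (hv₂ : (v₂ = 1 ∧ β + v₁ = 1 ∧ γ = 0 ∧ min k₁ k₃ = 0) ∨
      (v₂ = 0 ∧ (β + v₁ = 0 ∨ γ = 1 ∨ 0 < min k₁ k₃)))
    (hv₃ : (v₃ = 1 ∧ α - v₁ = 1 ∧ β + v₁ - v₂ = 0 ∧ k₂ + (k₁ - k₃) = 0) ∨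
      (v₃ = 0 ∧ (α - v₁ = 0 ∨ β + v₁ - v₂ = 1 ∨ 0 < k₂ + (k₁ - k₃)))) :
    v₂ = u₁ + u₃ ∧ v₁ + v₃ = u₂ ∧
      v₁ + (k₁ - k₃) = u₃ + (k₁ + γ + u₁ - β - (k₃ + (γ + u₁) + u₃ - (β - u₁ + u₂))) := by
  interval_cases β <;> interval_cases γ <;> interval_cases α <;>
    rcases hu₁ with ⟨rfl, hu₁⟩ | ⟨rfl, hu₁⟩ <;> omega

/-- The excess at column `x`, where `k` is the number of unmatched balls of `C` to the right of `x`
and column `x` has `α` balls in `A` and `γ` balls in `C`. -/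
theorem excess_step {A C : Finset ℕ} {x α γ k : ℕ} (hα : sufCount A x = sufCount A (x + 1) + α)
    (hγ : sufCount C x = sufCount C (x + 1) + γ)
    (hk : sufCount C (x + 1) + excess A C (x + 1) = sufCount A (x + 1) + k) :
    ∃ u, excess A C x = excess A C (x + 1) + u ∧
      ((u = 1 ∧ α = 1 ∧ γ = 0 ∧ k = 0) ∨ (u = 0 ∧ (α = 0 ∨ γ = 1 ∨ 0 < k))) := by
  refine ⟨excess A C x - excess A C (x + 1), ?_⟩
  have h1 := sufCount_succ A x
  have h2 := sufCount_succ C x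
  have h4 := excess_succ A C x
  split_ifs at h1 h2 <;> omega

theorem exists_sufCount_succ (A : Finset ℕ) (x : ℕ) :
    ∃ α ≤ 1, sufCount A x = sufCount A (x + 1) + α := by
  refine ⟨_, ?_, sufCount_succ A x⟩
  split_ifs <;> omega

/-- The numbers of dropped balls along the two sides of the braid relation determine each other.
The three identities are proved together from right to left: those for the columns to the right of
`x` express the unmatched balls along one side by those along the other, which reduces each step to
`braid_column`. -/
theorem braid_excess (A B C : Finset ℕ) (x : ℕ) :
    let B₁ := upperRow B C
    let C₁ := lowerRow B C
    let B₂ := lowerRow A B₁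
    let A₁ := upperRow A B
    let B₁' := lowerRow A B
    let B₂' := upperRow B₁' C
    excess A B x = max (excess B₂ C₁ x) (excess A B₁ x - excess B C x) ∧
      excess B₁' C x = excess B C x + excess B₂ C₁ x ∧
      excess A B x + excess A₁ B₂' x = excess A B₁ x := by
  intro B₁ C₁ B₂ A₁ B₁' B₂'
  induction x using downward_induction
    (N := ((A ∪ B ∪ C ∪ B₂ ∪ A₁ ∪ B₁')).sup id + 1) with
  | base x hx =>
    have e : ∀ S : Finset ℕ, S ⊆ A ∪ B ∪ C ∪ B₂ ∪ A₁ ∪ B₁' → S.sup id + 1 ≤ x := fun S hS =>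
      le_trans (Nat.succ_le_succ (Finset.sup_mono hS)) hx
    have hA := e A (by intro y; simp; tauto)
    have hB := e B (by intro y; simp; tauto)
    have hB₂ := e B₂ (by intro y; simp; tauto)
    have hA₁ := e A₁ (by intro y; simp; tauto)
    have hB₁' := e B₁' (by intro y; simp; tauto)
    rw [excess_eq_zero _ _ hA, excess_eq_zero _ _ hA, excess_eq_zero _ _ hB,
      excess_eq_zero _ _ hB₂, excess_eq_zero _ _ hA₁, excess_eq_zero _ _ hB₁']
    simp
  | step x ih =>
    obtain ⟨i1, i2, i3⟩ := ih
    obtain ⟨α, hα, a⟩ := exists_sufCount_succ A x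
    obtain ⟨β, hβ, b⟩ := exists_sufCount_succ B x
    obtain ⟨γ, hγ, c⟩ := exists_sufCount_succ C x
    have b1 : ∀ y, sufCount B₁ y + _ = _ := sufCount_upperRow B C
    have c1 : ∀ y, sufCount C₁ y = _ := sufCount_lowerRow B C
    have b2 : ∀ y, sufCount B₂ y = _ := sufCount_lowerRow A B₁
    have a1 : ∀ y, sufCount A₁ y + _ = _ := sufCount_upperRow A B
    have b1' : ∀ y, sufCount B₁' y = _ := sufCount_lowerRow A B
    have b2' : ∀ y, sufCount B₂' y + _ = _ := sufCount_upperRow B₁' C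
    have b1s := b1 (x + 1)
    have c1s := c1 (x + 1)
    have b2s := b2 (x + 1)
    have a1s := a1 (x + 1)
    have b1s' := b1' (x + 1)
    have b2s' := b2' (x + 1)
    obtain ⟨k₁, hk₁⟩ := Nat.exists_eq_add_of_le (sufCount_le_add_excess B C (x + 1))
    obtain ⟨k₂, hk₂⟩ := Nat.exists_eq_add_of_le (sufCount_le_add_excess A B₁ (x + 1))
    obtain ⟨k₃, hk₃⟩ := Nat.exists_eq_add_of_le (sufCount_le_add_excess B₂ C₁ (x + 1))
    clear_value B₁ C₁ B₂ A₁ B₁' B₂'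
    have hI : excess A B₁ (x + 1) + k₃ = excess B C (x + 1) + excess B₂ C₁ (x + 1) + k₁ := by
      clear * - hk₁ hk₂ hk₃ b1s c1s b2s; omega
    have hE : excess A B (x + 1) = excess B₂ C₁ (x + 1) + (k₁ - k₃) := by
      clear * - hI i1; omega
    have hk1 : sufCount B (x + 1) + excess A B (x + 1) = sufCount A (x + 1) + (k₂ + (k₃ - k₁)) := by
      clear * - hk₁ hk₂ hI hE b1s; omega
    have hk2 : sufCount C (x + 1) + excess B₁' C (x + 1) = sufCount B₁' (x + 1) + min k₁ k₃ := by
      clear * - hk₁ hE i2 b1s'; omega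
    have hk3 : sufCount B₂' (x + 1) + excess A₁ B₂' (x + 1) =
        sufCount A₁ (x + 1) + (k₂ + (k₁ - k₃)) := by
      clear * - hk₁ hk₂ hI hE i2 i3 b1s b1s' a1s b2s'; omega
    clear i1
    -- the two sides of the relation, one drop after the other
    obtain ⟨u₁, hp, hu₁⟩ := excess_step b c hk₁
    have b1x : sufCount B₁ x = sufCount B₁ (x + 1) + (β - u₁) := by
      have := b1 x; clear * - this b1s b hp hu₁; omega
    have c1x : sufCount C₁ x = sufCount C₁ (x + 1) + (γ + u₁) := by
      rw [c1, c1]; clear * - c hp; omega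
    obtain ⟨u₂, hq, hu₂⟩ := excess_step a b1x hk₂
    have b2x : sufCount B₂ x = sufCount B₂ (x + 1) + (β - u₁ + u₂) := by
      rw [b2, b2]; clear * - b1x hq; omega
    obtain ⟨u₃, hr, hu₃⟩ := excess_step b2x c1x hk₃
    obtain ⟨v₁, hp', hv₁⟩ := excess_step a b hk1
    have a1x : sufCount A₁ x = sufCount A₁ (x + 1) + (α - v₁) := by
      have := a1 x; clear * - this a1s a hp' hv₁; omega
    have b1x' : sufCount B₁' x = sufCount B₁' (x + 1) + (β + v₁) := by
      rw [b1', b1']; clear * - b hp'; omega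
    obtain ⟨v₂, hq', hv₂⟩ := excess_step b1x' c hk2
    have b2x' : sufCount B₂' x = sufCount B₂' (x + 1) + (β + v₁ - v₂) := by
      have := b2' x
      clear * - this b2s' b1x' hq' hv₂; omega
    obtain ⟨v₃, hr', hv₃⟩ := excess_step a1x b2x' hk3
    obtain ⟨e1, e2, e3⟩ := braid_column hα hβ hγ hu₁ hu₂ hu₃ hv₁ hv₂ hv₃
    have hβu : u₁ ≤ β ∧ u₁ ≤ 1 := by clear * - hu₁; omega
    have hβu' : β - u₁ + u₂ ≤ k₃ + (γ + u₁) + u₃ := by clear * - hβ hu₁ hu₂ hu₃; omega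
    have hβu'' : β ≤ k₁ + γ + u₁ := by clear * - hu₁ hβ; omega
    rw [hp, hq, hr, hp', hq', hr']
    refine ⟨?_, by clear * - i2 e1; omega, by clear * - i3 e2; omega⟩
    rw [hE]
    have e4 : excess A B₁ (x + 1) + u₂ + (k₃ + (γ + u₁) + u₃ - (β - u₁ + u₂)) =
        excess B C (x + 1) + u₁ + (excess B₂ C₁ (x + 1) + u₃) + (k₁ + γ + u₁ - β) := by
      clear * - hI hβu hβu' hβu''; omega
    clear * - e3 e4
    omega

/-- The braid relation for three rows `A`, `B`, `C` from top to bottom. -/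
theorem braid_rows (A B C : Finset ℕ) :
    upperRow (upperRow A B) (upperRow (lowerRow A B) C) = upperRow A (upperRow B C) ∧
    lowerRow (upperRow A B) (upperRow (lowerRow A B) C) =
      upperRow (lowerRow A (upperRow B C)) (lowerRow B C) ∧
    lowerRow (lowerRow A B) C = lowerRow (lowerRow A (upperRow B C)) (lowerRow B C) := by
  have key := braid_excess A B C
  simp only at key
  refine ⟨?_, ?_, ?_⟩ <;> apply sufCount_injective <;> funext x <;> obtain ⟨-, k2, k3⟩ := key x
  · have h1 := sufCount_upperRow (upperRow A B) (upperRow (lowerRow A B) C) x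
    have h2 := sufCount_upperRow A B x
    have h3 := sufCount_upperRow A (upperRow B C) x
    omega
  · have h1 := sufCount_lowerRow (upperRow A B) (upperRow (lowerRow A B) C) x
    have h2 := sufCount_upperRow (lowerRow A B) C x
    have h3 := sufCount_lowerRow A B x
    have h4 := sufCount_upperRow (lowerRow A (upperRow B C)) (lowerRow B C) x
    have h5 := sufCount_lowerRow A (upperRow B C) x
    have h6 := sufCount_upperRow B C x
    omega
  · have h1 := sufCount_lowerRow (lowerRow A B) C x
    have h3 := sufCount_lowerRow A B x
    have h4 := sufCount_lowerRow (lowerRow A (upperRow B C)) (lowerRow B C) x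
    have h5 := sufCount_lowerRow B C x
    have h6 := sufCount_lowerRow A (upperRow B C) x
    omega

/-! ### Words of dropping operators -/

/-- A sequence of rows, each given by the set of the columns of its balls. -/
abbrev Rows : Type := ℕ → Finset ℕ

/-- The operator which drops the unmatched balls of row `i + 1` to row `i`. -/
def dropRow (i : ℕ) (B : Rows) : Rows := fun r =>
  if r = i + 1 then upperRow (B (i + 1)) (B i)
  else if r = i then lowerRow (B (i + 1)) (B i)
  else B r

/-- The number of balls which drop from row `i + 1` to row `i`. -/
def dropCount (i : ℕ) (B : Rows) : ℕ := excess (B (i + 1)) (B i) 0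

theorem dropRow_succ (i : ℕ) (B : Rows) :
    dropRow i B (i + 1) = upperRow (B (i + 1)) (B i) := by simp [dropRow]

theorem dropRow_self (i : ℕ) (B : Rows) : dropRow i B i = lowerRow (B (i + 1)) (B i) := by
  simp [dropRow]

theorem dropRow_of_ne {i r : ℕ} (B : Rows) (h : r ≠ i + 1) (h' : r ≠ i) :
    dropRow i B r = B r := by
  simp [dropRow, h, h']

theorem card_dropRow_succ (i : ℕ) (B : Rows) :
    (dropRow i B (i + 1)).card + dropCount i B = (B (i + 1)).card := by
  rw [dropRow_succ]; exact card_upperRow _ _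

theorem card_dropRow_self (i : ℕ) (B : Rows) :
    (dropRow i B i).card = (B i).card + dropCount i B := by
  rw [dropRow_self]; exact card_lowerRow _ _

/-- The result of the operators of a word; the head of the word acts first. -/
def runWord (w : List ℕ) (B : Rows) : Rows := w.foldl (fun B i => dropRow i B) B

theorem runWord_nil (B : Rows) : runWord [] B = B := rfl

theorem runWord_cons (i : ℕ) (w : List ℕ) (B : Rows) :
    runWord (i :: w) B = runWord w (dropRow i B) := rfl

theorem runWord_append (u v : List ℕ) (B : Rows) :
    runWord (u ++ v) B = runWord v (runWord u B) := List.foldl_append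

theorem runWord_of_forall {w : List ℕ} {r : ℕ} (h : ∀ i ∈ w, r ≠ i + 1 ∧ r ≠ i) (B : Rows) :
    runWord w B r = B r := by
  induction w generalizing B with
  | nil => rfl
  | cons i w ih =>
    rw [runWord_cons, ih (fun j hj => h j (List.mem_cons_of_mem _ hj)),
      dropRow_of_ne _ (h i List.mem_cons_self).1 (h i List.mem_cons_self).2]

/-- The rows of `B` and `B'` have the same sizes, and this remains true after each letter of the
word `w`. -/
def SameSizes : List ℕ → Rows → Rows → Prop
  | [], B, B' => ∀ r, (B r).card = (B' r).card
  | i :: w, B, B' => (∀ r, (B r).card = (B' r).card) ∧ SameSizes w (dropRow i B) (dropRow i B')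

theorem SameSizes.card_eq {w : List ℕ} {B B' : Rows} (h : SameSizes w B B') (r : ℕ) :
    (B r).card = (B' r).card := by
  cases w with
  | nil => exact h r
  | cons i w => exact h.1 r

theorem sameSizes_append {u v : List ℕ} {B B' : Rows} :
    SameSizes (u ++ v) B B' ↔ SameSizes u B B' ∧ SameSizes v (runWord u B) (runWord u B') := by
  induction u generalizing B B' with
  | nil => exact ⟨fun h => ⟨h.card_eq, h⟩, fun h => h.2⟩
  | cons i u ih => simp only [List.cons_append, SameSizes, ih, runWord_cons, and_assoc]

theorem card_dropRow_eq_iff {i : ℕ} {B B' : Rows} (h : ∀ r, (B r).card = (B' r).card) :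
    (∀ r, (dropRow i B r).card = (dropRow i B' r).card) ↔ dropCount i B = dropCount i B' := by
  have h1 := card_dropRow_self i B
  have h2 := card_dropRow_self i B'
  have h3 := card_dropRow_succ i B
  have h4 := card_dropRow_succ i B'
  have h5 := h i
  have h6 := h (i + 1)
  constructor
  · intro hh
    have := hh i
    omega
  · intro hh r
    by_cases hr : r = i + 1
    · subst hr; omega
    by_cases hr' : r = i
    · subst hr'; omega
    rw [dropRow_of_ne _ hr hr', dropRow_of_ne _ hr hr', h]

theorem sameSizes_cons {i : ℕ} {w : List ℕ} {B B' : Rows} :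
    SameSizes (i :: w) B B' ↔ (∀ r, (B r).card = (B' r).card) ∧ dropCount i B = dropCount i B' ∧
      SameSizes w (dropRow i B) (dropRow i B') := by
  constructor
  · rintro ⟨h, h'⟩
    exact ⟨h, (card_dropRow_eq_iff h).1 h'.card_eq, h'⟩
  · rintro ⟨h, -, h'⟩
    exact ⟨h, h'⟩

theorem sameSizes_cons' {i : ℕ} {w : List ℕ} {B B' : Rows} (h : ∀ r, (B r).card = (B' r).card) :
    SameSizes (i :: w) B B' ↔ dropCount i B = dropCount i B' ∧
      SameSizes w (dropRow i B) (dropRow i B') := by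
  rw [sameSizes_cons]; simp [h]

/-- Two words are equivalent if they have the same action and the sizes of the rows along one of
them determine those along the other. -/
def WordEquiv (w w' : List ℕ) : Prop :=
  (∀ B, runWord w B = runWord w' B) ∧ ∀ B B', SameSizes w B B' ↔ SameSizes w' B B'

theorem WordEquiv.refl (w : List ℕ) : WordEquiv w w := ⟨fun _ => rfl, fun _ _ => Iff.rfl⟩

theorem WordEquiv.symm {w w' : List ℕ} (h : WordEquiv w w') : WordEquiv w' w :=
  ⟨fun B => (h.1 B).symm, fun B B' => (h.2 B B').symm⟩

theorem WordEquiv.trans {w w' w'' : List ℕ} (h : WordEquiv w w') (h' : WordEquiv w' w'') :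
    WordEquiv w w'' :=
  ⟨fun B => (h.1 B).trans (h'.1 B), fun B B' => (h.2 B B').trans (h'.2 B B')⟩

theorem WordEquiv.append {u u' v v' : List ℕ} (h : WordEquiv u u') (h' : WordEquiv v v') :
    WordEquiv (u ++ v) (u' ++ v') :=
  ⟨fun B => by rw [runWord_append, runWord_append, h.1, h'.1],
    fun B B' => by rw [sameSizes_append, sameSizes_append, h.2, h.1, h.1, h'.2]⟩

theorem WordEquiv.cons (i : ℕ) {v v' : List ℕ} (h : WordEquiv v v') :
    WordEquiv (i :: v) (i :: v') :=
  (WordEquiv.refl [i]).append h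

theorem dropRow_comm {i j : ℕ} (h : i + 2 ≤ j) (B : Rows) :
    dropRow i (dropRow j B) = dropRow j (dropRow i B) := by
  funext r
  simp only [dropRow]
  grind

theorem dropCount_dropRow_of_lt {i j : ℕ} (h : i + 2 ≤ j) (B : Rows) :
    dropCount i (dropRow j B) = dropCount i B ∧ dropCount j (dropRow i B) = dropCount j B := by
  constructor <;> unfold dropCount <;>
    rw [dropRow_of_ne _ (by omega) (by omega), dropRow_of_ne _ (by omega) (by omega)]

theorem wordEquiv_comm {i j : ℕ} (h : i + 2 ≤ j) : WordEquiv [i, j] [j, i] := by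
  refine ⟨fun B => (dropRow_comm h B).symm, fun B B' => ?_⟩
  by_cases hs : ∀ r, (B r).card = (B' r).card
  · have h1 := dropCount_dropRow_of_lt h B
    have h2 := dropCount_dropRow_of_lt h B'
    simp only [sameSizes_cons, h1, h2, dropRow_comm h]
    have hi := card_dropRow_eq_iff (i := i) hs
    have hj := card_dropRow_eq_iff (i := j) hs
    tauto
  · exact ⟨fun h => absurd h.card_eq hs, fun h => absurd h.card_eq hs⟩

theorem dropRow_braid (i : ℕ) (B : Rows) :
    dropRow i (dropRow (i + 1) (dropRow i B)) =
      dropRow (i + 1) (dropRow i (dropRow (i + 1) B)) := by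
  obtain ⟨h1, h2, h3⟩ := braid_rows (B (i + 1 + 1)) (B (i + 1)) (B i)
  have n1 : ∀ m : ℕ, m + 1 + 1 ≠ m := fun m => by omega
  have n2 : ∀ m : ℕ, m ≠ m + 1 + 1 := fun m => by omega
  funext r
  by_cases hr : r = i + 1 + 1
  · subst hr; simp [dropRow, h1, n1, n2]
  by_cases hr : r = i + 1
  · subst hr; simp [dropRow, h2, n1, n2]
  by_cases hr : r = i
  · subst hr; simp [dropRow, h3, n1, n2]
  simp [dropRow, *]

theorem wordEquiv_braid (i : ℕ) : WordEquiv [i, i + 1, i] [i + 1, i, i + 1] := by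
  refine ⟨fun B => dropRow_braid i B, fun B B' => ?_⟩
  have key : ∀ B : Rows,
      dropCount (i + 1) B = max (dropCount i (dropRow (i + 1) (dropRow i B)))
        (dropCount (i + 1) (dropRow i B) - dropCount i B) ∧
      dropCount i (dropRow (i + 1) B) =
        dropCount i B + dropCount i (dropRow (i + 1) (dropRow i B)) ∧
      dropCount (i + 1) B + dropCount (i + 1) (dropRow i (dropRow (i + 1) B)) =
        dropCount (i + 1) (dropRow i B) := fun B => by
    have hA : ∀ X : Rows, dropRow (i + 1) X i = X i := fun X =>
      dropRow_of_ne X (by omega) (by omega)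
    have hB : ∀ X : Rows, dropRow i X (i + 1 + 1) = X (i + 1 + 1) := fun X =>
      dropRow_of_ne X (by omega) (by omega)
    simp only [dropCount, dropRow_succ, dropRow_self, hA, hB]
    exact braid_excess (B (i + 1 + 1)) (B (i + 1)) (B i) 0
  have k := key B
  have k' := key B'
  constructor
  · intro h
    simp only [sameSizes_cons] at h
    obtain ⟨h0, h1, h2, h3, h4, h5, h6⟩ := h
    have e1 : dropCount (i + 1) B = dropCount (i + 1) B' := by omega
    rw [sameSizes_cons' h0]
    refine ⟨e1, ?_⟩
    rw [sameSizes_cons' ((card_dropRow_eq_iff h0).2 e1)]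
    have e2 : dropCount i (dropRow (i + 1) B) = dropCount i (dropRow (i + 1) B') := by omega
    refine ⟨e2, ?_⟩
    rw [sameSizes_cons' ((card_dropRow_eq_iff ((card_dropRow_eq_iff h0).2 e1)).2 e2)]
    refine ⟨by omega, ?_⟩
    rw [← dropRow_braid, ← dropRow_braid]
    exact h6
  · intro h
    simp only [sameSizes_cons] at h
    obtain ⟨h0, h1, h2, h3, h4, h5, h6⟩ := h
    have e1 : dropCount i B = dropCount i B' := by omega
    rw [sameSizes_cons' h0]
    refine ⟨e1, ?_⟩
    rw [sameSizes_cons' ((card_dropRow_eq_iff h0).2 e1)]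
    have e2 : dropCount (i + 1) (dropRow i B) = dropCount (i + 1) (dropRow i B') := by omega
    refine ⟨e2, ?_⟩
    rw [sameSizes_cons' ((card_dropRow_eq_iff ((card_dropRow_eq_iff h0).2 e1)).2 e2)]
    refine ⟨by omega, ?_⟩
    rw [dropRow_braid, dropRow_braid]
    exact h6

theorem dropRow_of_dominated {i : ℕ} {B : Rows} (h : Dominated (B (i + 1)) (B i)) :
    dropRow i B = B := by
  funext r
  obtain ⟨h1, h2⟩ := drop_of_dominated h
  simp only [dropRow, h1, h2]
  split_ifs <;> simp_all

theorem dominated_dropRow (i : ℕ) (B : Rows) :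
    Dominated (dropRow i B (i + 1)) (dropRow i B i) := by
  rw [dropRow_succ, dropRow_self]
  exact upperRow_dominated_lowerRow _ _

theorem wordEquiv_idem (i : ℕ) : WordEquiv [i, i] [i] := by
  have key : ∀ B, dropRow i (dropRow i B) = dropRow i B := fun B =>
    dropRow_of_dominated (dominated_dropRow i B)
  refine ⟨fun B => key B, fun B B' => ?_⟩
  simp only [SameSizes, key]
  tauto

/-- The word `[k, …, 2, 1]`. -/
def sweepWord : ℕ → List ℕ
  | 0 => []
  | k + 1 => (k + 1) :: sweepWord k

/-- The word of the operators which collapse the bottom `k` rows. -/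
def collapseWord : ℕ → List ℕ
  | 0 => []
  | k + 1 => collapseWord k ++ sweepWord k

theorem mem_sweepWord {k i : ℕ} : i ∈ sweepWord k ↔ 1 ≤ i ∧ i ≤ k := by
  induction k with
  | zero => simp [sweepWord]; omega
  | succ k ih => simp [sweepWord, ih]; omega

theorem mem_collapseWord {k i : ℕ} (h : i ∈ collapseWord k) : 1 ≤ i ∧ i + 1 ≤ k := by
  induction k with
  | zero => simp [collapseWord] at h
  | succ k ih =>
    simp only [collapseWord, List.mem_append, mem_sweepWord] at h
    rcases h with h | h
    · have := ih h; omega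
    · omega

theorem wordEquiv_cons_comm {j : ℕ} {w : List ℕ} (h : ∀ i ∈ w, i + 2 ≤ j) :
    WordEquiv (j :: w) (w ++ [j]) := by
  induction w with
  | nil => exact WordEquiv.refl _
  | cons i w ih =>
    have h1 : WordEquiv (j :: i :: w) (i :: j :: w) :=
      (wordEquiv_comm (h i List.mem_cons_self)).symm.append (WordEquiv.refl w)
    exact h1.trans ((ih fun k hk => h k (List.mem_cons_of_mem _ hk)).cons i)

theorem wordEquiv_sweep_sweep_cons (k : ℕ) :
    WordEquiv (sweepWord (k + 1) ++ sweepWord (k + 2))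
      ((k + 1) :: (k + 2) :: (sweepWord k ++ sweepWord (k + 1))) := by
  have h : WordEquiv (sweepWord k ++ [k + 2]) ((k + 2) :: sweepWord k) :=
    (wordEquiv_cons_comm fun i hi => by have := mem_sweepWord.1 hi; omega).symm
  have h2 := (h.append (WordEquiv.refl (sweepWord (k + 1)))).cons (k + 1)
  simpa [sweepWord] using h2

/-- The operator on the two topmost rows is absorbed by the last two sweeps: it is carried through
them by braid relations until it becomes a repetition. -/
theorem wordEquiv_absorb_sweeps (k : ℕ) :
    WordEquiv ((k + 1) :: (sweepWord k ++ sweepWord (k + 1)))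
      (sweepWord k ++ sweepWord (k + 1)) := by
  induction k with
  | zero => exact wordEquiv_idem 1
  | succ k ih =>
    have h1 := (wordEquiv_sweep_sweep_cons k).cons (k + 2)
    have h2 : WordEquiv ((k + 2) :: (k + 1) :: (k + 2) :: (sweepWord k ++ sweepWord (k + 1)))
        ((k + 1) :: (k + 2) :: (k + 1) :: (sweepWord k ++ sweepWord (k + 1))) :=
      (wordEquiv_braid (k + 1)).symm.append (WordEquiv.refl _)
    have h3 := (ih.cons (k + 2)).cons (k + 1)
    exact ((h1.trans h2).trans h3).trans (wordEquiv_sweep_sweep_cons k).symm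

/-- Collapsing absorbs each of the operators of which it is composed. -/
theorem wordEquiv_absorb {L i : ℕ} (h1 : 1 ≤ i) (h2 : i < L) :
    WordEquiv (i :: collapseWord L) (collapseWord L) := by
  induction L with
  | zero => omega
  | succ L ih =>
    by_cases hi : i < L
    · exact (ih hi).append (WordEquiv.refl (sweepWord L))
    · obtain ⟨k, rfl⟩ : ∃ k, L = k + 1 := ⟨L - 1, by omega⟩
      obtain rfl : i = k + 1 := by omega
      have h : WordEquiv ((k + 1) :: collapseWord k) (collapseWord k ++ [k + 1]) :=
        wordEquiv_cons_comm fun i hi => by have := mem_collapseWord hi; omega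
      have h3 := h.append (WordEquiv.refl (sweepWord k ++ sweepWord (k + 1)))
      have h4 := (WordEquiv.refl (collapseWord k)).append (wordEquiv_absorb_sweeps k)
      simp only [collapseWord, List.append_assoc, List.cons_append, List.nil_append] at h3 h4 ⊢
      exact h3.trans h4

theorem SameSizes.dropCount_eq {L i : ℕ} {B B' : Rows} (h : SameSizes (collapseWord L) B B')
    (h1 : 1 ≤ i) (h2 : i < L) : dropCount i B = dropCount i B' :=
  (sameSizes_cons.1 (((wordEquiv_absorb h1 h2).2 B B').2 h)).2.1

/-- The relation of having the same sizes along the collapsing is preserved if the rows are modified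
in a way which is invisible after the drop from row `i + 1` to row `i`: this drop is absorbed by the
collapsing. -/
theorem SameSizes.of_dropRow_eq {L i : ℕ} {B B' E E' : Rows}
    (h : SameSizes (collapseWord L) B B') (h1 : 1 ≤ i) (h2 : i < L)
    (hE : dropRow i E = dropRow i B) (hE' : dropRow i E' = dropRow i B')
    (hs : ∀ r, (E r).card = (E' r).card) : SameSizes (collapseWord L) E E' := by
  have key := sameSizes_cons.1 (((wordEquiv_absorb h1 h2).2 B B').2 h)
  refine ((wordEquiv_absorb h1 h2).2 E E').1 ⟨hs, ?_⟩
  rw [hE, hE']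
  exact key.2.2

/-- The sizes before and after a sweep determine those in between. -/
theorem sameSizes_sweepWord {k : ℕ} {B B' : Rows} (h : ∀ r, (B r).card = (B' r).card)
    (h' : ∀ r, (runWord (sweepWord k) B r).card = (runWord (sweepWord k) B' r).card) :
    SameSizes (sweepWord k) B B' := by
  induction k generalizing B B' with
  | zero => exact h
  | succ k ih =>
    have h1 := h' (k + 2)
    simp only [sweepWord, runWord_cons] at h1
    have hw : ∀ i ∈ sweepWord k, k + 2 ≠ i + 1 ∧ k + 2 ≠ i := fun i hi => by
      have := mem_sweepWord.1 hi; omega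
    rw [runWord_of_forall hw, runWord_of_forall hw] at h1
    have h2 := card_dropRow_succ (k + 1) B
    have h3 := card_dropRow_succ (k + 1) B'
    have h4 := h (k + 2)
    have h5 : dropCount (k + 1) B = dropCount (k + 1) B' := by
      simp only [show k + 1 + 1 = k + 2 from rfl] at h2 h3
      omega
    exact ⟨h, ih ((card_dropRow_eq_iff h).2 h5) h'⟩

/-! ### Cyclic pairing -/

theorem cyclicNext_eq_some {α : Type*} [LinearOrder α] {S : Finset α} {x y : α}
    (h : cyclicNext S x = some y) :
    y ∈ S ∧ (x ≤ y → ∀ z ∈ S, x ≤ z → y ≤ z) ∧ (y < x → ∀ z ∈ S, y ≤ z ∧ z < x) := by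
  unfold cyclicNext at h
  split_ifs at h with h1 h2
  · have h := Option.some.inj h
    subst h
    have hm := Finset.min'_mem _ h1
    rw [Finset.mem_filter] at hm
    refine ⟨hm.1, fun _ z hz hxz => Finset.min'_le _ _ (Finset.mem_filter.2 ⟨hz, hxz⟩),
      fun hlt => ?_⟩
    exact absurd hm.2 (not_le.2 hlt)
  · have h := Option.some.inj h
    subst h
    have hlt : ∀ z ∈ S, z < x := fun z hz => by
      by_contra hxz
      exact h1 ⟨z, Finset.mem_filter.2 ⟨hz, not_lt.1 hxz⟩⟩
    refine ⟨Finset.min'_mem _ h2, fun hle => absurd (hlt _ (Finset.min'_mem _ h2)) (not_lt.2 hle),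
      fun _ z hz => ⟨Finset.min'_le _ _ hz, hlt z hz⟩⟩

theorem exists_cyclicNext {α : Type*} [LinearOrder α] {S : Finset α} (h : S.Nonempty) (x : α) :
    ∃ y, cyclicNext S x = some y := by
  unfold cyclicNext
  split_ifs with h1
  · exact ⟨_, rfl⟩
  · exact ⟨_, rfl⟩

/-- `CyclicPairing A C I w`: pairing the elements of `A` one by one, in some order, to the first
remaining element of `C` weakly to the right, going around cyclically, uses the elements `I` of `C`
and wraps around `w` times. -/
inductive CyclicPairing : Finset ℕ → Finset ℕ → Finset ℕ → ℕ → Prop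
  | empty (C : Finset ℕ) : CyclicPairing ∅ C ∅ 0
  | insert {A C I : Finset ℕ} {w x y : ℕ} (hx : x ∉ A) (hy : cyclicNext C x = some y)
      (h : CyclicPairing A (C.erase y) I w) :
      CyclicPairing (insert x A) C (insert y I) (w + if y < x then 1 else 0)

theorem CyclicPairing.subset {A C I : Finset ℕ} {w : ℕ} (h : CyclicPairing A C I w) : I ⊆ C := by
  induction h with
  | empty C => simp
  | insert hx hy h ih =>
    exact Finset.insert_subset (cyclicNext_eq_some hy).1 (ih.trans (Finset.erase_subset _ _))

theorem CyclicPairing.card_eq {A C I : Finset ℕ} {w : ℕ} (h : CyclicPairing A C I w) :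
    I.card = A.card := by
  induction h with
  | empty C => simp
  | insert hx hy h ih =>
    rw [Finset.card_insert_of_notMem hx, Finset.card_insert_of_notMem, ih]
    exact fun hh => by simpa using h.subset hh

theorem sufCount_insert {A : Finset ℕ} {y : ℕ} (h : y ∉ A) (x : ℕ) :
    sufCount (insert y A) x = sufCount A x + if x ≤ y then 1 else 0 := by
  rw [Finset.insert_eq, Finset.union_comm, sufCount_union (by simpa using h)]
  congr 1
  unfold sufCount
  rw [Finset.filter_singleton]
  split_ifs <;> rfl

/-- The function `g` counts the pairings which cross from column `x - 1` to column `x`.  No pairing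
crosses an unused ball of `C`. -/
theorem CyclicPairing.exists_crossings {A C I : Finset ℕ} {w : ℕ} (h : CyclicPairing A C I w) :
    ∃ g : ℕ → ℕ, (∀ x, sufCount A x + g x = sufCount I x + w) ∧
      (∀ y ∈ C, y ∉ I → g y = 0 ∧ g (y + 1) = 0 ∧ y ∉ A) ∧
      ((C = ∅ ∧ w = 0) ∨ ∃ v ∈ C, g (v + 1) = 0 ∧ ∀ y ∈ C, y ∉ I → y ≤ v) := by
  induction h with
  | empty C =>
    refine ⟨fun _ => 0, by simp, by simp, ?_⟩
    rcases C.eq_empty_or_nonempty with h | h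
    · exact Or.inl ⟨h, rfl⟩
    · exact Or.inr ⟨C.max' h, C.max'_mem h, rfl, fun y hy _ => C.le_max' y hy⟩
  | @insert A C I w x y hx hy h ih =>
    obtain ⟨g, h1, h2, h3⟩ := ih
    obtain ⟨hyC, hy1, hy2⟩ := cyclicNext_eq_some hy
    have hyI : y ∉ I := fun hh => by simpa using h.subset hh
    let p : ℕ → ℕ := fun z =>
      if x ≤ y then (if x < z ∧ z ≤ y then 1 else 0) else (if z ≤ y ∨ x < z then 1 else 0)
    have hp : ∀ z ∈ C, z ≠ y → p z = 0 ∧ p (z + 1) = 0 ∧ z ≠ x := by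
      intro z hz hzy
      have e1 := fun h => hy1 h z hz
      have e2 := fun h => hy2 h z hz
      simp only [p]
      split_ifs <;> omega
    refine ⟨fun z => g z + p z, ?_, ?_, ?_⟩
    · intro z
      rw [sufCount_insert hx, sufCount_insert hyI]
      have := h1 z
      simp only [p]
      split_ifs <;> omega
    · intro z hz hzI
      rw [Finset.mem_insert, not_or] at hzI
      obtain ⟨e1, e2, e3⟩ := h2 z (Finset.mem_erase.2 ⟨hzI.1, hz⟩) hzI.2
      obtain ⟨e4, e5, e6⟩ := hp z hz hzI.1
      refine ⟨by simp [e1, e4], by simp [e2, e5], ?_⟩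
      rw [Finset.mem_insert, not_or]
      exact ⟨e6, e3⟩
    · right
      rcases h3 with ⟨h3, rfl⟩ | ⟨v, hv, h4, h5⟩
      · have hI : I = ∅ := by
          have := h.subset
          rwa [h3, Finset.subset_empty] at this
        have hA : A = ∅ := by rw [← Finset.card_eq_zero, ← h.card_eq, hI]; rfl
        refine ⟨y, hyC, ?_, fun z hz hzI => ?_⟩
        · have := h1 (y + 1)
          rw [hA, hI] at this
          simp only [p]
          split_ifs <;> omega
        · by_contra hzy
          have : z ∈ C.erase y := Finset.mem_erase.2 ⟨by omega, hz⟩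
          rw [h3] at this
          simp at this
      · rw [Finset.mem_erase] at hv
        refine ⟨v, hv.2, by simp [h4, (hp v hv.2 hv.1).2.1], fun z hz hzI => ?_⟩
        rw [Finset.mem_insert, not_or] at hzI
        exact h5 z (Finset.mem_erase.2 ⟨hzI.1, hz⟩) hzI.2

/-- The effect of a cyclic pairing on the excess: if the unused balls of `C` are moved up to `A`,
the excess grows by the number of these balls. -/
theorem CyclicPairing.excess_eq {A C I : Finset ℕ} {w : ℕ} (h : CyclicPairing A C I w) :
    Disjoint A (C \ I) ∧ w = excess A C 0 ∧
      ∀ x, excess (A ∪ (C \ I)) I x = excess A C x + sufCount (C \ I) x := by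
  obtain ⟨g, h1, h2, h3⟩ := h.exists_crossings
  have hdis : Disjoint A (C \ I) := Finset.disjoint_right.2 fun y hy => by
    rw [Finset.mem_sdiff] at hy
    exact (h2 y hy.1 hy.2).2.2
  have hk := sufCount_sdiff h.subset
  have hle : ∀ x, excess A C x ≤ w := by
    intro x
    induction x using downward_induction (N := A.sup id + 1) with
    | base x hx => rw [excess_eq_zero _ _ hx]; omega
    | step x ih =>
      rw [excess_succ]
      have := h1 x
      have := hk x
      omega
  -- the excess is `w` as long as there are unused balls weakly to the right
  have hw : excess A C 0 = w ∧ ∀ x ∈ C, x ∉ I → excess A C (x + 1) = w := by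
    rcases h3 with ⟨h3, rfl⟩ | ⟨v, hv, h4, h5⟩
    · exact ⟨Nat.le_zero.1 (hle 0), fun x hx => by simp [h3] at hx⟩
    · have hkv : sufCount (C \ I) (v + 1) = 0 := by
        rw [sufCount, Finset.card_eq_zero, Finset.filter_eq_empty_iff]
        intro y hy
        rw [Finset.mem_sdiff] at hy
        have := h5 y hy.1 hy.2
        omega
      have e1 := h1 (v + 1)
      have e2 := hk (v + 1)
      have e3 := sufCount_le_add_excess A C (v + 1)
      have hv : ∀ x, x ≤ v + 1 → excess A C x = w := fun x hx => by
        have := hle x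
        have := excess_antitone A C hx
        omega
      exact ⟨hv 0 (by omega), fun x hx hxI => hv _ (by have := h5 x hx hxI; omega)⟩
  have hw' : ∀ x, 0 < sufCount (C \ I) x → excess A C x = w := by
    intro x hx
    rw [sufCount, Finset.card_pos] at hx
    obtain ⟨y, hy⟩ := hx
    rw [Finset.mem_filter, Finset.mem_sdiff] at hy
    have e1 := hw.2 y hy.1.1 hy.1.2
    have e2 := excess_antitone A C (show x ≤ y + 1 by omega)
    have e3 := hle x
    omega
  refine ⟨hdis, hw.1.symm, ?_⟩
  refine excess_eq_of_rec _ _ _ (max (A.sup id + 1) ((C \ I).sup id + 1)) (fun x hx => ?_)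
    fun x => ?_
  · rw [excess_eq_zero _ _ (by omega), sufCount_eq_zero _ (by omega)]
  · rw [sufCount_union hdis]
    have e1 := h1 x
    have e2 := hk x
    have e3 := excess_succ A C x
    have e4 := sufCount_succ (C \ I) x
    have e5 := hw' x
    have e6 := hw' (x + 1)
    by_cases hx : x ∈ C \ I
    · rw [if_pos hx] at e4
      rw [Finset.mem_sdiff] at hx
      have e7 := (h2 x hx.1 hx.2).1
      have e8 := hw.2 x hx.1 hx.2
      have e9 := e5 (by omega)
      omega
    · rw [if_neg hx] at e4
      rcases Nat.eq_zero_or_pos (sufCount (C \ I) x) with e7 | e7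
      · omega
      · have e8 := e5 e7
        have e9 := e6 (by omega)
        omega

theorem CyclicPairing.drop_eq {A C I : Finset ℕ} {w : ℕ} (h : CyclicPairing A C I w) :
    upperRow (A ∪ (C \ I)) I = upperRow A C ∧ lowerRow (A ∪ (C \ I)) I = lowerRow A C := by
  obtain ⟨hd, -, he⟩ := h.excess_eq
  constructor <;> apply sufCount_injective <;> funext x <;> have e1 := he x
  · have e2 := sufCount_upperRow A C x
    have e3 := sufCount_upperRow (A ∪ (C \ I)) I x
    have e4 := sufCount_union hd x
    omega
  · have e2 := sufCount_lowerRow A C x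
    have e3 := sufCount_lowerRow (A ∪ (C \ I)) I x
    have e4 := sufCount_sdiff h.subset x
    omega

theorem CyclicPairing.exists_of_card_le {A C : Finset ℕ} (h : A.card ≤ C.card) :
    ∃ I w, CyclicPairing A C I w := by
  induction A using Finset.induction_on generalizing C with
  | empty => exact ⟨∅, 0, .empty C⟩
  | insert x A hx ih =>
    rw [Finset.card_insert_of_notMem hx] at h
    obtain ⟨y, hy⟩ := exists_cyclicNext (Finset.card_pos.1 (by omega : 0 < C.card)) x
    obtain ⟨I, w, hI⟩ := ih (C := C.erase y) (by
      rw [Finset.card_erase_of_mem (cyclicNext_eq_some hy).1]; omega)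
    exact ⟨_, _, .insert hx hy hI⟩

open Classical in
/-- The set of the elements of `C` which are used in a cyclic pairing of `A` to `C` (in any
order). -/
noncomputable def matched (A C : Finset ℕ) : Finset ℕ :=
  if h : ∃ I w, CyclicPairing A C I w then h.choose else ∅

/-- Neither the elements of `C` which are used nor the number of wrapping pairings depend on the
order in which the elements of `A` are paired. -/
theorem CyclicPairing.eq_matched {A C I : Finset ℕ} {w : ℕ} (h : CyclicPairing A C I w) :
    I = matched A C ∧ w = excess A C 0 := by
  refine ⟨?_, h.excess_eq.2.1⟩
  have hex : ∃ I w, CyclicPairing A C I w := ⟨I, w, h⟩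
  rw [matched, dif_pos hex]
  obtain ⟨w', h'⟩ := hex.choose_spec
  refine (drop_injective (h.drop_eq.1.trans h'.drop_eq.1.symm)
    (h.drop_eq.2.trans h'.drop_eq.2.symm) ?_).2
  rw [h.excess_eq.2.2, h'.excess_eq.2.2, sufCount_zero, sufCount_zero,
    Finset.card_sdiff_of_subset h.subset, Finset.card_sdiff_of_subset h'.subset, h.card_eq,
    h'.card_eq]

theorem cyclicPairing_matched {A C : Finset ℕ} (h : A.card ≤ C.card) :
    CyclicPairing A C (matched A C) (excess A C 0) := by
  obtain ⟨I, w, hI⟩ := CyclicPairing.exists_of_card_le h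
  obtain ⟨rfl, rfl⟩ := hI.eq_matched
  exact hI

theorem card_matched {A C : Finset ℕ} (h : A.card ≤ C.card) : (matched A C).card = A.card :=
  (cyclicPairing_matched h).card_eq

theorem matched_subset {A C : Finset ℕ} (h : A.card ≤ C.card) : matched A C ⊆ C :=
  (cyclicPairing_matched h).subset

/-- Any element of `A` may be paired first. -/
theorem matched_erase {A C : Finset ℕ} (h : A.card ≤ C.card) {x y : ℕ} (hx : x ∈ A)
    (hy : cyclicNext C x = some y) :
    y ∈ matched A C ∧
      matched (A.erase x) (C.erase y) = (matched A C).erase y ∧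
      excess A C 0 = excess (A.erase x) (C.erase y) 0 + if y < x then 1 else 0 := by
  have hc : (A.erase x).card ≤ (C.erase y).card := by
    rw [Finset.card_erase_of_mem hx, Finset.card_erase_of_mem (cyclicNext_eq_some hy).1]; omega
  have h1 := CyclicPairing.insert (Finset.notMem_erase x A) hy (cyclicPairing_matched hc)
  rw [Finset.insert_erase hx] at h1
  have h2 := h1.eq_matched.1.symm
  have hn : y ∉ matched (A.erase x) (C.erase y) := fun hh => by simpa using matched_subset hc hh
  refine ⟨by simp [h2], by rw [h2, Finset.erase_insert hn], h1.eq_matched.2.symm⟩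

/-! ### The energy -/

/-- The balls of row `l - t` which are reached from the balls of row `l` by cyclic pairing. -/
noncomputable def strand (M : Rows) (l : ℕ) : ℕ → Finset ℕ
  | 0 => M l
  | t + 1 => matched (strand M l t) (M (l - (t + 1)))

/-- The energy of the bottom `L` rows: the number of wrapping pairings when, for each row, its balls
are paired downwards until row `1`. -/
noncomputable def energy (L : ℕ) (M : Rows) : ℕ :=
  ∑ l ∈ Finset.Icc 1 L, ∑ t ∈ Finset.range (l - 1), excess (strand M l t) (M (l - (t + 1))) 0

theorem card_strand {M : Rows} {l t : ℕ} (h : ∀ r, 1 ≤ r → r < l → (M l).card ≤ (M r).card)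
    (ht : t < l) : (strand M l t).card = (M l).card := by
  induction t with
  | zero => rfl
  | succ t ih =>
    have := ih (by omega)
    rw [strand, card_matched, this]
    rw [this]
    exact h _ (by omega) (by omega)

/-- The exchange of the sizes of rows `i` and `i + 1`: the balls of row `i` which are not used in
the cyclic pairing move up. -/
noncomputable def swapRow (i : ℕ) (B : Rows) : Rows := fun r =>
  if r = i + 1 then B (i + 1) ∪ (B i \ matched (B (i + 1)) (B i))
  else if r = i then matched (B (i + 1)) (B i)
  else B r

theorem dropRow_swapRow {i : ℕ} {B : Rows} (h : (B (i + 1)).card ≤ (B i).card) :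
    dropRow i (swapRow i B) = dropRow i B := by
  obtain ⟨h1, h2⟩ := (cyclicPairing_matched h).drop_eq
  have a : swapRow i B (i + 1) = B (i + 1) ∪ (B i \ matched (B (i + 1)) (B i)) := by simp [swapRow]
  have b : swapRow i B i = matched (B (i + 1)) (B i) := by simp [swapRow]
  funext r
  simp only [dropRow, a, b, h1, h2]
  split_ifs with h3 h4
  · rfl
  · rfl
  · simp only [swapRow, if_neg h3, if_neg h4]

theorem card_swapRow {i : ℕ} {B : Rows} (h : (B (i + 1)).card ≤ (B i).card) (r : ℕ) :
    (swapRow i B r).card =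
      if r = i + 1 then (B i).card else if r = i then (B (i + 1)).card else (B r).card := by
  have hp := cyclicPairing_matched h
  simp only [swapRow]
  split_ifs
  · rw [Finset.card_union_of_disjoint hp.excess_eq.1, Finset.card_sdiff_of_subset hp.subset,
      hp.card_eq]
    omega
  · exact hp.card_eq
  · rfl

/-- The energy of a sequence of rows of weakly decreasing sizes depends only on the sizes of the
rows along the collapsing. -/
theorem energy_eq_of_sameSizes {L : ℕ} {M M' : Rows} (h : SameSizes (collapseWord L) M M')
    (hM : ∀ r r', 1 ≤ r → r ≤ r' → (M r').card ≤ (M r).card) : energy L M = energy L M' := by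
  have hM' : ∀ r r', 1 ≤ r → r ≤ r' → (M' r').card ≤ (M' r).card := fun r r' h1 h2 => by
    rw [← h.card_eq, ← h.card_eq]; exact hM r r' h1 h2
  refine Finset.sum_congr rfl fun l hl => Finset.sum_congr rfl fun t ht => ?_
  rw [Finset.mem_Icc] at hl
  rw [Finset.mem_range] at ht
  -- successive exchanges carry the balls of row `l` downwards
  have key : ∀ t, t < l → ∃ E E' : Rows, SameSizes (collapseWord L) E E' ∧
      E (l - t) = strand M l t ∧ E' (l - t) = strand M' l t ∧
      ∀ r, r < l - t → E r = M r ∧ E' r = M' r := by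
    intro t
    induction t with
    | zero => exact fun _ => ⟨M, M', h, rfl, rfl, fun r _ => ⟨rfl, rfl⟩⟩
    | succ t ih =>
      intro ht
      obtain ⟨E, E', h1, h2, h3, h4⟩ := ih (by omega)
      obtain ⟨i, hi⟩ : ∃ i, l - t = i + 1 := ⟨l - (t + 1), by omega⟩
      have hi' : l - (t + 1) = i := by omega
      rw [hi] at h2 h3 h4
      have c := card_strand (M := M) (l := l) (t := t) (fun r hr hr' => hM _ _ hr hr'.le) (by omega)
      have c' := card_strand (M := M') (l := l) (t := t) (fun r hr hr' => hM' _ _ hr hr'.le)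
        (by omega)
      have e := hM i l (by omega) (by omega)
      have e' := hM' i l (by omega) (by omega)
      have k : (E (i + 1)).card ≤ (E i).card := by rw [h2, c, (h4 i (by omega)).1]; exact e
      have k' : (E' (i + 1)).card ≤ (E' i).card := by rw [h3, c', (h4 i (by omega)).2]; exact e'
      refine ⟨swapRow i E, swapRow i E', h1.of_dropRow_eq (i := i) (by omega) (by omega)
        (dropRow_swapRow k) (dropRow_swapRow k') ?_, ?_, ?_, ?_⟩
      · intro r
        rw [card_swapRow k, card_swapRow k', h1.card_eq, h1.card_eq, h1.card_eq]
      · rw [hi', strand, hi', ← h2, ← (h4 i (by omega)).1]; simp [swapRow]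
      · rw [hi', strand, hi', ← h3, ← (h4 i (by omega)).2]; simp [swapRow]
      · intro r hr
        rw [hi'] at hr
        rw [← (h4 r (by omega)).1, ← (h4 r (by omega)).2]
        simp only [swapRow]
        constructor <;> rw [if_neg (by omega), if_neg (by omega)]
  obtain ⟨E, E', h1, h2, h3, h4⟩ := key t (by omega)
  have h5 := h1.dropCount_eq (i := l - (t + 1)) (by omega) (by omega)
  rw [dropCount, dropCount, show l - (t + 1) + 1 = l - t by omega, h2, h3,
    (h4 _ (by omega)).1, (h4 _ (by omega)).2] at h5
  exact h5

/-- The energy vanishes exactly if no ball drops. -/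
theorem energy_eq_zero_iff {L : ℕ} {M : Rows}
    (hM : ∀ r r', 1 ≤ r → r ≤ r' → (M r').card ≤ (M r).card) :
    energy L M = 0 ↔ ∀ r, 1 ≤ r → r < L → Dominated (M (r + 1)) (M r) := by
  simp only [energy, Finset.sum_eq_zero_iff, Finset.mem_Icc, Finset.mem_range,
    excess_zero_eq_zero_iff]
  constructor
  · intro h r h1 h2
    have := h (r + 1) ⟨by omega, h2⟩ 0 (by omega)
    simpa [strand] using this
  · intro h l hl t ht
    have hs : strand M l t ⊆ M (l - t) := by
      cases t with
      | zero => exact subset_rfl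
      | succ t =>
        apply matched_subset
        rw [card_strand (fun r hr hr' => hM _ _ hr hr'.le) (by omega)]
        exact hM _ _ (by omega) (by omega)
    have h1 := h (l - (t + 1)) (by omega) (by omega)
    rw [show l - (t + 1) + 1 = l - t by omega] at h1
    exact fun x => (sufCount_mono hs x).trans (h1 x)

/-! ### Sweeps through nonwrapping rows -/

/-- The result of a sweep interlaces with the rows before the sweep. -/
theorem sweep_interlace {k : ℕ} {B : Rows}
    (hB : ∀ r, 1 ≤ r → r < k → Dominated (B (r + 1)) (B r)) {r : ℕ} (h1 : 1 ≤ r) (h2 : r ≤ k) :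
    Dominated (runWord (sweepWord k) B (r + 1)) (B r) ∧
      Dominated (B r) (runWord (sweepWord k) B r) := by
  induction k generalizing B r with
  | zero => omega
  | succ k ih =>
    rw [sweepWord, runWord_cons]
    have hne : ∀ r, r ≤ k → dropRow (k + 1) B r = B r := fun r hr =>
      dropRow_of_ne B (by omega) (by omega)
    have ih' := fun r (hr : 1 ≤ r) (hr' : r ≤ k) => ih (B := dropRow (k + 1) B)
      (fun r hr hr' => by rw [hne _ (by omega), hne _ (by omega)]; exact hB r hr (by omega)) hr hr'
    by_cases hr : r ≤ k
    · have := ih' r h1 hr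
      rwa [hne r hr] at this
    · obtain rfl : r = k + 1 := by omega
      have hw : ∀ i ∈ sweepWord k, k + 1 + 1 ≠ i + 1 ∧ k + 1 + 1 ≠ i := fun i hi => by
        have := mem_sweepWord.1 hi; omega
      refine ⟨?_, ?_⟩
      · rw [runWord_of_forall hw, dropRow_succ]
        exact upperRow_dominated _ _
      · cases k with
        | zero =>
          rw [sweepWord, runWord_nil, dropRow_self]
          exact dominated_lowerRow _ _
        | succ k =>
          have hw : ∀ i ∈ sweepWord k, k + 1 + 1 ≠ i + 1 ∧ k + 1 + 1 ≠ i := fun i hi => by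
            have := mem_sweepWord.1 hi; omega
          rw [sweepWord, runWord_cons, runWord_of_forall hw, dropRow_succ, dropRow_self,
            hne _ le_rfl]
          intro x
          have e1 := sufCount_upperRow (lowerRow (B (k + 1 + 1 + 1)) (B (k + 1 + 1))) (B (k + 1)) x
          have e2 := sufCount_lowerRow (B (k + 1 + 1 + 1)) (B (k + 1 + 1)) x
          have e3 := excess_le_of_dominated _
            (excess_antitone (B (k + 1 + 1 + 1)) (B (k + 1 + 1)))
            (sufCount_lowerRow (B (k + 1 + 1 + 1)) (B (k + 1 + 1)))
            (hB (k + 1) (by omega) (by omega)) x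
          omega

/-- A word of operators is injective once the sizes of the rows along it are known. -/
theorem runWord_injective {w : List ℕ} {B B' : Rows} (h : SameSizes w B B')
    (h' : runWord w B = runWord w B') : B = B' := by
  induction w generalizing B B' with
  | nil => exact h'
  | cons i w ih =>
    rw [sameSizes_cons] at h
    have e := ih h.2.2 h'
    have e1 := congrFun e (i + 1)
    have e2 := congrFun e i
    rw [dropRow_succ, dropRow_succ] at e1
    rw [dropRow_self, dropRow_self] at e2
    obtain ⟨e3, e4⟩ := drop_injective e1 e2 h.2.1
    funext r
    by_cases hr : r = i + 1
    · subst hr; exact e3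
    by_cases hr' : r = i
    · subst hr'; exact e4
    have := congrFun e r
    rwa [dropRow_of_ne _ hr hr', dropRow_of_ne _ hr hr'] at this

/-- Undoing a sweep: the operators are undone from the bottom to the top, and the sizes `p r` of the
rows before the sweep can be prescribed subject to interlacing. -/
theorem exists_sweep_eq {k : ℕ} {N : Rows} (hN : ∀ r, 1 ≤ r → r ≤ k → Dominated (N (r + 1)) (N r))
    {p : ℕ → ℕ} (hp : ∀ r, 1 ≤ r → r ≤ k → (N (r + 1)).card ≤ p r ∧ p r ≤ (N r).card) :
    ∃ E : Rows, runWord (sweepWord k) E = N ∧ (∀ r, r = 0 ∨ k + 1 < r → E r = N r) ∧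
      (∀ r, 1 ≤ r → r ≤ k → (E r).card = p r) ∧
      ∀ r, 1 ≤ r → r < k → Dominated (E (r + 1)) (E r) := by
  suffices H : ∀ j, j ≤ k → ∃ (E : Rows) (m : ℕ → ℕ), runWord (sweepWord j) E = N ∧
      (∀ r, r = 0 ∨ j + 1 < r → E r = N r) ∧ (∀ r, 1 ≤ r → r ≤ j → (E r).card = p r) ∧
      (∀ r, 1 ≤ r → r < j → Dominated (E (r + 1)) (E r)) ∧
      (∀ x, sufCount (E (j + 1)) x = sufCount (N (j + 1)) x + m x) ∧ Antitone m ∧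
      (1 ≤ j → Dominated (N (j + 1)) (E j)) by
    obtain ⟨E, m, h1, h2, h3, h4, -⟩ := H k le_rfl
    exact ⟨E, h1, h2, h3, h4⟩
  intro j
  induction j with
  | zero =>
    intro _
    exact ⟨N, fun _ => 0, rfl, fun _ _ => rfl, fun r h1 h2 => by omega, fun r h1 h2 => by omega,
      fun x => rfl, fun _ _ _ => le_rfl, fun h => by omega⟩
  | succ j ih =>
    intro hj
    obtain ⟨E, m, h1, h2, h3, h4, h5, h6, h7⟩ := ih (by omega)
    have hp' := hp (j + 1) (by omega) hj
    have hN' := hN (j + 1) (by omega) hj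
    have h50 := h5 0
    rw [sufCount_zero, sufCount_zero] at h50
    have hdom : Dominated (N (j + 1 + 1)) (E (j + 1)) := fun x => by
      have := hN' x; rw [h5]; omega
    obtain ⟨A, C, hA, hC, hs⟩ := exists_drop_eq hdom (s := (E (j + 1)).card - p (j + 1)) (by omega)
    have hcard := card_lowerRow A C
    rw [hC, hs] at hcard
    have hlow := sufCount_lowerRow A C
    rw [hC] at hlow
    have hup := sufCount_upperRow A C
    rw [hA] at hup
    -- more balls are moved up than in the previous step
    have hm : ∀ x, m x ≤ excess A C x := by
      refine le_excess_of_le m h6 (by rw [hs]; omega) fun x => ?_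
      rw [hA, hC, h5]
      have := hN' x
      omega
    have hCN : Dominated C (N (j + 1)) := fun x => by
      have e1 := hlow x
      have e2 := hm x
      rw [h5] at e1
      omega
    let E' : Rows := fun r => if r = j + 1 + 1 then A else if r = j + 1 then C else E r
    have hE1 : E' (j + 1 + 1) = A := by simp [E']
    have hE2 : E' (j + 1) = C := by simp [E']
    have hE3 : ∀ r, r ≠ j + 1 + 1 → r ≠ j + 1 → E' r = E r := fun r hr hr' => by
      simp only [E', if_neg hr, if_neg hr']
    refine ⟨E', excess A C, ?_, ?_, ?_, ?_, ?_, excess_antitone A C, ?_⟩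
    · rw [sweepWord, runWord_cons]
      convert h1
      funext r
      by_cases hr : r = j + 1 + 1
      · rw [hr, dropRow_succ, hE1, hE2, hA, h2 _ (by omega)]
      by_cases hr' : r = j + 1
      · rw [hr', dropRow_self, hE1, hE2, hC]
      rw [dropRow_of_ne _ hr hr', hE3 r hr hr']
    · intro r hr
      rw [hE3 r (by omega) (by omega), h2 r (by omega)]
    · intro r hr hr'
      by_cases hr'' : r = j + 1
      · rw [hr'', hE2]; omega
      · rw [hE3 r (by omega) hr'', h3 r hr (by omega)]
    · intro r hr hr'
      by_cases hr'' : r = j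
      · subst hr''
        rw [hE2, hE3 r (by omega) (by omega)]
        exact hCN.trans (h7 hr)
      · rw [hE3 _ (by omega) (by omega), hE3 _ (by omega) (by omega)]
        exact h4 r hr (by omega)
    · intro x
      rw [hE1]
      exact (hup x).symm
    · intro _
      rw [hE2, ← hA]
      exact upperRow_dominated A C

/-! ### The stages of collapsing -/

/-- The submatrix formed by the bottom `k` rows. -/
def cutRows (k : ℕ) (B : Rows) : Rows := fun r => if r ≤ k then B r else ∅

/-- The result of collapsing the bottom `k` rows. -/
def stage (k : ℕ) (B : Rows) : Rows := runWord (collapseWord k) (cutRows k B)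

theorem runWord_update {w : List ℕ} {r : ℕ} (h : ∀ i ∈ w, r ≠ i + 1 ∧ r ≠ i) (B : Rows)
    (A : Finset ℕ) :
    runWord w (Function.update B r A) = Function.update (runWord w B) r A := by
  induction w generalizing B with
  | nil => rfl
  | cons i w ih =>
    rw [runWord_cons, runWord_cons, ← ih fun j hj => h j (List.mem_cons_of_mem _ hj)]
    congr 1
    obtain ⟨h1, h2⟩ := h i List.mem_cons_self
    funext s
    simp only [dropRow, Function.update_apply, h1.symm, h2.symm, if_false]
    split_ifs <;> simp_all

theorem stage_succ (k : ℕ) (B : Rows) :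
    stage (k + 1) B =
      runWord (sweepWord k) (Function.update (stage k B) (k + 1) (B (k + 1))) := by
  rw [stage, collapseWord, runWord_append, stage, ← runWord_update]
  · congr 2
    funext r
    simp only [cutRows, Function.update_apply]
    split_ifs <;> first | omega | simp_all
  · intro i hi
    have := mem_collapseWord hi
    omega

theorem stage_of_lt {k r : ℕ} (h : k < r) (B : Rows) : stage k B r = ∅ := by
  rw [stage, runWord_of_forall]
  · exact if_neg (by omega)
  · intro i hi
    have := mem_collapseWord hi
    omega

theorem stage_row_zero (k : ℕ) {B : Rows} (h : B 0 = ∅) : stage k B 0 = ∅ := by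
  rw [stage, runWord_of_forall]
  · simp [cutRows, h]
  · intro i hi
    have := mem_collapseWord hi
    omega

theorem stage_zero {B : Rows} (h : B 0 = ∅) : stage 0 B = fun _ => ∅ := by
  funext r
  rcases Nat.eq_zero_or_pos r with rfl | hr
  · exact stage_row_zero 0 h
  · exact stage_of_lt hr B

/-- The stages are nonwrapping. -/
theorem stage_dominated (k : ℕ) (B : Rows) {r : ℕ} (h : 1 ≤ r) :
    Dominated (stage k B (r + 1)) (stage k B r) := by
  induction k generalizing r with
  | zero =>
    intro x
    rw [stage_of_lt (by omega), sufCount_empty]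
    omega
  | succ k ih =>
    by_cases hr : r ≤ k
    · rw [stage_succ]
      have key := sweep_interlace (k := k) (B := Function.update (stage k B) (k + 1) (B (k + 1)))
        (fun r hr hr' => by
          rw [Function.update_of_ne (by omega), Function.update_of_ne (by omega)]; exact ih hr)
        h hr
      exact key.1.trans key.2
    · intro x
      rw [stage_of_lt (by omega), sufCount_empty]
      omega

/-- Successive stages interlace. -/
theorem stage_interlace (k : ℕ) (B : Rows) {r : ℕ} (h : 1 ≤ r) :
    Dominated (stage (k + 1) B (r + 1)) (stage k B r) ∧
      Dominated (stage k B r) (stage (k + 1) B r) := by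
  by_cases hr : r ≤ k
  · rw [stage_succ]
    have key := sweep_interlace (k := k) (B := Function.update (stage k B) (k + 1) (B (k + 1)))
      (fun r hr hr' => by
        rw [Function.update_of_ne (by omega), Function.update_of_ne (by omega)]
        exact stage_dominated k B hr) h hr
    rwa [Function.update_of_ne (by omega)] at key
  · constructor <;> intro x
    · rw [stage_of_lt (by omega), sufCount_empty]; omega
    · rw [stage_of_lt (by omega) B, sufCount_empty]; omega

theorem prod_eq_of_pair {ι M : Type*} [DecidableEq ι] [CommMonoid M] {s : Finset ι} {i j : ι}
    (hi : i ∈ s) (hj : j ∈ s) (hij : i ≠ j) {f g : ι → M} (h : f i * f j = g i * g j)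
    (h' : ∀ r, r ≠ i → r ≠ j → f r = g r) : ∏ r ∈ s, f r = ∏ r ∈ s, g r := by
  have hj' : j ∈ s.erase i := Finset.mem_erase.2 ⟨hij.symm, hj⟩
  rw [← Finset.mul_prod_erase s f hi, ← Finset.mul_prod_erase s g hi,
    ← Finset.mul_prod_erase _ f hj', ← Finset.mul_prod_erase _ g hj', ← mul_assoc, ← mul_assoc, h]
  congr 1
  refine Finset.prod_congr rfl fun r hr => ?_
  simp only [Finset.mem_erase] at hr
  exact h' r hr.2.1 hr.1

/-- The number of balls is preserved by the operators. -/
theorem sum_card_runWord {w : List ℕ} {n : ℕ} (h : ∀ i ∈ w, i + 1 < n) (B : Rows) :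
    ∑ r ∈ Finset.range n, (runWord w B r).card = ∑ r ∈ Finset.range n, (B r).card := by
  induction w generalizing B with
  | nil => rfl
  | cons i w ih =>
    rw [runWord_cons, ih (fun j hj => h j (List.mem_cons_of_mem _ hj))]
    have hi := h i List.mem_cons_self
    refine Multiplicative.ofAdd.injective ?_
    rw [ofAdd_sum, ofAdd_sum]
    refine prod_eq_of_pair (i := i) (j := i + 1) (Finset.mem_range.2 (by omega))
      (Finset.mem_range.2 hi) (by omega) ?_ fun r hr hr' => ?_
    · rw [← ofAdd_add, ← ofAdd_add]
      have e1 := card_dropRow_self i B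
      have e2 := card_dropRow_succ i B
      congr 1
      omega
    · rw [dropRow_of_ne _ hr' hr]

theorem sum_card_stage_succ (k : ℕ) (B : Rows) {n : ℕ} (h : k + 1 < n) :
    ∑ r ∈ Finset.range n, (stage (k + 1) B r).card =
      ∑ r ∈ Finset.range n, (stage k B r).card + (B (k + 1)).card := by
  rw [stage_succ, sum_card_runWord (fun i hi => by have := mem_sweepWord.1 hi; omega)]
  have hm : k + 1 ∈ Finset.range n := Finset.mem_range.2 h
  rw [← Finset.add_sum_erase _ _ hm,
    ← Finset.add_sum_erase _ (fun r => (stage k B r).card) hm, Function.update_self,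
    stage_of_lt (by omega) B, Finset.card_empty, zero_add, add_comm]
  congr 1
  refine Finset.sum_congr rfl fun r hr => ?_
  rw [Function.update_of_ne (Finset.ne_of_mem_erase hr)]

/-- A column which contains a ball never becomes empty. -/
theorem exists_mem_runWord {w : List ℕ} {B : Rows} {x r : ℕ} (h : x ∈ B r) :
    ∃ s, x ∈ runWord w B s := by
  induction w generalizing B r with
  | nil => exact ⟨r, h⟩
  | cons i w ih =>
    rw [runWord_cons]
    by_cases hx : x ∈ unmatched (B (i + 1)) (B i)
    · refine ih (r := i) ?_
      rw [dropRow_self]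
      exact Finset.mem_union_right _ hx
    by_cases hr : r = i + 1
    · subst hr
      refine ih (r := i + 1) ?_
      rw [dropRow_succ]
      exact Finset.mem_sdiff.2 ⟨h, hx⟩
    by_cases hr' : r = i
    · subst hr'
      refine ih (r := r) ?_
      rw [dropRow_self]
      exact Finset.mem_union_left _ h
    · refine ih (r := r) ?_
      rwa [dropRow_of_ne _ hr hr']

theorem runWord_congr {w : List ℕ} {k : ℕ} (h : ∀ i ∈ w, i + 1 ≤ k) {B B' : Rows}
    (hB : ∀ r, r ≤ k → B r = B' r) {r : ℕ} (hr : r ≤ k) : runWord w B r = runWord w B' r := by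
  induction w generalizing B B' with
  | nil => exact hB r hr
  | cons i w ih =>
    have hi := h i List.mem_cons_self
    rw [runWord_cons, runWord_cons]
    refine ih (fun j hj => h j (List.mem_cons_of_mem _ hj)) fun s hs => ?_
    simp only [dropRow, hB s hs, hB i (by omega), hB (i + 1) hi]

theorem runWord_collapseWord_cutRows {k L : ℕ} (h : k ≤ L) (B : Rows) (r : ℕ) :
    runWord (collapseWord k) (cutRows L B) r = if r ≤ k then stage k B r else cutRows L B r := by
  split_ifs with hr
  · refine runWord_congr (fun i hi => (mem_collapseWord hi).2) (fun s hs => ?_) hr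
    simp [cutRows, hs, hs.trans h]
  · refine runWord_of_forall (fun i hi => ?_) _
    have := mem_collapseWord hi
    omega

/-- If the stages have the same sizes, then the rows have the same sizes all along the
collapsing. -/
theorem sameSizes_of_stage {L : ℕ} {B B' : Rows} (h0 : B 0 = ∅) (h0' : B' 0 = ∅)
    (h : ∀ k, k ≤ L → ∀ r, (stage k B r).card = (stage k B' r).card) :
    (∀ r, r ≤ L → (B r).card = (B' r).card) ∧
      SameSizes (collapseWord L) (cutRows L B) (cutRows L B') := by
  have hc : ∀ r, r ≤ L → (B r).card = (B' r).card := by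
    intro r hr
    cases r with
    | zero => rw [h0, h0']
    | succ k =>
      have e1 := sum_card_stage_succ k B (n := k + 2) (by omega)
      have e2 := sum_card_stage_succ k B' (n := k + 2) (by omega)
      rw [Finset.sum_congr rfl fun r _ => h (k + 1) hr r,
        Finset.sum_congr rfl fun r _ => h k (by omega) r] at e1
      omega
  refine ⟨hc, ?_⟩
  have hcut : ∀ r, (cutRows L B r).card = (cutRows L B' r).card := by
    intro r
    by_cases hr : r ≤ L
    · simp [cutRows, hr, hc r hr]
    · simp [cutRows, hr]
  have hrun : ∀ k, k ≤ L → ∀ r, (runWord (collapseWord k) (cutRows L B) r).card =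
      (runWord (collapseWord k) (cutRows L B') r).card := by
    intro k hk r
    rw [runWord_collapseWord_cutRows hk, runWord_collapseWord_cutRows hk]
    split_ifs
    · exact h k hk r
    · exact hcut r
  have key : ∀ k, k ≤ L → SameSizes (collapseWord k) (cutRows L B) (cutRows L B') := by
    intro k hk
    induction k with
    | zero => exact hcut
    | succ k ih =>
      rw [collapseWord, sameSizes_append]
      refine ⟨ih (by omega), sameSizes_sweepWord (hrun k (by omega)) ?_⟩
      simp only [← runWord_append]
      exact hrun (k + 1) hk
  exact key L le_rfl

/-- Collapsing is injective once the sizes of all the stages are known. -/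
theorem eq_of_stage_eq {L : ℕ} {B B' : Rows} (h0 : B 0 = ∅) (h0' : B' 0 = ∅)
    (h : ∀ k, k ≤ L → ∀ r, (stage k B r).card = (stage k B' r).card)
    (hL : stage L B = stage L B') {r : ℕ} (hr : r ≤ L) : B r = B' r := by
  induction L generalizing r with
  | zero =>
    obtain rfl : r = 0 := by omega
    rw [h0, h0']
  | succ L ih =>
    have hc := (sameSizes_of_stage h0 h0' h).1
    have hL' := hL
    rw [stage_succ, stage_succ] at hL'
    have hs : SameSizes (sweepWord L) (Function.update (stage L B) (L + 1) (B (L + 1)))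
        (Function.update (stage L B') (L + 1) (B' (L + 1))) := by
      refine sameSizes_sweepWord (fun r => ?_) fun r => by rw [hL']
      by_cases hr : r = L + 1
      · subst hr
        rw [Function.update_self, Function.update_self]
        exact hc _ le_rfl
      · rw [Function.update_of_ne hr, Function.update_of_ne hr]
        exact h L (by omega) r
    have e := runWord_injective hs hL'
    by_cases hr' : r = L + 1
    · subst hr'
      simpa using congrFun e (L + 1)
    · refine ih (fun k hk => h k (by omega)) ?_ (by omega)
      funext s
      by_cases hs : s = L + 1
      · rw [stage_of_lt (by omega), stage_of_lt (by omega)]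
      · have := congrFun e s
        rwa [Function.update_of_ne hs, Function.update_of_ne hs] at this

/-- Nonwrapping rows together with an interlacing chain of sizes come from collapsing. -/
theorem exists_stage_eq {L : ℕ} {N : Rows} {c : ℕ → ℕ → ℕ} (h0 : N 0 = ∅)
    (hL : ∀ r, L < r → N r = ∅) (hN : ∀ r, 1 ≤ r → Dominated (N (r + 1)) (N r))
    (hc : ∀ r, (N r).card = c L r) (hc0 : ∀ k, c k 0 = 0) (hck : ∀ k r, k < r → c k r = 0)
    (hint : ∀ k r, k < L → 1 ≤ r → c (k + 1) (r + 1) ≤ c k r ∧ c k r ≤ c (k + 1) r) :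
    ∃ B : Rows, B 0 = ∅ ∧ (∀ r, L < r → B r = ∅) ∧
      (∀ k, k ≤ L → ∀ r, (stage k B r).card = c k r) ∧ stage L B = N := by
  induction L generalizing N with
  | zero =>
    have hs : stage 0 (fun _ => ∅) = fun _ => ∅ := stage_zero rfl
    refine ⟨fun _ => ∅, rfl, fun _ _ => rfl, fun k hk r => ?_, ?_⟩
    · obtain rfl : k = 0 := by omega
      rw [hs, Finset.card_empty]
      rcases Nat.eq_zero_or_pos r with rfl | hr
      · exact (hc0 0).symm
      · exact (hck 0 r hr).symm
    · rw [hs]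
      funext r
      rcases Nat.eq_zero_or_pos r with rfl | hr
      · exact h0.symm
      · exact (hL r hr).symm
  | succ L ih =>
    obtain ⟨E, h1, h2, h3, h4⟩ := exists_sweep_eq (k := L) (N := N) (p := c L)
      (fun r hr _ => hN r hr) (fun r hr _ => by
        rw [hc, hc]; exact hint L r (by omega) hr)
    have hE0 : E 0 = ∅ := by rw [h2 0 (Or.inl rfl), h0]
    obtain ⟨B, b1, b2, b3, b4⟩ := ih (N := fun r => if r ≤ L then E r else ∅) (by simp [hE0])
      (fun r hr => if_neg (by omega)) (fun r hr => by
        by_cases hrL : r < L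
        · simp only [if_pos hrL.le, if_pos (show r + 1 ≤ L from hrL)]
          exact h4 r hr hrL
        · simp only [if_neg (show ¬r + 1 ≤ L by omega)]
          intro x; rw [sufCount_empty]; omega)
      (fun r => by
        by_cases hrL : r ≤ L
        · simp only [if_pos hrL]
          rcases Nat.eq_zero_or_pos r with rfl | hr
          · rw [hE0, hc0]; rfl
          · exact h3 r hr hrL
        · simp only [if_neg hrL]
          rw [hck L r (by omega)]; rfl)
      (fun k r hk hr => hint k r (by omega) hr)
    have hst : ∀ k, k ≤ L → stage k (Function.update B (L + 1) (E (L + 1))) = stage k B := by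
      intro k hk
      unfold stage
      congr 1
      funext r
      simp only [cutRows, Function.update_apply]
      split_ifs <;> first | omega | rfl
    have hfin : stage (L + 1) (Function.update B (L + 1) (E (L + 1))) = N := by
      rw [stage_succ, hst L le_rfl, Function.update_self, b4]
      convert h1
      funext r
      by_cases hr : r = L + 1
      · subst hr; rw [Function.update_self]
      · rw [Function.update_of_ne hr]
        split_ifs with hrL
        · rfl
        · rw [h2 r (by omega), hL r (by omega)]
    refine ⟨Function.update B (L + 1) (E (L + 1)), by
      rw [Function.update_of_ne (by omega), b1], fun r hr => by
        rw [Function.update_of_ne (by omega), b2 r (by omega)], fun k hk r => ?_, hfin⟩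
    by_cases hk' : k ≤ L
    · rw [hst k hk', b3 k hk']
    · obtain rfl : k = L + 1 := by omega
      rw [hfin, hc]

/-! ### Ball arrangements as rows -/

/-- The rows of an arrangement, as sets of natural numbers. -/
def toRows {n : ℕ} (B : Arrangement n) : Rows := fun r => (B r).map Fin.valEmbedding

theorem toRows_injective {n : ℕ} : Function.Injective (toRows (n := n)) := fun B B' h => by
  funext r
  exact Finset.map_injective _ (congrFun h r)

theorem card_toRows {n : ℕ} (B : Arrangement n) (r : ℕ) : (toRows B r).card = (B r).card :=
  Finset.card_map _

/-- The number of closed parentheses of a word which are unmatched. -/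
def unmatchedClosed {α : Type*} : List (Bool × α) → ℕ
  | [] => 0
  | (true, _) :: w => unmatchedClosed w - 1
  | (false, _) :: w => unmatchedClosed w + 1

/-- The rest of the word removes as many open parentheses from the stack as it has unmatched closed
ones. -/
theorem unmatchedOpen_eq_append {α : Type*} (w : List (Bool × α)) (st : List α) :
    unmatchedOpen st w = unmatchedOpen [] w ++ st.drop (unmatchedClosed w) := by
  induction w generalizing st with
  | nil => cases st <;> simp [unmatchedOpen, unmatchedClosed]
  | cons p w ih =>
    obtain ⟨b, a⟩ := p
    cases b
    · cases st with
      | nil => simp [unmatchedOpen]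
      | cons c st => simp [unmatchedOpen, unmatchedClosed, ih st]
    · have h1 : unmatchedOpen st ((true, a) :: w) = unmatchedOpen (a :: st) w := by
        cases st <;> rfl
      have h2 : unmatchedOpen [] ((true, a) :: w) = unmatchedOpen [a] w := rfl
      rw [h1, h2, ih (a :: st), ih [a], unmatchedClosed, List.append_assoc]
      cases unmatchedClosed w <;> simp

theorem unmatchedOpen_true {α : Type*} (a : α) (w : List (Bool × α)) :
    unmatchedOpen [] ((true, a) :: w) =
      unmatchedOpen [] w ++ if unmatchedClosed w = 0 then [a] else [] := by
  have h2 : unmatchedOpen [] ((true, a) :: w) = unmatchedOpen [a] w := rfl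
  rw [h2, unmatchedOpen_eq_append]
  cases unmatchedClosed w <;> simp

theorem unmatchedOpen_false {α : Type*} (a : α) (w : List (Bool × α)) :
    unmatchedOpen [] ((false, a) :: w) = unmatchedOpen [] w := rfl

/-- Bracketing of the columns from `x` on: the excess counts the unmatched open parentheses, and
`sufCount C' x + excess A' C' x - sufCount A' x` the unmatched closed ones. -/
theorem mem_unmatchedOpen_par {n : ℕ} (A C : Finset (Fin n)) (x : ℕ) :
    let A' := A.map Fin.valEmbedding
    let C' := C.map Fin.valEmbedding
    let w := ((List.finRange n).drop x).flatMap fun j =>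
      (if j ∈ A then [(true, j)] else []) ++ (if j ∈ C then [(false, j)] else [])
    unmatchedClosed w + sufCount A' x = sufCount C' x + excess A' C' x ∧
      ∀ j, j ∈ unmatchedOpen [] w ↔ x ≤ j ∧ (j : ℕ) ∈ unmatched A' C' := by
  intro A' C'
  have hA : ∀ j : Fin n, (j : ℕ) ∈ A' ↔ j ∈ A := fun j => by simp [A', Fin.val_inj]
  have hC : ∀ j : Fin n, (j : ℕ) ∈ C' ↔ j ∈ C := fun j => by simp [C', Fin.val_inj]
  induction x using downward_induction (N := n) with
  | base x hx =>
    have hlt : ∀ S : Finset (Fin n), sufCount (S.map Fin.valEmbedding) x = 0 := fun S => by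
      rw [sufCount, Finset.card_eq_zero, Finset.filter_eq_empty_iff]
      intro y hy
      obtain ⟨j, -, rfl⟩ := Finset.mem_map.1 hy
      have := j.2
      simp
      omega
    have he : excess A' C' x = 0 := by
      have e1 := sufCount_unmatched A' C' x
      have e2 := sufCount_mono (unmatched_subset A' C') x
      rw [hlt A] at e2
      omega
    rw [List.drop_eq_nil_of_le (by simpa using hx), hlt, hlt, he]
    refine ⟨rfl, fun j => ?_⟩
    have := j.2
    simp [unmatchedOpen]
    omega
  | step x ih =>
    by_cases hx : x < n
    swap
    · have e1 := List.drop_eq_nil_of_le (as := List.finRange n) (i := x) (by simpa using hx)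
      have e2 := List.drop_eq_nil_of_le (as := List.finRange n) (i := x + 1) (by simp; omega)
      have hxA : x ∉ A' := fun h => by
        obtain ⟨j, -, hj⟩ := Finset.mem_map.1 h
        have := j.2
        simp at hj
        omega
      have hxC : x ∉ C' := fun h => by
        obtain ⟨j, -, hj⟩ := Finset.mem_map.1 h
        have := j.2
        simp at hj
        omega
      intro w
      have hw : w = [] := by simp [w, e1]
      obtain ⟨i1, i2⟩ := ih
      have a := sufCount_succ A' x
      have c := sufCount_succ C' x
      rw [if_neg hxA] at a
      rw [if_neg hxC] at c
      have e := excess_succ A' C' x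
      simp only [e2, List.flatMap_nil, unmatchedClosed] at i1
      refine ⟨by rw [hw, unmatchedClosed]; omega, fun j => ?_⟩
      have := j.2
      simp [hw, unmatchedOpen]
      omega
    · obtain ⟨i1, i2⟩ := ih
      intro w
      set w' := ((List.finRange n).drop (x + 1)).flatMap fun j =>
        (if j ∈ A then [(true, j)] else []) ++ (if j ∈ C then [(false, j)] else []) with hw'
      have hw : w = ((if (⟨x, hx⟩ : Fin n) ∈ A then [(true, ⟨x, hx⟩)] else []) ++
          (if (⟨x, hx⟩ : Fin n) ∈ C then [(false, ⟨x, hx⟩)] else [])) ++ w' := by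
        simp only [w]
        rw [List.drop_eq_getElem_cons (by simpa using hx), List.flatMap_cons]
        simp [hw']
      have a := sufCount_succ A' x
      have c := sufCount_succ C' x
      have e := excess_succ A' C' x
      have e0 := sufCount_le_add_excess A' C' (x + 1)
      have hA := hA ⟨x, hx⟩
      have hC := hC ⟨x, hx⟩
      have hmem : x ∈ unmatched A' C' ↔ excess A' C' (x + 1) < excess A' C' x :=
        ⟨fun h => (Finset.mem_filter.1 h).2,
          fun h => Finset.mem_filter.2 ⟨(excess_lt_imp h).1, h⟩⟩
      have hj : ∀ j : Fin n, (x ≤ j ∧ (j : ℕ) ∈ unmatched A' C') ↔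
          ((x + 1 ≤ j ∧ (j : ℕ) ∈ unmatched A' C') ∨
            (j = ⟨x, hx⟩ ∧ excess A' C' (x + 1) < excess A' C' x)) := by
        intro j
        rw [← hmem, Fin.ext_iff]
        constructor
        · rintro ⟨h1, h2⟩
          by_cases h3 : (j : ℕ) = x
          · exact Or.inr ⟨h3, h3 ▸ h2⟩
          · exact Or.inl ⟨by omega, h2⟩
        · rintro (⟨h1, h2⟩ | ⟨h1, h2⟩)
          · exact ⟨by omega, h2⟩
          · simp only at h1
            exact ⟨by omega, h1 ▸ h2⟩
      simp only at hA hC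
      by_cases h1 : (⟨x, hx⟩ : Fin n) ∈ A <;> by_cases h2 : (⟨x, hx⟩ : Fin n) ∈ C <;>
        simp only [h1, h2, iff_true, iff_false] at hA hC <;>
        simp only [hA, hC, if_true, if_false] at a c <;>
        simp only [h1, h2, if_true, if_false, List.nil_append, List.append_nil, List.cons_append]
          at hw <;> rw [hw]
      · refine ⟨by simp only [unmatchedClosed]; omega, fun j => ?_⟩
        rw [unmatchedOpen_true, unmatchedOpen_false, hj, List.mem_append, i2]
        simp [unmatchedClosed]
        omega
      · refine ⟨by simp only [unmatchedClosed]; omega, fun j => ?_⟩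
        rw [unmatchedOpen_true, hj, List.mem_append, i2]
        refine or_congr Iff.rfl ?_
        split_ifs with h3
        · simp only [List.mem_singleton]
          have : excess A' C' (x + 1) < excess A' C' x := by omega
          tauto
        · simp only [List.not_mem_nil, false_iff]
          omega
      · refine ⟨by simp only [unmatchedClosed]; omega, fun j => ?_⟩
        rw [unmatchedOpen_false, hj, i2]
        have : ¬ excess A' C' (x + 1) < excess A' C' x := by omega
        tauto
      · refine ⟨by omega, fun j => ?_⟩
        rw [hj, i2]
        have : ¬ excess A' C' (x + 1) < excess A' C' x := by omega
        tauto

theorem map_unmatchedAbove {n : ℕ} (A C : Finset (Fin n)) :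
    (unmatchedAbove A C).map Fin.valEmbedding =
      unmatched (A.map Fin.valEmbedding) (C.map Fin.valEmbedding) := by
  have key := (mem_unmatchedOpen_par A C 0).2
  rw [List.drop_zero] at key
  ext x
  rw [Finset.mem_map]
  constructor
  · rintro ⟨j, hj, rfl⟩
    exact ((key j).1 (List.mem_toFinset.1 hj)).2
  · intro hx
    obtain ⟨j, -, rfl⟩ := Finset.mem_map.1 (unmatched_subset _ _ hx)
    exact ⟨j, List.mem_toFinset.2 ((key j).2 ⟨Nat.zero_le _, hx⟩), rfl⟩

theorem toRows_eStar {n : ℕ} (i : ℕ) (B : Arrangement n) :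
    toRows (eStar i B) = dropRow i (toRows B) := by
  funext r
  simp only [toRows, eStar, dropRow, upperRow, lowerRow, ← map_unmatchedAbove]
  split_ifs
  · rw [Finset.map_sdiff]
  · rw [Finset.map_union]
  · rfl

theorem toRows_eStarSweep {n : ℕ} (k : ℕ) (B : Arrangement n) :
    toRows (eStarSweep k B) = runWord (sweepWord k) (toRows B) := by
  induction k generalizing B with
  | zero => rfl
  | succ k ih => rw [eStarSweep, ih, toRows_eStar]; rfl

theorem toRows_collapseRows {n : ℕ} (k : ℕ) (B : Arrangement n) :
    toRows (collapseRows k B) = runWord (collapseWord k) (toRows B) := by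
  induction k with
  | zero => rfl
  | succ k ih => rw [collapseRows, toRows_eStarSweep, ih, collapseWord, runWord_append]

theorem toRows_partialN {n : ℕ} (k : ℕ) (B : Arrangement n) :
    toRows (partialN k B) = stage k (toRows B) := by
  rw [partialN, toRows_collapseRows, stage]
  congr 1
  funext r
  simp only [toRows, cutRows]
  split_ifs <;> simp

theorem card_partialN {n : ℕ} (k : ℕ) (B : Arrangement n) (r : ℕ) :
    (partialN k B r).card = (stage k (toRows B) r).card := by
  rw [← toRows_partialN, card_toRows]

theorem rhoN_eq_partialN {n L : ℕ} {B : Arrangement n} (hB : B ∈ BinaryMatrices L n) :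
    rhoN L B = partialN L B := by
  rw [rhoN, partialN]
  congr 1
  funext r
  split_ifs with h
  · rfl
  · exact hB r (by rw [Finset.mem_Icc]; omega)

theorem toRows_rhoN {n L : ℕ} {B : Arrangement n} (hB : B ∈ BinaryMatrices L n) :
    toRows (rhoN L B) = stage L (toRows B) := by
  rw [rhoN_eq_partialN hB, toRows_partialN]

theorem unmatchedAbove_subset {n : ℕ} (A C : Finset (Fin n)) : unmatchedAbove A C ⊆ A := by
  rw [← Finset.map_subset_map (f := Fin.valEmbedding), map_unmatchedAbove]
  exact unmatched_subset _ _

theorem disjoint_unmatchedAbove {n : ℕ} (A C : Finset (Fin n)) :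
    Disjoint C (unmatchedAbove A C) := by
  rw [← Finset.disjoint_map Fin.valEmbedding, map_unmatchedAbove]
  exact disjoint_unmatched _ _

theorem xMonomial_eStar {n L i : ℕ} (h1 : 1 ≤ i) (h2 : i + 1 ≤ L) (B : Arrangement n) :
    xMonomial L (eStar i B) = xMonomial L B := by
  refine prod_eq_of_pair (i := i) (j := i + 1) (Finset.mem_Icc.2 ⟨h1, by omega⟩)
    (Finset.mem_Icc.2 ⟨by omega, h2⟩) (by omega) ?_ fun r hr hr' => ?_
  · have e1 : eStar i B i = B i ∪ unmatchedAbove (B (i + 1)) (B i) := by simp [eStar]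
    have e2 : eStar i B (i + 1) = B (i + 1) \ unmatchedAbove (B (i + 1)) (B i) := by simp [eStar]
    rw [e1, e2, Finset.prod_union (disjoint_unmatchedAbove _ _), mul_assoc]
    congr 1
    rw [mul_comm]
    exact Finset.prod_sdiff (unmatchedAbove_subset _ _)
  · simp only [eStar, if_neg hr, if_neg hr']

theorem xMonomial_eStarSweep {n L k : ℕ} (h : k + 1 ≤ L) (B : Arrangement n) :
    xMonomial L (eStarSweep k B) = xMonomial L B := by
  induction k generalizing B with
  | zero => rfl
  | succ k ih => rw [eStarSweep, ih (by omega), xMonomial_eStar (by omega) h]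

theorem xMonomial_rhoN {n : ℕ} (L : ℕ) (B : Arrangement n) :
    xMonomial L (rhoN L B) = xMonomial L B := by
  have key : ∀ k, k ≤ L → xMonomial L (collapseRows k B) = xMonomial L B := by
    intro k hk
    induction k with
    | zero => rfl
    | succ k ih => rw [collapseRows, xMonomial_eStarSweep hk, ih (by omega)]
  exact key L le_rfl

/-- Rows all of whose balls lie in the first `n` columns come from an arrangement. -/
theorem exists_toRows_eq {n : ℕ} {B : Rows} (h : ∀ r, ∀ x ∈ B r, x < n) :
    ∃ B' : Arrangement n, toRows B' = B := by
  refine ⟨fun r => Finset.univ.filter fun j : Fin n => (j : ℕ) ∈ B r, ?_⟩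
  funext r
  ext x
  simp only [toRows, Finset.mem_map, Finset.mem_filter, Finset.mem_univ, true_and,
    Fin.valEmbedding_apply]
  constructor
  · rintro ⟨j, hj, rfl⟩; exact hj
  · intro hx; exact ⟨⟨x, h r x hx⟩, hx, rfl⟩

/-! ### The major index as an energy -/

theorem cyclicNext_map_val {n : ℕ} (S : Finset (Fin n)) (x : Fin n) :
    cyclicNext (S.map Fin.valEmbedding) (x : ℕ) = (cyclicNext S x).map Fin.val := by
  have hne : (S.map Fin.valEmbedding).Nonempty ↔ S.Nonempty := Finset.map_nonempty
  rcases S.eq_empty_or_nonempty with rfl | hS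
  · simp [cyclicNext]
  · obtain ⟨y, hy⟩ := exists_cyclicNext hS x
    obtain ⟨z, hz⟩ := exists_cyclicNext (hne.2 hS) (x : ℕ)
    rw [hy, hz, Option.map_some]
    obtain ⟨y1, y2, y3⟩ := cyclicNext_eq_some hy
    obtain ⟨z1, z2, z3⟩ := cyclicNext_eq_some hz
    obtain ⟨j, hj, rfl⟩ := Finset.mem_map.1 z1
    have e1 := fun h => y2 h j hj
    have e2 := fun h => y3 h j hj
    have e3 := fun h => z2 h y (Finset.mem_map.2 ⟨y, y1, rfl⟩)
    have e4 := fun h => z3 h y (Finset.mem_map.2 ⟨y, y1, rfl⟩)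
    simp only [Fin.valEmbedding_apply, Fin.le_def, Fin.lt_def] at e1 e2 e3 e4 ⊢
    congr 1
    omega

theorem pairBalls_cons {n : ℕ} {l : ℕ} {x y : Fin n} {w : List (ℕ × Fin n)} {S : Finset (Fin n)}
    (h : cyclicNext S x = some y) :
    pairBalls ((l, x) :: w) S = (l, x, y) :: pairBalls w (S.erase y) := by
  rw [pairBalls, h]

/-- As long as there are enough balls below, all the balls of the list are paired, and they realize
a cyclic pairing. -/
theorem pairBalls_spec {n : ℕ} (w : List (ℕ × Fin n)) (S : Finset (Fin n))
    (hw : (w.map Prod.snd).Nodup) (hS : w.length ≤ S.card) :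
    (pairBalls w S).map (fun p => (p.1, p.2.1)) = w ∧
      ((pairBalls w S).map fun p => p.2.2).Nodup ∧ (∀ p ∈ pairBalls w S, p.2.2 ∈ S) ∧
      CyclicPairing ((w.map Prod.snd).toFinset.map Fin.valEmbedding) (S.map Fin.valEmbedding)
        (((pairBalls w S).map fun p => p.2.2).toFinset.map Fin.valEmbedding)
        ((pairBalls w S).countP fun p => p.2.2 < p.2.1) := by
  induction w generalizing S with
  | nil => exact ⟨rfl, List.nodup_nil, by simp [pairBalls], CyclicPairing.empty _⟩
  | cons a w ih =>
    obtain ⟨l, x⟩ := a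
    rw [List.length_cons] at hS
    obtain ⟨y, hy⟩ := exists_cyclicNext (Finset.card_pos.1 (by omega : 0 < S.card)) x
    have hyS := (cyclicNext_eq_some hy).1
    rw [List.map_cons, List.nodup_cons] at hw
    obtain ⟨i1, i2, i3, i4⟩ := ih (S.erase y) hw.2 (by rw [Finset.card_erase_of_mem hyS]; omega)
    rw [pairBalls_cons hy]
    refine ⟨by rw [List.map_cons, i1], ?_, ?_, ?_⟩
    · rw [List.map_cons, List.nodup_cons]
      refine ⟨fun hm => ?_, i2⟩
      obtain ⟨p, hp, hpy⟩ := List.mem_map.1 hm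
      have := i3 p hp
      rw [hpy] at this
      simp at this
    · intro p hp
      rcases List.mem_cons.1 hp with rfl | hp
      · exact hyS
      · exact Finset.mem_of_mem_erase (i3 p hp)
    · rw [Finset.map_erase] at i4
      have hc : cyclicNext (S.map Fin.valEmbedding) (x : ℕ) = some (y : ℕ) := by
        rw [cyclicNext_map_val, hy, Option.map_some]
      have hx : (x : ℕ) ∉ (w.map Prod.snd).toFinset.map Fin.valEmbedding := fun hm => by
        obtain ⟨z, hz, hzx⟩ := Finset.mem_map.1 hm
        have : z = x := Fin.val_injective hzx
        subst this
        exact hw.1 (List.mem_toFinset.1 hz)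
      have key := CyclicPairing.insert hx hc i4
      rw [List.map_cons, List.toFinset_cons, List.map_cons, List.toFinset_cons, Finset.map_insert,
        Finset.map_insert, List.countP_cons]
      convert key using 2 <;> first | rfl | simp

theorem mem_of_mem_pairBalls {n : ℕ} {w : List (ℕ × Fin n)} {S : Finset (Fin n)}
    {p : ℕ × Fin n × Fin n} (h : p ∈ pairBalls w S) : (p.1, p.2.1) ∈ w := by
  induction w generalizing S with
  | nil => simp [pairBalls] at h
  | cons a w ih =>
    obtain ⟨l, x⟩ := a
    rw [pairBalls] at h
    split at h
    · exact List.mem_cons_of_mem _ (ih h)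
    · rcases List.mem_cons.1 h with rfl | h
      · exact List.mem_cons_self
      · exact List.mem_cons_of_mem _ (ih h)

/-- The pairings with large labels are not affected by the balls with smaller labels. -/
theorem filter_pairBalls {n : ℕ} {w : List (ℕ × Fin n)} (hw : w.Pairwise fun a b => b.1 ≤ a.1)
    (S : Finset (Fin n)) (l : ℕ) :
    (pairBalls w S).filter (fun p => l ≤ p.1) = pairBalls (w.filter fun a => l ≤ a.1) S := by
  induction w generalizing S with
  | nil => rfl
  | cons a w ih =>
    rw [List.pairwise_cons] at hw
    by_cases ha : l ≤ a.1
    · rw [List.filter_cons_of_pos (by simpa using ha)]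
      obtain ⟨k, x⟩ := a
      rw [pairBalls, pairBalls]
      split
      · exact ih hw.2 S
      · rw [List.filter_cons_of_pos (by simpa using ha), ih hw.2]
    · have h1 : ((a :: w).filter fun a => l ≤ a.1) = [] := by
        rw [List.filter_eq_nil_iff]
        intro b hb
        rcases List.mem_cons.1 hb with rfl | hb
        · simpa using ha
        · have := hw.1 b hb
          simp
          omega
      rw [h1, pairBalls, List.filter_eq_nil_iff]
      intro p hp
      rcases List.mem_cons.1 (mem_of_mem_pairBalls hp) with hb | hb
      · subst hb
        simpa using ha
      · have := hw.1 _ hb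
        simp at this ⊢
        omega

theorem mem_priorityList {n L : ℕ} {lab : Fin n → ℕ} {a : ℕ × Fin n} :
    a ∈ priorityList L lab ↔ 1 ≤ a.1 ∧ a.1 ≤ L ∧ lab a.2 = a.1 := by
  obtain ⟨l, x⟩ := a
  simp only [priorityList, List.mem_flatMap, List.mem_reverse, List.mem_range'_1, List.mem_map,
    List.mem_filter, List.mem_finRange, true_and, decide_eq_true_eq]
  constructor
  · rintro ⟨k, hk, y, hy, h⟩
    obtain ⟨rfl, rfl⟩ := Prod.mk.inj h
    exact ⟨by omega, by omega, hy⟩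
  · rintro ⟨h1, h2, h3⟩
    exact ⟨l, by omega, x, h3, rfl⟩

theorem pairwise_priorityList {n : ℕ} (L : ℕ) (lab : Fin n → ℕ) :
    (priorityList L lab).Pairwise fun a b => b.1 ≤ a.1 := by
  rw [priorityList, List.pairwise_flatMap]
  refine ⟨fun l _ => ?_, ?_⟩
  · rw [List.pairwise_map]
    exact ((List.nodup_finRange n).filter _).imp fun _ => le_rfl
  · rw [List.pairwise_reverse]
    refine (List.pairwise_lt_range' (s := 1) (n := L)).imp fun {a b} hab x hx y hy => ?_
    obtain ⟨_, _, rfl⟩ := List.mem_map.1 hx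
    obtain ⟨_, _, rfl⟩ := List.mem_map.1 hy
    exact hab.le

theorem nodup_priorityList {n : ℕ} (L : ℕ) (lab : Fin n → ℕ) :
    ((priorityList L lab).map Prod.snd).Nodup := by
  rw [List.Nodup, List.pairwise_map, priorityList, List.pairwise_flatMap]
  refine ⟨fun l _ => ?_, ?_⟩
  · rw [List.pairwise_map]
    exact (List.nodup_finRange n).filter _
  · rw [List.pairwise_reverse]
    refine (List.pairwise_lt_range' (s := 1) (n := L)).imp fun {a b} hab x hx y hy => ?_
    obtain ⟨u, hu, rfl⟩ := List.mem_map.1 hx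
    obtain ⟨v, hv, rfl⟩ := List.mem_map.1 hy
    rw [List.mem_filter, decide_eq_true_eq] at hu hv
    rintro rfl
    have := hu.2.symm.trans hv.2
    omega

/-- The balls with labels at least `l`. -/
def labelled {n : ℕ} (l : ℕ) (lab : Fin n → ℕ) : Finset (Fin n) :=
  Finset.univ.filter fun x => l ≤ lab x

theorem toFinset_filter_priorityList {n L l : ℕ} {lab : Fin n → ℕ} (hl : 1 ≤ l)
    (hlab : ∀ x, lab x ≤ L) :
    (((priorityList L lab).filter fun a => l ≤ a.1).map Prod.snd).toFinset = labelled l lab := by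
  ext x
  simp only [List.mem_toFinset, List.mem_map, List.mem_filter, mem_priorityList, labelled,
    Finset.mem_filter, Finset.mem_univ, true_and, decide_eq_true_eq]
  constructor
  · rintro ⟨a, ⟨⟨h1, h2, h3⟩, h4⟩, rfl⟩; omega
  · intro h; exact ⟨(lab x, x), ⟨⟨by simp only; omega, hlab x, rfl⟩, h⟩, rfl⟩

/-- The pairings with labels at least `l` realize a cyclic pairing. -/
theorem pairBalls_labelled {n L l : ℕ} {lab : Fin n → ℕ} (S : Finset (Fin n)) (hl : 1 ≤ l)
    (hlab : ∀ x, lab x ≤ L) (hS : (labelled l lab).card ≤ S.card) :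
    let ps := (pairBalls (priorityList L lab) S).filter fun p => l ≤ p.1
    (ps.map fun p => p.2.2).toFinset.map Fin.valEmbedding =
        matched ((labelled l lab).map Fin.valEmbedding) (S.map Fin.valEmbedding) ∧
      (ps.countP fun p => p.2.2 < p.2.1) =
        excess ((labelled l lab).map Fin.valEmbedding) (S.map Fin.valEmbedding) 0 := by
  intro ps
  have hps : ps = pairBalls ((priorityList L lab).filter fun a => l ≤ a.1) S :=
    filter_pairBalls (pairwise_priorityList L lab) S l
  have hnd : (((priorityList L lab).filter fun a => l ≤ a.1).map Prod.snd).Nodup :=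
    (List.filter_sublist.map _).nodup (nodup_priorityList L lab)
  have hcard : ((priorityList L lab).filter fun a => l ≤ a.1).length ≤ S.card := by
    rw [← List.length_map (f := Prod.snd), ← List.toFinset_card_of_nodup hnd,
      toFinset_filter_priorityList hl hlab]
    exact hS
  have key := (pairBalls_spec _ S hnd hcard).2.2.2
  rw [toFinset_filter_priorityList hl hlab, ← hps] at key
  exact key.eq_matched

theorem fmLabel_succ {n : ℕ} (M : Arrangement n) (k r : ℕ) (y : Fin n) :
    fmLabel M (k + 1) r y =
      match (pairBalls (priorityList (r + k) (fmLabel M k (r + 1))) (M r)).find?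
        (fun p => p.2.2 = y) with
      | some p => p.1
      | none => if y ∈ M r then r else 0 := rfl

/-- The labels of row `r`, if it is the first of the top `k` rows: the balls of this row, and no
vacancies, have labels, which lie between `r` and `r + k - 1`, and the balls with labels at least
`l` are those reached by the strand from row `l`. -/
theorem fmLabel_spec {n : ℕ} {M : Arrangement n}
    (hM : ∀ r r', 1 ≤ r → r ≤ r' → (M r').card ≤ (M r).card) (k r : ℕ) (hr : 1 ≤ r) :
    (∀ x, fmLabel M k r x < r + k) ∧
      (1 ≤ k → ∀ x, (x ∈ M r → r ≤ fmLabel M k r x) ∧ (x ∉ M r → fmLabel M k r x = 0)) ∧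
      ∀ l, r ≤ l → l < r + k →
        (labelled l (fmLabel M k r)).map Fin.valEmbedding = strand (toRows M) l (l - r) := by
  induction k generalizing r with
  | zero => exact ⟨fun x => by simp [fmLabel]; omega, fun h => by omega, fun l h1 h2 => by omega⟩
  | succ k ih =>
    obtain ⟨i1, i2, i3⟩ := ih (r + 1) (by omega)
    have hM' : ∀ r r', 1 ≤ r → r ≤ r' → (toRows M r').card ≤ (toRows M r).card := by
      simpa only [card_toRows] using hM
    set lab := fmLabel M k (r + 1) with hlab
    have hle : ∀ x, lab x ≤ r + k := fun x => by have := i1 x; omega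
    -- only balls of row `r + 1` have positive labels
    have hpos : ∀ x, 1 ≤ lab x → r + 1 ≤ lab x := by
      intro x hx
      rcases Nat.eq_zero_or_pos k with rfl | hk
      · simp [hlab, fmLabel] at hx
      · by_cases hxM : x ∈ M (r + 1)
        · exact (i2 hk x).1 hxM
        · have := (i2 hk x).2 hxM; omega
    have hcard : ∀ l, 1 ≤ l → (labelled l lab).card ≤ (M r).card := by
      intro l hl
      refine le_trans (Finset.card_le_card (t := M (r + 1)) fun x hx => ?_)
        (hM r (r + 1) hr (by omega))
      have hx' := (Finset.mem_filter.1 hx).2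
      rcases Nat.eq_zero_or_pos k with rfl | hk
      · simp [hlab, fmLabel] at hx'; omega
      · by_contra hxM
        have := (i2 hk x).2 hxM; omega
    set ps := pairBalls (priorityList (r + k) lab) (M r) with hps
    have hall : (priorityList (r + k) lab).filter (fun a => 1 ≤ a.1) = priorityList (r + k) lab :=
      List.filter_eq_self.2 fun a ha => by simpa using (mem_priorityList.1 ha).1
    have hnd := nodup_priorityList (r + k) lab
    have hlen : (priorityList (r + k) lab).length ≤ (M r).card := by
      rw [← List.length_map (f := Prod.snd), ← List.toFinset_card_of_nodup hnd, ← hall,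
        toFinset_filter_priorityList le_rfl hle]
      exact hcard 1 le_rfl
    obtain ⟨-, q2, q3, -⟩ := pairBalls_spec _ (M r) hnd hlen
    have hpl : ∀ p ∈ ps, r + 1 ≤ p.1 ∧ p.1 ≤ r + k := by
      intro p hp
      obtain ⟨h1, h2, h3⟩ := mem_priorityList.1 (mem_of_mem_pairBalls hp)
      simp only at h1 h2 h3
      have := hpos p.2.1 (by omega)
      omega
    -- the label of `y` is that of the pairing with lower ball `y`, if there is one
    have hsome : ∀ p ∈ ps, fmLabel M (k + 1) r p.2.2 = p.1 := by
      intro p hp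
      rw [fmLabel_succ]
      have hf : ∃ q, ps.find? (fun q => q.2.2 = p.2.2) = some q := by
        rw [← Option.isSome_iff_exists, List.find?_isSome]
        exact ⟨p, hp, by simp⟩
      obtain ⟨q, hq⟩ := hf
      have hq1 := List.find?_some hq
      have hq2 := List.mem_of_find?_eq_some hq
      simp only [decide_eq_true_eq] at hq1
      have : q = p := List.inj_on_of_nodup_map q2 hq2 hp hq1
      rw [← hlab, ← hps, hq, this]
    have hnone : ∀ y, (∀ p ∈ ps, p.2.2 ≠ y) →
        fmLabel M (k + 1) r y = if y ∈ M r then r else 0 := by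
      intro y hy
      rw [fmLabel_succ, ← hlab, ← hps, List.find?_eq_none.2 fun p hp => by simpa using hy p hp]
    have hcases : ∀ y, (∃ p ∈ ps, p.2.2 = y ∧ y ∈ M r ∧ fmLabel M (k + 1) r y = p.1) ∨
        ((∀ p ∈ ps, p.2.2 ≠ y) ∧ fmLabel M (k + 1) r y = if y ∈ M r then r else 0) := by
      intro y
      by_cases h : ∃ p ∈ ps, p.2.2 = y
      · obtain ⟨p, hp, rfl⟩ := h
        exact Or.inl ⟨p, hp, rfl, q3 p hp, hsome p hp⟩
      · have h' : ∀ p ∈ ps, p.2.2 ≠ y := fun p hp hpy => h ⟨p, hp, hpy⟩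
        exact Or.inr ⟨h', hnone y h'⟩
    refine ⟨fun y => ?_, fun _ y => ?_, fun l hl hl' => ?_⟩
    · rcases hcases y with ⟨p, hp, -, -, h⟩ | ⟨-, h⟩
      · have := hpl p hp; omega
      · rw [h]; split_ifs <;> omega
    · rcases hcases y with ⟨p, hp, -, hy, h⟩ | ⟨-, h⟩
      · have := hpl p hp
        exact ⟨fun _ => by omega, fun hy' => absurd hy hy'⟩
      · rw [h]
        exact ⟨fun hy => by rw [if_pos hy], fun hy => by rw [if_neg hy]⟩
    · rcases Nat.eq_or_lt_of_le hl with rfl | hl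
      · rw [Nat.sub_self, strand, toRows]
        congr 1
        ext y
        simp only [labelled, Finset.mem_filter, Finset.mem_univ, true_and]
        rcases hcases y with ⟨p, hp, -, hy, h⟩ | ⟨-, h⟩
        · have := hpl p hp
          exact ⟨fun _ => hy, fun _ => by omega⟩
        · rw [h]
          split_ifs with hy
          · simp [hy]
          · simp only [hy, iff_false]; omega
      · have key := (pairBalls_labelled (M r) (by omega : 1 ≤ l) hle (hcard l (by omega))).1
        rw [i3 l (by omega) (by omega)] at key
        rw [show l - r = l - (r + 1) + 1 by omega, strand,
          show l - (l - (r + 1) + 1) = r by omega]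
        refine Eq.trans ?_ key
        congr 1
        ext y
        simp only [labelled, Finset.mem_filter, Finset.mem_univ, true_and, List.mem_toFinset,
          List.mem_map, List.mem_filter, decide_eq_true_eq]
        constructor
        · intro hy
          rcases hcases y with ⟨p, hp, hpy, -, h⟩ | ⟨-, h⟩
          · exact ⟨p, ⟨hp, by omega⟩, hpy⟩
          · rw [h] at hy
            split_ifs at hy <;> omega
        · rintro ⟨p, ⟨hp, hlp⟩, rfl⟩
          rw [hsome p hp]
          exact hlp

/-- A wrapping pairing of label `ℓ` counts once for each `l` in `r, …, ℓ`. -/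
theorem sum_map_weight {α : Type*} (ps : List (ℕ × α)) (P : ℕ × α → Prop) [DecidablePred P]
    {r L : ℕ} (h : ∀ p ∈ ps, r ≤ p.1 ∧ p.1 ≤ L) :
    (ps.map fun p => if P p then p.1 - r + 1 else 0).sum =
      ∑ l ∈ Finset.Icc r L, (ps.filter fun p => l ≤ p.1).countP fun p => P p := by
  induction ps with
  | nil => simp
  | cons p ps ih =>
    rw [List.map_cons, List.sum_cons, ih fun q hq => h q (List.mem_cons_of_mem _ hq)]
    have hp := h p List.mem_cons_self
    have e : ∀ l, ((p :: ps).filter fun p => l ≤ p.1).countP (fun p => P p) =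
        (if l ≤ p.1 then (if P p then 1 else 0) else 0) +
          (ps.filter fun p => l ≤ p.1).countP fun p => P p := by
      intro l
      by_cases hl : l ≤ p.1
      · rw [List.filter_cons_of_pos (by simpa using hl), List.countP_cons, if_pos hl, add_comm]
        simp
      · rw [List.filter_cons_of_neg (by simpa using hl), if_neg hl, zero_add]
    simp only [e, Finset.sum_add_distrib]
    congr 1
    rw [← Finset.sum_filter, Finset.sum_const, smul_eq_mul]
    have : (Finset.Icc r L).filter (fun l => l ≤ p.1) = Finset.Icc r p.1 := by
      ext l; simp only [Finset.mem_filter, Finset.mem_Icc]; omega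
    rw [this, Nat.card_Icc]
    split_ifs <;> omega

/-- The major index is the energy: a pairing of label `l` from row `r` to row `r - 1` contributes to
the strands starting in the rows `r, …, l`. -/
theorem maj_eq_energy {n : ℕ} (L : ℕ) {M : Arrangement n}
    (hM : ∀ r r', 1 ≤ r → r ≤ r' → (M r').card ≤ (M r).card) : maj L M = energy L (toRows M) := by
  have h1 : maj L M = ∑ r ∈ Finset.Icc 2 L, ∑ l ∈ Finset.Icc r L,
      excess (strand (toRows M) l (l - r)) (toRows M (r - 1)) 0 := by
    refine Finset.sum_congr rfl fun r hr => ?_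
    rw [Finset.mem_Icc] at hr
    obtain ⟨s1, s2, s3⟩ := fmLabel_spec hM (L + 1 - r) r (by omega)
    have hle : ∀ x, fmLabel M (L + 1 - r) r x ≤ L := fun x => by have := s1 x; omega
    rw [fmPairs]
    refine (sum_map_weight (r := r) (L := L) _
      (fun p : ℕ × Fin n × Fin n => p.2.2 < p.2.1) ?_).trans ?_
    rotate_left
    · refine Finset.sum_congr rfl fun l hl => ?_
      rw [Finset.mem_Icc] at hl
      have e := s3 l hl.1 (by omega)
      have hsub : (labelled l (fmLabel M (L + 1 - r) r)).card ≤ (M (r - 1)).card := by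
        refine le_trans (Finset.card_le_card (t := M r) fun x hx => ?_)
          (hM (r - 1) r (by omega) (by omega))
        by_contra hxM
        have := (s2 (by omega) x).2 hxM
        have := (Finset.mem_filter.1 hx).2
        omega
      have key := (pairBalls_labelled (M (r - 1)) (by omega : 1 ≤ l) hle hsub).2
      rw [e] at key
      exact key
    · intro p hp
      obtain ⟨h1, h2, h3⟩ := mem_priorityList.1 (mem_of_mem_pairBalls hp)
      simp only at h1 h2 h3
      refine ⟨?_, h2⟩
      by_cases hxM : p.2.1 ∈ M r
      · have := (s2 (by omega) p.2.1).1 hxM; omega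
      · have := (s2 (by omega) p.2.1).2 hxM; omega
  rw [h1, energy, Finset.sum_comm' (t' := Finset.Icc 1 L) (s' := fun l => Finset.Icc 2 l)
    (by intro r l; simp only [Finset.mem_Icc]; omega)]
  refine Finset.sum_congr rfl fun l hl => ?_
  refine Finset.sum_nbij' (fun r => l - r) (fun t => l - t) ?_ ?_ ?_ ?_ ?_
  all_goals simp only [Finset.mem_Icc, Finset.mem_range]
  · intro r hr; omega
  · intro t ht; omega
  · intro r hr; omega
  · intro t ht; omega
  · intro r hr; rw [show l - (l - r + 1) = r - 1 by omega]

/-! ### The charge as an energy -/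

theorem strand_eq_empty {M : Rows} {l t : ℕ} (h : M l = ∅) : strand M l t = ∅ := by
  induction t with
  | zero => exact h
  | succ t ih =>
    have := card_matched (A := strand M l t) (C := M (l - (t + 1))) (by simp [ih])
    rw [ih, Finset.card_empty, Finset.card_eq_zero] at this
    rw [strand, ih, this]

theorem excess_empty (C : Finset ℕ) (x : ℕ) : excess ∅ C x = 0 := by
  rw [← sufCount_unmatched]
  exact Nat.le_zero.1 ((sufCount_mono (unmatched_subset ∅ C) x).trans (sufCount_empty x).le)

theorem energy_of_empty {M : Rows} {K L : ℕ} (hKL : K ≤ L) (h : ∀ r, K < r → M r = ∅) :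
    energy L M = energy K M := by
  symm
  refine Finset.sum_subset (Finset.Icc_subset_Icc le_rfl hKL) fun l _ hl' => ?_
  refine Finset.sum_eq_zero fun t _ => ?_
  rw [strand_eq_empty (h l ?_), excess_empty]
  simp only [Finset.mem_Icc] at *
  omega

theorem sum_Icc_sum_Ico (f : ℕ → Prop) [DecidablePred f] (K : ℕ) :
    ∑ l ∈ Finset.Icc 1 K, ∑ i ∈ Finset.Ico 1 l, (if f i then 1 else 0) =
      ∑ i ∈ Finset.Ico 1 K, if f i then K - i else 0 := by
  rw [Finset.sum_comm' (t' := Finset.Ico 1 K) (s' := fun i => Finset.Ioc i K)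
    (by intro l i; simp only [Finset.mem_Icc, Finset.mem_Ico, Finset.mem_Ioc]; omega)]
  refine Finset.sum_congr rfl fun i _ => ?_
  rw [Finset.sum_const, Nat.card_Ioc, smul_eq_mul]
  split_ifs <;> simp

/-- Removing a strand of balls `q K, …, q 1`, each of which is the cyclic successor of the previous
one, from the rows. -/
theorem energy_erase {R R' : Rows} {K : ℕ} {q : ℕ → ℕ}
    (hR : ∀ r r', 1 ≤ r → r ≤ r' → (R r').card ≤ (R r).card) (hK : 1 ≤ K) (hqK : q K ∈ R K)
    (hq : ∀ j, 1 ≤ j → j < K → cyclicNext (R j) (q (j + 1)) = some (q j))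
    (hR' : ∀ r, 1 ≤ r → r ≤ K → R' r = (R r).erase (q r)) :
    energy K R = (∑ i ∈ Finset.Ico 1 K, if q i < q (i + 1) then K - i else 0) + energy K R' := by
  have hqR : ∀ j, 1 ≤ j → j ≤ K → q j ∈ R j := fun j h1 h2 => by
    rcases Nat.eq_or_lt_of_le h2 with rfl | h
    · exact hqK
    · exact (cyclicNext_eq_some (hq j h1 h)).1
  have hcard : ∀ l t, 1 ≤ l → l ≤ K → t + 1 < l →
      (strand R l t).card ≤ (R (l - (t + 1))).card := fun l t h1 h2 h3 => by
    rw [card_strand (fun r hr hr' => hR r l hr hr'.le) (by omega)]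
    exact hR _ _ (by omega) (by omega)
  have key : ∀ l, 1 ≤ l → l ≤ K → ∀ t, t < l →
      q (l - t) ∈ strand R l t ∧ strand R' l t = (strand R l t).erase (q (l - t)) := by
    intro l h1 h2 t
    induction t with
    | zero => exact fun _ => ⟨hqR l h1 h2, hR' l h1 h2⟩
    | succ t ih =>
      intro ht
      obtain ⟨i1, i2⟩ := ih (by omega)
      have hn := hq (l - (t + 1)) (by omega) (by omega)
      rw [show l - (t + 1) + 1 = l - t by omega] at hn
      obtain ⟨m2, m3, -⟩ := matched_erase (hcard l t h1 h2 (by omega)) i1 hn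
      rw [strand, strand, i2, hR' _ (by omega) (by omega)]
      exact ⟨m2, m3⟩
  rw [← sum_Icc_sum_Ico, energy, energy, ← Finset.sum_add_distrib]
  refine Finset.sum_congr rfl fun l hl => ?_
  rw [Finset.mem_Icc] at hl
  have hre : ∑ i ∈ Finset.Ico 1 l, (if q i < q (i + 1) then 1 else 0) =
      ∑ t ∈ Finset.range (l - 1), if q (l - (t + 1)) < q (l - t) then 1 else 0 := by
    refine Finset.sum_nbij' (fun i => l - (i + 1)) (fun t => l - (t + 1)) ?_ ?_ ?_ ?_ ?_
    all_goals simp only [Finset.mem_Ico, Finset.mem_range]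
    · intro r hr; omega
    · intro t ht; omega
    · intro r hr; omega
    · intro t ht; omega
    · intro r hr
      rw [show l - (l - (r + 1) + 1) = r by omega, show l - (l - (r + 1)) = r + 1 by omega]
  rw [hre, ← Finset.sum_add_distrib]
  refine Finset.sum_congr rfl fun t ht => ?_
  rw [Finset.mem_range] at ht
  obtain ⟨i1, i2⟩ := key l hl.1 hl.2 t (by omega)
  have hn := hq (l - (t + 1)) (by omega) (by omega)
  rw [show l - (t + 1) + 1 = l - t by omega] at hn
  obtain ⟨-, -, m4⟩ := matched_erase (hcard l t hl.1 hl.2 (by omega)) i1 hn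
  rw [i2, hR' _ (by omega) (by omega), m4, add_comm]

/-- The positions in `S` of the letter `r` of the word `w`, for each `r`. -/
def letterRows (w : List ℕ) (S : Finset ℕ) : Rows := fun r => S.filter fun q => w.getD q 0 = r

/-- A charge subword is a chain `q k, …, q 1` of cyclic successors in the rows of positions. -/
theorem chargeScan_spec {w : List ℕ} {S : Finset ℕ} {k : ℕ}
    (h : ∀ j, 1 ≤ j → j ≤ k → (letterRows w S j).Nonempty) (p : ℕ) :
    ∃ q : ℕ → ℕ, q (k + 1) = p ∧
      (∀ j, 1 ≤ j → j ≤ k → cyclicNext (letterRows w S j) (q (j + 1)) = some (q j)) ∧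
      chargeScan w S k p = (List.range k).map fun i => q (k - i) := by
  induction k generalizing p with
  | zero => exact ⟨fun _ => p, rfl, fun j h1 h2 => by omega, rfl⟩
  | succ k ih =>
    obtain ⟨y, hy⟩ := exists_cyclicNext (h (k + 1) (by omega) le_rfl) p
    obtain ⟨q, h1, h2, h3⟩ := ih (fun j hj hj' => h j hj (by omega)) y
    have hu : ∀ j, j ≤ k + 1 → Function.update q (k + 2) p j = q j := fun j hj =>
      Function.update_of_ne (by omega) p q
    refine ⟨Function.update q (k + 2) p, Function.update_self _ _ _, fun j hj hj' => ?_, ?_⟩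
    · rw [hu j hj']
      rcases Nat.eq_or_lt_of_le hj' with rfl | hlt
      · rw [h1, show k + 1 + 1 = k + 2 from rfl, Function.update_self]; exact hy
      · rw [hu _ (by omega)]
        exact h2 j hj (by omega)
    · have hy' : cyclicNext (S.filter fun q => w.getD q 0 = k + 1) p = some y := hy
      rw [chargeScan, hy']
      change y :: chargeScan w S k y = _
      rw [h3, List.range_succ_eq_map, List.map_cons, List.map_map, Nat.sub_zero, hu _ le_rfl, h1]
      congr 1
      refine List.map_congr_left fun i hi => ?_
      simp only [Function.comp_apply]
      rw [hu _ (by omega)]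
      congr 1
      omega

theorem permCharge_map (q : ℕ → ℕ) (k : ℕ) :
    permCharge ((List.range k).map fun i => q (k - i)) =
      ∑ i ∈ Finset.Ico 1 k, if q i < q (i + 1) then k - i else 0 := by
  have hget : ∀ i, i < k → ((List.range k).map fun i => q (k - i)).getD i 0 = q (k - i) := by
    intro i hi
    simp [List.getD, hi]
  unfold permCharge
  rw [List.length_map, List.length_range]
  refine Finset.sum_congr rfl fun i hi => ?_
  rw [Finset.mem_Ico] at hi
  rw [hget _ (by omega), hget _ (by omega), show k - (k - i) = i by omega,
    show k - (k - (i + 1)) = i + 1 by omega]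

/-- The charge of a word with partition content is the energy of the rows formed by the positions of
its letters: the charge subwords are removed one after the other. -/
theorem chargeAux_eq_energy {w : List ℕ} {m L : ℕ} {S : Finset ℕ}
    (hS : ∀ q ∈ S, w.getD q 0 ≤ L)
    (hR : ∀ r r', 1 ≤ r → r ≤ r' → (letterRows w S r').card ≤ (letterRows w S r).card)
    (hm : (letterRows w S 1).card = m) : chargeAux w m S = energy L (letterRows w S) := by
  induction m generalizing S with
  | zero =>
    have h0 : ∀ r, 0 < r → letterRows w S r = ∅ := fun r hr => by
      have := hR 1 r le_rfl hr
      rw [hm] at this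
      exact Finset.card_eq_zero.1 (Nat.le_zero.1 this)
    rw [energy_of_empty (Nat.zero_le L) h0]
    rfl
  | succ m ih =>
    have h1 : (letterRows w S 1).Nonempty := Finset.card_pos.1 (by omega)
    have hSne : S.Nonempty := h1.mono (Finset.filter_subset _ _)
    obtain ⟨p, hp, hpK⟩ := Finset.exists_mem_eq_sup S hSne fun q => w.getD q 0
    set K := S.sup fun q => w.getD q 0 with hKdef
    have hle : ∀ q ∈ S, w.getD q 0 ≤ K := fun q hq => Finset.le_sup (f := fun q => w.getD q 0) hq
    have hK1 : 1 ≤ K := by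
      obtain ⟨q, hq⟩ := h1
      have h2 := Finset.mem_filter.1 hq
      have := hle q h2.1
      omega
    have hKL : K ≤ L := hpK ▸ hS p hp
    have hemp : ∀ r, K < r → letterRows w S r = ∅ := fun r hr => by
      refine Finset.filter_eq_empty_iff.2 fun q hq => ?_
      have := hle q hq
      omega
    have hKne : (letterRows w S K).Nonempty := ⟨p, Finset.mem_filter.2 ⟨hp, hpK.symm⟩⟩
    have hne : ∀ j, 1 ≤ j → j ≤ K → (letterRows w S j).Nonempty := fun j hj hj' => by
      have := hR j K hj hj'
      have := Finset.card_pos.2 hKne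
      exact Finset.card_pos.1 (by omega)
    obtain ⟨q, q1, q2, q3⟩ := chargeScan_spec hne 0
    have hqmem : ∀ j, 1 ≤ j → j ≤ K → q j ∈ letterRows w S j := fun j hj hj' =>
      (cyclicNext_eq_some (q2 j hj hj')).1
    have hR' : ∀ r, 1 ≤ r → r ≤ K →
        letterRows w (S \ (chargeScan w S K 0).toFinset) r = (letterRows w S r).erase (q r) := by
      intro r hr hr'
      ext x
      simp only [letterRows, Finset.mem_filter, Finset.mem_sdiff, Finset.mem_erase, q3,
        List.mem_toFinset, List.mem_map, List.mem_range]
      constructor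
      · rintro ⟨⟨hx, hn⟩, hxr⟩
        refine ⟨fun hxq => hn ⟨K - r, by omega, ?_⟩, hx, hxr⟩
        rw [show K - (K - r) = r by omega, hxq]
      · rintro ⟨hn, hx, hxr⟩
        refine ⟨⟨hx, ?_⟩, hxr⟩
        rintro ⟨i, hi, hix⟩
        have := (Finset.mem_filter.1 (hqmem (K - i) (by omega) (by omega))).2
        rw [hix, hxr] at this
        rw [← this] at hix
        exact hn hix.symm
    have hR'0 : ∀ r, K < r → letterRows w (S \ (chargeScan w S K 0).toFinset) r = ∅ := by
      intro r hr
      refine Finset.filter_eq_empty_iff.2 fun x hx => ?_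
      have := hle x (Finset.mem_sdiff.1 hx).1
      omega
    have hcard : ∀ r, 1 ≤ r → r ≤ K →
        (letterRows w (S \ (chargeScan w S K 0).toFinset) r).card + 1 =
          (letterRows w S r).card := by
      intro r hr hr'
      rw [hR' r hr hr', Finset.card_erase_of_mem (hqmem r hr hr')]
      have := Finset.card_pos.2 (hne r hr hr')
      omega
    have hrec : chargeAux w (m + 1) S = permCharge (chargeScan w S K 0) +
        chargeAux w m (S \ (chargeScan w S K 0).toFinset) := rfl
    rw [q3] at hR' hR'0 hcard hrec
    rw [hrec, ih, energy_of_empty hKL hemp, energy_of_empty hKL hR'0, permCharge_map,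
      energy_erase hR hK1 (hqmem K hK1 le_rfl) (fun j hj hj' => q2 j hj hj'.le) hR']
    · exact fun x hx => hS x (Finset.mem_sdiff.1 hx).1
    · intro r r' hr hrr
      by_cases hr' : r' ≤ K
      · have := hcard r hr (by omega)
        have := hcard r' (by omega) hr'
        have := hR r r' hr hrr
        omega
      · rw [hR'0 r' (by omega), Finset.card_empty]
        omega
    · have := hcard 1 le_rfl hK1
      omega

theorem count_eq_card_letterRows (w : List ℕ) {a : ℕ} :
    w.count a = (letterRows w (Finset.range w.length) a).card := by
  induction w using List.reverseRecOn with
  | nil => simp [letterRows]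
  | append_singleton w b ih =>
    rw [List.count_append, ih, List.length_append, List.length_singleton, letterRows, letterRows,
      Finset.range_add_one, Finset.filter_insert]
    have e : (Finset.range w.length).filter (fun q => (w ++ [b]).getD q 0 = a) =
        (Finset.range w.length).filter fun q => w.getD q 0 = a := by
      refine Finset.filter_congr fun q hq => ?_
      rw [List.getD_append _ _ _ _ (Finset.mem_range.1 hq)]
    have e' : (w ++ [b]).getD w.length 0 = b := by simp
    rw [e, e']
    by_cases hb : b = a
    · rw [if_pos hb, Finset.card_insert_of_notMem (by simp)]
      simp [hb]
    · rw [if_neg hb]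
      simp [hb]

theorem wordCharge_eq_energy {w : List ℕ} {L : ℕ} (hL : ∀ a ∈ w, a ≤ L)
    (hR : ∀ r r', 1 ≤ r → r ≤ r' → w.count r' ≤ w.count r) :
    wordCharge w = energy L (letterRows w (Finset.range w.length)) := by
  refine chargeAux_eq_energy (fun q hq => ?_) (fun r r' h1 h2 => ?_)
    (count_eq_card_letterRows w).symm
  · rw [Finset.mem_range] at hq
    rw [List.getD_eq_getElem _ _ hq]
    exact hL _ (List.getElem_mem hq)
  · rw [← count_eq_card_letterRows, ← count_eq_card_letterRows]
    exact hR r r' h1 h2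

/-! ### Tableaux and chains of row sizes -/

/-- The sizes `c k r` of the rows `r` of the successive stages `k` of a collapsing. -/
structure SizeChain (c : ℕ → ℕ → ℕ) : Prop where
  row_zero : ∀ k, c k 0 = 0
  of_lt : ∀ k r, k < r → c k r = 0
  interlace : ∀ k r, 1 ≤ r → c (k + 1) (r + 1) ≤ c k r ∧ c k r ≤ c (k + 1) r

theorem SizeChain.mono {c : ℕ → ℕ → ℕ} (h : SizeChain c) {k k' : ℕ} (hk : k ≤ k') (r : ℕ) :
    c k r ≤ c k' r := by
  induction hk with
  | refl => exact le_rfl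
  | step _ ih =>
    rcases Nat.eq_zero_or_pos r with rfl | hr
    · rw [h.row_zero, h.row_zero]
    · exact ih.trans (h.interlace _ r hr).2

theorem SizeChain.succ_le {c : ℕ → ℕ → ℕ} (h : SizeChain c) (k : ℕ) {r : ℕ} (hr : 1 ≤ r) :
    c k (r + 1) ≤ c k r :=
  (h.mono (Nat.le_succ k) _).trans (h.interlace k r hr).1

theorem SizeChain.antitone {c : ℕ → ℕ → ℕ} (h : SizeChain c) (k : ℕ) :
    Antitone fun i => c k (i + 1) :=
  antitone_nat_of_succ_le fun i => h.succ_le k (by omega)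

/-- The filling `T` is the tableau recording the chain `c` up to stage `L`: the box in row `i` and
column `j` is present with an entry at most `k` if and only if `j < c k (i + 1)`. -/
def Records (L : ℕ) (c : ℕ → ℕ → ℕ) (T : Filling) : Prop :=
  (∀ i j, T i j ≤ L) ∧ ∀ i j k, k ≤ L → ((1 ≤ T i j ∧ T i j ≤ k) ↔ j < c k (i + 1))

theorem Records.eq {L : ℕ} {c : ℕ → ℕ → ℕ} {T T' : Filling} (h : Records L c T)
    (h' : Records L c T') : T = T' := by
  funext i j
  have e := fun k (hk : k ≤ L) => (h.2 i j k hk).trans (h'.2 i j k hk).symm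
  have e1 := e (T i j) (h.1 i j)
  have e2 := e (T' i j) (h'.1 i j)
  omega

theorem Records.chain_eq {L : ℕ} {c c' : ℕ → ℕ → ℕ} {T : Filling} (h : Records L c T)
    (h' : Records L c' T) {k : ℕ} (hk : k ≤ L) (i : ℕ) : c k (i + 1) = c' k (i + 1) := by
  have e := fun j => (h.2 i j k hk).symm.trans (h'.2 i j k hk)
  have e1 := e (c k (i + 1))
  have e2 := e (c' k (i + 1))
  omega

theorem sizeChain_stage {B : Rows} (hB : B 0 = ∅) : SizeChain fun k r => (stage k B r).card where
  row_zero k := by simp only [stage_row_zero k hB, Finset.card_empty]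
  of_lt k r h := by simp only [stage_of_lt h B, Finset.card_empty]
  interlace k r h := ⟨(stage_interlace k B h).1.card_le, (stage_interlace k B h).2.card_le⟩

/-- The row of a recording tableau with `f k` entries at most `k`. -/
theorem getD_flatMap_replicate {f : ℕ → ℕ} (hf : Monotone f) (h0 : f 0 = 0) (L j : ℕ) :
    let row := (List.range' 1 L).flatMap fun k => List.replicate (f k - f (k - 1)) k
    row.length = f L ∧ row.getD j 0 ≤ L ∧
      ∀ k, k ≤ L → ((1 ≤ row.getD j 0 ∧ row.getD j 0 ≤ k) ↔ j < f k) := by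
  induction L with
  | zero => simp [h0]
  | succ L ih =>
    obtain ⟨i1, i2, i3⟩ := ih
    intro row
    set row' := (List.range' 1 L).flatMap fun k => List.replicate (f k - f (k - 1)) k with hrow'
    have hrow : row = row' ++ List.replicate (f (L + 1) - f L) (L + 1) := by
      simp only [row, List.range'_1_concat, List.flatMap_append, ← hrow']
      simp [add_comm 1 L]
    have hL := hf (Nat.le_succ L)
    simp only [Nat.succ_eq_add_one] at hL
    have hlen : row.length = f (L + 1) := by
      rw [hrow, List.length_append, i1, List.length_replicate]; omega
    refine ⟨hlen, ?_⟩
    by_cases hj : j < f L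
    · have e : row.getD j 0 = row'.getD j 0 := by
        rw [hrow, List.getD_append _ _ _ _ (by omega)]
      rw [e]
      refine ⟨by omega, fun k hk => ?_⟩
      rcases Nat.eq_or_lt_of_le hk with rfl | hk
      · have := i3 L le_rfl
        omega
      · exact i3 k (by omega)
    · by_cases hj' : j < f (L + 1)
      · have e : row.getD j 0 = L + 1 := by
          rw [hrow, List.getD_append_right _ _ _ _ (by omega), i1,
            List.getD_eq_getElem _ _ (by rw [List.length_replicate]; omega),
            List.getElem_replicate]
        rw [e]
        refine ⟨le_rfl, fun k hk => ?_⟩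
        rcases Nat.eq_or_lt_of_le hk with rfl | hk
        · omega
        · have := hf (show k ≤ L by omega)
          omega
      · have e : row.getD j 0 = 0 := List.getD_eq_default _ _ (by omega)
        rw [e]
        refine ⟨by omega, fun k hk => ?_⟩
        have := hf hk
        omega

theorem records_rhoQ {n : ℕ} (L : ℕ) {B : Arrangement n} (hB : B 0 = ∅) :
    Records L (fun k r => (stage k (toRows B) r).card) (rhoQ L B) := by
  have hc := sizeChain_stage (B := toRows B) (by simp [toRows, hB])
  have key := fun i => getD_flatMap_replicate (f := fun k => (stage k (toRows B) (i + 1)).card)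
    (fun k k' h => hc.mono h (i + 1)) (hc.of_lt 0 (i + 1) (by omega)) L
  simp only [Records, rhoQ, rhoQRow, card_partialN]
  exact ⟨fun i j => (key i j).2.1, fun i j => (key i j).2.2⟩

theorem exists_youngDiagram {f : ℕ → ℕ} (hf : Antitone f) {N : ℕ} (hN : ∀ i, N ≤ i → f i = 0) :
    ∃ ν : YoungDiagram, ∀ i, ν.rowLen i = f i := by
  let F := (Finset.range N ×ˢ Finset.range (f 0)).filter fun p => p.2 < f p.1
  have hmem : ∀ i j, (i, j) ∈ F ↔ j < f i := by
    intro i j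
    simp only [F, Finset.mem_filter, Finset.mem_product, Finset.mem_range]
    have h1 := hf (Nat.zero_le i)
    have h2 := hN i
    constructor
    · exact fun h => h.2
    · intro h
      refine ⟨⟨?_, by omega⟩, h⟩
      by_contra hi
      have := h2 (by omega)
      omega
  have hF : IsLowerSet (F : Set (ℕ × ℕ)) := by
    rintro ⟨i, j⟩ ⟨i', j'⟩ ⟨h1, h2⟩ h
    simp only [Finset.mem_coe, hmem] at h ⊢
    have := hf h1
    simp only at h1 h2 this
    omega
  refine ⟨⟨F, hF⟩, fun i => ?_⟩
  have h1 : ∀ j, j < YoungDiagram.rowLen ⟨F, hF⟩ i ↔ j < f i := fun j =>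
    (YoungDiagram.mem_iff_lt_rowLen (μ := ⟨F, hF⟩)).symm.trans (hmem i j)
  exact le_antisymm (not_lt.1 fun h => lt_irrefl _ ((h1 _).1 h))
    (not_lt.1 fun h => lt_irrefl _ ((h1 _).2 h))

/-- A filling recording a chain is a semistandard tableau. -/
theorem Records.mem_SSYTMax {L : ℕ} {c : ℕ → ℕ → ℕ} {T : Filling} (hc : SizeChain c)
    (h : Records L c T) {ν : YoungDiagram} (hν : ∀ i, ν.rowLen i = c L (i + 1)) :
    T ∈ SSYTMax ν L := by
  have hmem : ∀ i j, (i, j) ∈ ν ↔ 1 ≤ T i j := fun i j => by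
    rw [YoungDiagram.mem_iff_lt_rowLen, hν, ← h.2 i j L le_rfl]
    have := h.1 i j
    omega
  have hle : ∀ i j, 1 ≤ T i j → j < c (T i j) (i + 1) := fun i j hj =>
    (h.2 i j _ (h.1 i j)).1 ⟨hj, le_rfl⟩
  refine ⟨⟨⟨T, fun {i j1 j2} hj hm => ?_, fun {i1 i2 j} hi hm => ?_, fun {i j} hm => ?_⟩,
    fun _ _ => rfl, fun p hp => (hmem p.1 p.2).1 hp⟩, h.1⟩
  · have h1 := hle i j2 ((hmem i j2).1 hm)
    exact ((h.2 i j1 _ (h.1 i j2)).2 (by omega)).2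
  · have h0 := (hmem i2 j).1 hm
    have h1 := hle i2 j h0
    have h2 := h.1 i2 j
    obtain ⟨k, hk⟩ : ∃ k, T i2 j = k + 1 := ⟨T i2 j - 1, by omega⟩
    obtain ⟨i, rfl⟩ : ∃ i, i2 = i + 1 := ⟨i2 - 1, by omega⟩
    rw [hk] at h1 h2 ⊢
    have h3 := (hc.interlace k (i + 1) (by omega)).1
    have h4 := hc.antitone k (show i1 ≤ i by omega)
    simp only at h4
    have h5 := (h.2 i1 j k (by omega)).2 (by omega)
    omega
  · rw [hmem] at hm
    omega

/-- The entries at most `k` of a row of a tableau form an initial segment of it. -/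
theorem entry_le_iff_lt_card {ν : YoungDiagram} {T : Filling} (hT : T ∈ SSYT ν) (i k j : ℕ) :
    (1 ≤ T i j ∧ T i j ≤ k) ↔
      j < ((Finset.range (ν.rowLen i)).filter fun j => T i j ≤ k).card := by
  obtain ⟨S, hS, hpos⟩ := hT
  have hin : ∀ j, 1 ≤ T i j ↔ j < ν.rowLen i := by
    intro j
    rw [← YoungDiagram.mem_iff_lt_rowLen]
    refine ⟨fun h => ?_, fun h => by rw [hS]; exact hpos _ h⟩
    by_contra hm
    have := S.zeros hm
    rw [← hS] at this
    omega
  have hlow : ∀ j j', j ≤ j' → 1 ≤ T i j' → T i j ≤ T i j' := by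
    intro j j' hj h1
    rcases Nat.eq_or_lt_of_le hj with rfl | hj
    · exact le_rfl
    · rw [hS, hS]
      exact S.row_weak hj (YoungDiagram.mem_iff_lt_rowLen.2 ((hin j').1 h1))
  set F := (Finset.range (ν.rowLen i)).filter fun j => T i j ≤ k with hF
  have hmF : ∀ j, j ∈ F ↔ 1 ≤ T i j ∧ T i j ≤ k := fun j => by
    rw [hF, Finset.mem_filter, Finset.mem_range, ← hin]
  have hdown : ∀ j j', j ≤ j' → j' ∈ F → j ∈ F := by
    intro j j' hj h
    rw [hmF] at h ⊢
    have h1 := hlow j j' hj h.1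
    have h2 := (hin j').1 h.1
    have h3 := (hin j).2 (by omega)
    omega
  rw [← hmF]
  constructor
  · intro h
    have : Finset.range (j + 1) ⊆ F := fun x hx => hdown x j (by
      have := Finset.mem_range.1 hx; omega) h
    have := Finset.card_le_card this
    rw [Finset.card_range] at this
    omega
  · intro h
    by_contra hj
    have : F ⊆ Finset.range j := fun x hx => by
      rw [Finset.mem_range]
      by_contra hxj
      exact hj (hdown j x (by omega) hx)
    have := Finset.card_le_card this
    rw [Finset.card_range] at this
    omega

/-- Every semistandard tableau records a chain. -/
theorem exists_records {ν : YoungDiagram} {L : ℕ} {T : Filling} (hT : T ∈ SSYTMax ν L) :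
    ∃ c, SizeChain c ∧ Records L c T ∧ ∀ i, ν.rowLen i = c L (i + 1) := by
  obtain ⟨hT, hL⟩ := hT
  have key := entry_le_iff_lt_card hT
  let c : ℕ → ℕ → ℕ := fun k r =>
    if r = 0 then 0 else ((Finset.range (ν.rowLen (r - 1))).filter fun j => T (r - 1) j ≤ k).card
  have hck : ∀ i j k, (1 ≤ T i j ∧ T i j ≤ k) ↔ j < c k (i + 1) := fun i j k => key i k j
  have hle : ∀ m m' : ℕ, (∀ j, j < m → j < m') → m ≤ m' := fun m m' h => by
    by_contra hm
    exact lt_irrefl _ (h m' (by omega))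
  obtain ⟨S, hS, hpos⟩ := hT
  have hmem : ∀ i j, 1 ≤ T i j → (i, j) ∈ ν := fun i j h => by
    by_contra hm
    have := S.zeros hm
    rw [← hS] at this
    omega
  have hcol : ∀ i j, 1 ≤ T (i + 1) j → 1 ≤ T i j ∧ T i j < T (i + 1) j := fun i j h => by
    have h1 := hmem _ _ h
    have h2 := ν.up_left_mem (Nat.le_succ i) le_rfl h1
    rw [hS i j, hS (i + 1) j]
    exact ⟨hpos _ h2, S.col_strict (Nat.lt_succ_self i) h1⟩
  have hrow : ∀ i j, 1 ≤ T i j → i + 1 ≤ T i j := by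
    intro i
    induction i with
    | zero => exact fun j h => h
    | succ i ih =>
      intro j h
      have h1 := hcol i j h
      have h2 := ih j h1.1
      omega
  refine ⟨c, ⟨fun k => rfl, fun k r hr => ?_, fun k r hr => ?_⟩, ⟨hL, fun i j k _ => hck i j k⟩,
    fun i => ?_⟩
  · obtain ⟨i, rfl⟩ : ∃ i, r = i + 1 := ⟨r - 1, by omega⟩
    refine Nat.le_zero.1 (hle _ _ fun j hj => ?_)
    rw [← hck] at hj
    have := hrow i j hj.1
    omega
  · obtain ⟨i, rfl⟩ : ∃ i, r = i + 1 := ⟨r - 1, by omega⟩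
    refine ⟨hle _ _ fun j hj => ?_, hle _ _ fun j hj => ?_⟩
    · rw [← hck] at hj ⊢
      have := hcol i j hj.1
      omega
    · rw [← hck] at hj ⊢
      omega
  · simp only [c, Nat.add_one_ne_zero, if_false, Nat.add_sub_cancel]
    rw [Finset.filter_true_of_mem fun j _ => hL i j, Finset.card_range]

/-- The number of entries `k` of a filling recording a chain. -/
theorem Records.content_eq {L : ℕ} {c : ℕ → ℕ → ℕ} {T : Filling} (hc : SizeChain c)
    (h : Records L c T) {k : ℕ} (hk : k + 1 ≤ L) :
    content T (k + 1) = ∑ i ∈ Finset.range (k + 1), (c (k + 1) (i + 1) - c k (i + 1)) := by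
  have hset : {p : ℕ × ℕ | T p.1 p.2 = k + 1} =
      (((Finset.range (k + 1)).sigma fun i => Finset.Ico (c k (i + 1)) (c (k + 1) (i + 1))).map
        (Equiv.sigmaEquivProd ℕ ℕ).toEmbedding : Finset (ℕ × ℕ)) := by
    ext ⟨i, j⟩
    simp only [Set.mem_ofPred_eq, Finset.coe_map, Set.mem_image, Finset.mem_coe, Finset.mem_sigma,
      Finset.mem_range, Finset.mem_Ico, Equiv.coe_toEmbedding, Sigma.exists]
    have h1 := h.2 i j k (by omega)
    have h2 := h.2 i j (k + 1) hk
    constructor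
    · intro hT
      refine ⟨i, j, ⟨?_, by omega, by omega⟩, rfl⟩
      by_contra hi
      have := hc.of_lt (k + 1) (i + 1) (by omega)
      omega
    · rintro ⟨a, b, ⟨h3, h4, h5⟩, h6⟩
      simp only [Equiv.sigmaEquivProd_apply, Prod.mk.injEq] at h6
      obtain ⟨rfl, rfl⟩ := h6
      omega
  rw [content, hset, Set.ncard_coe_finset, Finset.card_map, Finset.card_sigma]
  exact Finset.sum_congr rfl fun i _ => Nat.card_Ico _ _

theorem content_rhoQ {n L : ℕ} {B : Arrangement n} (hB : B 0 = ∅) {k : ℕ} (hk : k + 1 ≤ L) :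
    content (rhoQ L B) (k + 1) = (B (k + 1)).card := by
  have h0 : toRows B 0 = ∅ := by simp [toRows, hB]
  have hc := sizeChain_stage h0
  rw [(records_rhoQ L hB).content_eq hc hk]
  have e := sum_card_stage_succ k (toRows B) (n := k + 2) (by omega)
  rw [Finset.sum_range_succ', Finset.sum_range_succ' (fun r => (stage k (toRows B) r).card),
    stage_row_zero _ h0, stage_row_zero _ h0, card_toRows] at e
  rw [Finset.sum_tsub_distrib _ fun i _ => hc.mono (Nat.le_add_right k 1) (i + 1)]
  simp only [Finset.card_empty] at e
  omega

/-! ### Collapsing the row reading word of a tableau -/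

/-- If `A` lies to the left of `C` and `V` to its right, and `A` is not larger than `C`, then `A`
is matched by `C` and exactly the elements of `V` are unmatched. -/
theorem unmatched_block {A C V : Finset ℕ} (hA : ∀ x ∈ A, ∀ y ∈ C, x < y)
    (hV : ∀ x ∈ V, ∀ y ∈ C, y < x) (hAV : Disjoint A V) (hcard : A.card ≤ C.card) :
    unmatched (A ∪ V) C = V := by
  refine sufCount_injective (funext fun x => ?_)
  rw [sufCount_unmatched]
  refine excess_eq_of_rec _ _ (sufCount V) (V.sup id + 1) (fun y => sufCount_eq_zero V)
    (fun x => ?_) x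
  have h1 := sufCount_union hAV x
  have h2 := sufCount_succ V x
  have h3 : sufCount A x ≤ sufCount C x := by
    by_cases h : ∃ c ∈ C, c < x
    · obtain ⟨c, hc, hcx⟩ := h
      have : sufCount A x = 0 := by
        rw [sufCount, Finset.card_eq_zero, Finset.filter_eq_empty_iff]
        intro a ha
        have := hA a ha c hc
        omega
      omega
    · push Not at h
      calc sufCount A x ≤ A.card := Finset.card_filter_le _ _
        _ ≤ C.card := hcard
        _ = sufCount C x := by rw [sufCount, Finset.filter_true_of_mem h]
  have h4 : x ∈ V → sufCount C x = 0 := fun hx => by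
    rw [sufCount, Finset.card_eq_zero, Finset.filter_eq_empty_iff]
    intro y hy
    have := hV x hx y hy
    omega
  by_cases hx : x ∈ V
  · have := h4 hx
    rw [if_pos hx] at h2
    omega
  · rw [if_neg hx] at h2
    omega

/-- A sweep over rows which are blocks of balls: row `i + 1` is `C i`, and the segments `D i` by
which the blocks are to grow all start in the topmost row. -/
theorem sweep_blocks {C D : ℕ → Finset ℕ}
    (hlt : ∀ i, ∀ x ∈ C (i + 1) ∪ D (i + 1), ∀ y ∈ C i, x < y)
    (hgt : ∀ i j, i ≤ j → ∀ x ∈ D i, ∀ y ∈ C j, y < x)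
    (hdisj : ∀ j, Disjoint (C j ∪ D j) ((Finset.range j).biUnion D))
    (hcard : ∀ i, (C (i + 1) ∪ D (i + 1)).card ≤ (C i).card) {k : ℕ} {B : Rows}
    (hB : ∀ i, i < k → B (i + 1) = C i)
    (hk : B (k + 1) = (C k ∪ D k) ∪ (Finset.range k).biUnion D) {i : ℕ} (hi : i ≤ k) :
    runWord (sweepWord k) B (i + 1) = C i ∪ D i := by
  induction k generalizing B with
  | zero =>
    obtain rfl : i = 0 := by omega
    rw [sweepWord, runWord_nil, hk, Finset.range_zero, Finset.biUnion_empty, Finset.union_empty]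
  | succ k ih =>
    have hun : unmatched (B (k + 1 + 1)) (B (k + 1)) = (Finset.range (k + 1)).biUnion D := by
      rw [hk, hB k (by omega)]
      refine unmatched_block (hlt k) (fun x hx y hy => ?_) (hdisj _) (hcard k)
      obtain ⟨i, hi, hx⟩ := Finset.mem_biUnion.1 hx
      exact hgt i k (by have := Finset.mem_range.1 hi; omega) x hx y hy
    rw [sweepWord, runWord_cons]
    rcases Nat.eq_or_lt_of_le hi with rfl | hi'
    · rw [runWord_of_forall, dropRow, if_pos rfl, upperRow, hun, hk]
      · exact Finset.union_sdiff_cancel_right (hdisj _)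
      · intro i hi
        have := mem_sweepWord.1 hi
        omega
    · refine ih (fun i hi => ?_) ?_ (by omega)
      · rw [dropRow, if_neg (by omega), if_neg (by omega), hB i (by omega)]
      · rw [dropRow, if_neg (by omega), if_pos rfl, lowerRow, hun, hB k (by omega),
          Finset.range_add_one, Finset.biUnion_insert, Finset.union_assoc]

/-- The stages of the collapsing of the positions of the letters in a row reading word: if the
entries at most `k` of row `i` of the tableau are at the positions `o i, …, o i + c k (i + 1) - 1`,
then these positions form row `i + 1` of stage `k`. -/
theorem stage_blocks {L : ℕ} {c : ℕ → ℕ → ℕ} (hc : SizeChain c) {o : ℕ → ℕ}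
    (ho : ∀ i, o (i + 1) + c L (i + 2) ≤ o i) {W : Rows} (h0 : W 0 = ∅)
    (hW : ∀ k, k < L → ∀ x, x ∈ W (k + 1) ↔
      ∃ i, o i + c k (i + 1) ≤ x ∧ x < o i + c (k + 1) (i + 1)) {k : ℕ} (hk : k ≤ L) (i : ℕ) :
    stage k W (i + 1) = Finset.Ico (o i) (o i + c k (i + 1)) := by
  induction k generalizing i with
  | zero => simp [stage_zero h0, hc.of_lt 0 (i + 1) (by omega)]
  | succ k ih =>
    by_cases hi : i ≤ k
    · have ho' : Antitone o := antitone_nat_of_succ_le fun i => by have := ho i; omega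
      have hoc : ∀ i j, i < j → o j + c L (j + 1) ≤ o i := fun i j hij => by
        obtain ⟨j, rfl⟩ : ∃ j', j = j' + 1 := ⟨j - 1, by omega⟩
        exact (ho j).trans (ho' (by omega))
      have hmono := fun i => hc.mono (Nat.le_succ k) (i + 1)
      have hmono' := fun i => hc.mono hk (i + 1)
      simp only [Nat.succ_eq_add_one] at hmono
      have hun : ∀ i, Finset.Ico (o i) (o i + c k (i + 1)) ∪
          Finset.Ico (o i + c k (i + 1)) (o i + c (k + 1) (i + 1)) =
          Finset.Ico (o i) (o i + c (k + 1) (i + 1)) := fun i =>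
        Finset.Ico_union_Ico_eq_Ico (by omega) (by have := hmono i; omega)
      rw [stage_succ, sweep_blocks (C := fun i => Finset.Ico (o i) (o i + c k (i + 1)))
        (D := fun i => Finset.Ico (o i + c k (i + 1)) (o i + c (k + 1) (i + 1))) _ _ _ _ _ _ hi,
        hun]
      · intro i x hx y hy
        rw [hun, Finset.mem_Ico] at hx
        rw [Finset.mem_Ico] at hy
        have h1 := hmono' (i + 1)
        have h2 := ho i
        simp only [show i + 1 + 1 = i + 2 from rfl] at *
        omega
      · intro i j hij x hx y hy
        rw [Finset.mem_Ico] at hx hy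
        rcases Nat.eq_or_lt_of_le hij with rfl | hij
        · omega
        · have h1 := hoc i j hij
          have h2 := hmono j
          have h3 := hmono' j
          omega
      · intro j
        rw [hun, Finset.disjoint_left]
        intro x hx hx'
        obtain ⟨i, hi, hx'⟩ := Finset.mem_biUnion.1 hx'
        rw [Finset.mem_Ico] at hx hx'
        have h1 := hoc i j (Finset.mem_range.1 hi)
        have h3 := hmono' j
        omega
      · intro i
        rw [hun, Nat.card_Ico, Nat.card_Ico]
        have := (hc.interlace k (i + 1) (by omega)).1
        simp only [show i + 1 + 1 = i + 2 from rfl] at *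
        omega
      · intro i hi
        rw [Function.update_of_ne (by omega), ih (by omega)]
      · rw [Function.update_self, hun]
        ext x
        have hz := hc.of_lt k (k + 1) (by omega)
        simp only [hW k (by omega), Finset.mem_union, Finset.mem_biUnion, Finset.mem_range,
          Finset.mem_Ico]
        constructor
        · rintro ⟨i, h1, h2⟩
          rcases lt_trichotomy i k with h | rfl | h
          · exact Or.inr ⟨i, h, h1, h2⟩
          · left; omega
          · have := hc.of_lt (k + 1) (i + 1) (by omega)
            omega
        · rintro (h | ⟨i, -, h⟩)
          · exact ⟨k, by omega, h.2⟩
          · exact ⟨i, h⟩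
    · rw [stage_of_lt (by omega), hc.of_lt (k + 1) (i + 1) (by omega)]
      simp

/-- The letters of a word made of the rows `T i 0, …, T i (len i - 1)`, from top to bottom, and
their positions. -/
theorem getD_flatMap_map (T : Filling) (len : ℕ → ℕ) (R q a : ℕ) :
    let w := (List.range R).reverse.flatMap fun i => (List.range (len i)).map (T i)
    (q < w.length ∧ w.getD q 0 = a) ↔
      ∃ i < R, ∃ j < len i, q = ∑ i' ∈ Finset.Ico (i + 1) R, len i' + j ∧ T i j = a := by
  induction R generalizing q with
  | zero => simp
  | succ R ih =>
    intro w
    set w' := (List.range R).reverse.flatMap fun i => (List.range (len i)).map (T i) with hw'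
    have hw : w = (List.range (len R)).map (T R) ++ w' := by
      simp [w, hw', List.range_succ]
    have hlen : ((List.range (len R)).map (T R)).length = len R := by simp
    have hsum : ∀ i < R, ∑ i' ∈ Finset.Ico (i + 1) (R + 1), len i' =
        ∑ i' ∈ Finset.Ico (i + 1) R, len i' + len R := fun i hi =>
      Finset.sum_Ico_succ_top (by omega) _
    by_cases hq : q < len R
    · rw [hw, List.getD_append _ _ _ _ (by omega), List.length_append, hlen,
        List.getD_eq_getElem _ _ (by omega), List.getElem_map, List.getElem_range]
      constructor
      · exact fun h => ⟨R, by omega, q, hq, by simp, h.2⟩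
      · rintro ⟨i, hi, j, hj, rfl, h⟩
        rcases Nat.lt_or_eq_of_le (Nat.le_of_lt_succ hi) with hi' | rfl
        · have := hsum i hi'
          omega
        · simp only [Finset.Ico_self, Finset.sum_empty, zero_add] at *
          exact ⟨by omega, h⟩
    · have e := ih (q - len R)
      simp only at e
      rw [hw, List.getD_append_right _ _ _ _ (by omega), List.length_append, hlen,
        show q < len R + w'.length ↔ q - len R < w'.length by omega, e]
      constructor
      · rintro ⟨i, hi, j, hj, h1, h2⟩
        exact ⟨i, by omega, j, hj, by have := hsum i hi; omega, h2⟩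
      · rintro ⟨i, hi, j, hj, h1, h2⟩
        rcases Nat.lt_or_eq_of_le (Nat.le_of_lt_succ hi) with hi' | rfl
        · exact ⟨i, hi', j, hj, by have := hsum i hi'; omega, h2⟩
        · simp only [Finset.Ico_self, Finset.sum_empty, zero_add] at h1
          omega

/-- Collapsing the positions of the letters of the row reading word of a tableau gives back the
chain recorded by this tableau. -/
theorem Records.card_stage {L : ℕ} {c : ℕ → ℕ → ℕ} {T : Filling} (hc : SizeChain c)
    (h : Records L c T) :
    let w := rowReadingWord T
    let W := letterRows w (Finset.range w.length)
    (∀ a ∈ w, a ≤ L) ∧ W 0 = ∅ ∧ ∀ k ≤ L, ∀ r, (stage k W r).card = c k r := by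
  intro w W
  have hT : ∀ i j, T i j ≠ 0 ↔ j < c L (i + 1) := fun i j => by
    rw [← h.2 i j L le_rfl]
    have := h.1 i j
    omega
  have hcol : ∀ i, {j | T i j ≠ 0}.ncard = c L (i + 1) := fun i => by
    have : {j | T i j ≠ 0} = (Finset.range (c L (i + 1)) : Finset ℕ) := by
      ext j
      simp [hT]
    rw [this, Set.ncard_coe_finset, Finset.card_range]
  obtain ⟨R, hR⟩ : ∃ R, ∀ i, 0 < c L (i + 1) ↔ i < R := by
    have hex : ∃ i, c L (i + 1) = 0 := ⟨L, hc.of_lt _ _ (by omega)⟩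
    refine ⟨Nat.find hex, fun i => ⟨fun hi => ?_, fun hi => ?_⟩⟩
    · by_contra hle
      have h1 := hc.antitone L (not_lt.1 hle)
      have h2 := Nat.find_spec hex
      simp only at h1
      omega
    · exact Nat.pos_of_ne_zero (Nat.find_min hex hi)
  have hrow : {i | T i 0 ≠ 0}.ncard = R := by
    have : {i | T i 0 ≠ 0} = (Finset.range R : Finset ℕ) := by
      ext i
      simp [hT, hR]
    rw [this, Set.ncard_coe_finset, Finset.card_range]
  have hw : w = (List.range R).reverse.flatMap fun i =>
      (List.range (c L (i + 1))).map (T i) := by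
    simp only [w, rowReadingWord, hrow, hcol]
  have hmem : ∀ a x, x ∈ W a ↔ ∃ i < R, ∃ j < c L (i + 1),
      x = ∑ i' ∈ Finset.Ico (i + 1) R, c L (i' + 1) + j ∧ T i j = a := fun a x => by
    have e := getD_flatMap_map T (fun i => c L (i + 1)) R x a
    simp only [← hw] at e
    rw [← e]
    simp only [W, letterRows, Finset.mem_filter, Finset.mem_range]
  have h0 : W 0 = ∅ := by
    refine Finset.eq_empty_of_forall_notMem fun x hx => ?_
    obtain ⟨i, -, j, hj, -, h0⟩ := (hmem 0 x).1 hx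
    exact (hT i j).2 hj h0
  refine ⟨fun a ha => ?_, h0, fun k hk r => ?_⟩
  · rw [hw] at ha
    simp only [List.mem_flatMap, List.mem_map] at ha
    obtain ⟨i, -, j, -, rfl⟩ := ha
    exact h.1 i j
  · rcases Nat.eq_zero_or_pos r with rfl | hr
    · rw [stage_row_zero k h0, hc.row_zero, Finset.card_empty]
    · obtain ⟨i, rfl⟩ : ∃ i, r = i + 1 := ⟨r - 1, by omega⟩
      rw [stage_blocks hc (o := fun i => ∑ i' ∈ Finset.Ico (i + 1) R, c L (i' + 1)) _ h0 _ hk,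
        Nat.card_Ico, Nat.add_sub_cancel_left]
      · intro i
        by_cases hi : i + 1 < R
        · rw [Finset.sum_eq_sum_Ico_succ_bot hi]
          exact (add_comm _ _).le
        · have h1 := hR (i + 1)
          rw [Finset.Ico_eq_empty_of_le (by omega), Finset.Ico_eq_empty_of_le (by omega)]
          simp only [show i + 1 + 1 = i + 2 from rfl] at h1
          simp only [Finset.sum_empty]
          omega
      · intro k hk x
        rw [hmem]
        have hj : ∀ i j, T i j = k + 1 ↔ c k (i + 1) ≤ j ∧ j < c (k + 1) (i + 1) := fun i j => by
          rw [← not_lt, ← h.2 i j k hk.le, ← h.2 i j (k + 1) hk]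
          omega
        constructor
        · rintro ⟨i, -, j, -, rfl, h2⟩
          have := (hj i j).1 h2
          exact ⟨i, by omega, by omega⟩
        · rintro ⟨i, h1, h2⟩
          obtain ⟨j, rfl⟩ := Nat.exists_eq_add_of_le
            (show _ ≤ x from (Nat.le_add_right _ _).trans h1)
          have h3 := hc.mono hk (i + 1)
          simp only [Nat.succ_eq_add_one] at h3
          exact ⟨i, (hR i).1 (by omega), j, by omega, rfl, (hj i j).2 (by omega)⟩

/-- The major index of a multiline queue is the charge of its recording tableau: both are energies,
of the multiline queue and of the rows of positions of the letters in the reading word, and the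
stages of these two sequences of rows have the same sizes. -/
theorem maj_eq_charge {n L : ℕ} {M : Arrangement n} (hM : M ∈ BinaryMatrices L n)
    (hcard : ∀ r r', 1 ≤ r → r ≤ r' → (M r').card ≤ (M r).card) :
    maj L M = charge (rhoQ L M) := by
  have hM0 : M 0 = ∅ := hM 0 (by simp)
  have h0 : toRows M 0 = ∅ := by simp [toRows, hM0]
  obtain ⟨hL, hW0, hst⟩ := (records_rhoQ L hM0).card_stage (sizeChain_stage h0)
  set w := rowReadingWord (rhoQ L M) with hw
  set W := letterRows w (Finset.range w.length) with hW
  obtain ⟨h1, h2⟩ := sameSizes_of_stage h0 hW0 fun k hk r => (hst k hk r).symm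
  have hML : ∀ r, L < r → toRows M r = ∅ := fun r hr => by
    simp [toRows, hM r (by simp; omega)]
  have hWL : ∀ r, L < r → W r = ∅ := fun r hr => by
    rw [← Finset.card_eq_zero, hW, ← count_eq_card_letterRows, List.count_eq_zero]
    exact fun hr' => absurd (hL r hr') (by omega)
  have hcut : ∀ B : Rows, (∀ r, L < r → B r = ∅) → cutRows L B = B := fun B hB => by
    funext r
    by_cases hr : r ≤ L
    · simp [cutRows, hr]
    · simp [cutRows, hr, hB r (by omega)]
  rw [hcut _ hML, hcut _ hWL] at h2
  have hcW : ∀ r, w.count r = (M r).card := fun r => by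
    rw [count_eq_card_letterRows, ← card_toRows, h2.card_eq]
  rw [maj_eq_energy L hcard, charge, ← hw,
    wordCharge_eq_energy hL fun r r' hr hr' => by rw [hcW, hcW]; exact hcard r r' hr hr']
  exact energy_eq_of_sameSizes h2 fun r r' hr hr' => by
    rw [card_toRows, card_toRows]; exact hcard r r' hr hr'

/-! ### Multiline queues and collapsing -/

theorem colLen_eq_zero (μ : YoungDiagram) {k : ℕ} (h : μ.rowLen 0 ≤ k) : μ.colLen k = 0 := by
  by_contra hk
  have h1 := YoungDiagram.mem_iff_lt_colLen.2 (Nat.pos_of_ne_zero hk)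
  have h2 := YoungDiagram.mem_iff_lt_rowLen.1 h1
  omega

theorem MLQ_subset {μ : YoungDiagram} {n : ℕ} : MLQ μ n ⊆ BinaryMatrices (μ.rowLen 0) n := by
  intro M hM r hr
  rcases Nat.eq_zero_or_pos r with rfl | h
  · exact hM.1
  · obtain ⟨k, rfl⟩ : ∃ k, r = k + 1 := ⟨r - 1, by omega⟩
    rw [Finset.mem_Icc] at hr
    rw [← Finset.card_eq_zero, hM.2, colLen_eq_zero μ (by omega)]

theorem card_le_of_mem_MLQ {μ : YoungDiagram} {n : ℕ} {M : Arrangement n} (hM : M ∈ MLQ μ n)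
    (r r' : ℕ) (h : 1 ≤ r) (h' : r ≤ r') : (M r').card ≤ (M r).card := by
  obtain ⟨k, rfl⟩ : ∃ k, r = k + 1 := ⟨r - 1, by omega⟩
  obtain ⟨k', rfl⟩ : ∃ k', r' = k' + 1 := ⟨r' - 1, by omega⟩
  rw [hM.2, hM.2]
  exact μ.colLen_anti _ _ (by omega)

/-- A multiline queue is nonwrapping if and only if each row is dominated by the row below. -/
theorem mem_MLQ₀_iff {μ : YoungDiagram} {n : ℕ} {M : Arrangement n} :
    M ∈ MLQ₀ μ n ↔ M ∈ MLQ μ n ∧ ∀ r, 1 ≤ r → Dominated (toRows M (r + 1)) (toRows M r) := by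
  refine and_congr_right fun hM => ?_
  rw [maj_eq_energy _ (card_le_of_mem_MLQ hM), energy_eq_zero_iff fun r r' h h' => by
    rw [card_toRows, card_toRows]; exact card_le_of_mem_MLQ hM r r' h h']
  refine ⟨fun h r hr => ?_, fun h r hr _ => h r hr⟩
  by_cases hr' : r < μ.rowLen 0
  · exact h r hr hr'
  · have : toRows M (r + 1) = ∅ := by
      rw [← Finset.card_eq_zero, card_toRows, hM.2, colLen_eq_zero μ (by omega)]
    intro x
    rw [this, sufCount_empty]
    exact Nat.zero_le _

theorem toRows_zero {L n : ℕ} {B : Arrangement n} (hB : B ∈ BinaryMatrices L n) :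
    toRows B 0 = ∅ := by
  simp [toRows, hB 0 (by simp)]

/-- Collapsing gives a nonwrapping multiline queue and a semistandard tableau of conjugate
shapes. -/
theorem rho_mem {L n : ℕ} {B : Arrangement n} (hB : B ∈ BinaryMatrices L n) :
    ∃ μ : YoungDiagram, rhoN L B ∈ MLQ₀ μ n ∧ rhoQ L B ∈ SSYTMax μ.transpose L := by
  have h0 := toRows_zero hB
  have hc := sizeChain_stage h0
  obtain ⟨ν, hν⟩ := exists_youngDiagram (hc.antitone L) (N := L) fun i hi =>
    hc.of_lt L (i + 1) (by omega)
  refine ⟨ν.transpose, mem_MLQ₀_iff.2 ⟨⟨?_, fun j => ?_⟩, fun r hr => ?_⟩, ?_⟩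
  · rw [← Finset.card_eq_zero, ← card_toRows, toRows_rhoN hB, stage_row_zero L h0,
      Finset.card_empty]
  · rw [YoungDiagram.colLen_transpose, hν, ← card_toRows, toRows_rhoN hB]
  · rw [toRows_rhoN hB]
    exact stage_dominated L _ hr
  · rw [YoungDiagram.transpose_transpose]
    exact (records_rhoQ L (hB 0 (by simp))).mem_SSYTMax hc hν

theorem rho_injOn (L n : ℕ) : Set.InjOn (rho L) (BinaryMatrices L n) := by
  intro B hB B' hB' h
  have h1 := toRows_rhoN hB
  rw [show rhoN L B = rhoN L B' from congrArg Prod.fst h, toRows_rhoN hB'] at h1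
  have h2 := records_rhoQ L (hB 0 (by simp))
  rw [show rhoQ L B = rhoQ L B' from congrArg Prod.snd h] at h2
  have h0 := toRows_zero hB
  have h0' := toRows_zero hB'
  refine toRows_injective (funext fun r => ?_)
  by_cases hr : r ≤ L
  · refine eq_of_stage_eq h0 h0' (fun k hk r => ?_) h1.symm hr
    rcases Nat.eq_zero_or_pos r with rfl | hr
    · rw [stage_row_zero k h0, stage_row_zero k h0']
    · obtain ⟨i, rfl⟩ : ∃ i, r = i + 1 := ⟨r - 1, by omega⟩
      exact h2.chain_eq (records_rhoQ L (hB' 0 (by simp))) hk i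
  · have hr' : r ∉ Finset.Icc 1 L := by simp; omega
    rw [toRows, toRows, hB r hr', hB' r hr']

/-- Every pair of a nonwrapping multiline queue and a semistandard tableau of conjugate shapes comes
from collapsing. -/
theorem exists_rho_eq {L n : ℕ} {μ : YoungDiagram} {N : Arrangement n} {T : Filling}
    (hN : N ∈ MLQ₀ μ n) (hT : T ∈ SSYTMax μ.transpose L) :
    ∃ B ∈ BinaryMatrices L n, rho L B = (N, T) := by
  obtain ⟨c, hc, hrec, hν⟩ := exists_records hT
  obtain ⟨hN, hdom⟩ := mem_MLQ₀_iff.1 hN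
  have hcard : ∀ r, (toRows N r).card = c L r := fun r => by
    rw [card_toRows]
    rcases Nat.eq_zero_or_pos r with rfl | hr
    · rw [hN.1, hc.row_zero, Finset.card_empty]
    · obtain ⟨i, rfl⟩ : ∃ i, r = i + 1 := ⟨r - 1, by omega⟩
      rw [hN.2, ← hν, YoungDiagram.rowLen_transpose]
  obtain ⟨B, h0, hL, hst, hB⟩ := exists_stage_eq (by simp [toRows, hN.1])
    (fun r hr => Finset.card_eq_zero.1 ((hcard r).trans (hc.of_lt L r hr))) hdom hcard
    hc.row_zero hc.of_lt fun k r _ hr => hc.interlace k r hr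
  -- collapsing does not move balls to other columns
  obtain ⟨B, rfl⟩ := exists_toRows_eq (n := n) (B := B) fun r x hx => by
    have hr : r ≤ L := by
      by_contra hr
      rw [hL r (by omega)] at hx
      exact absurd hx (Finset.notMem_empty x)
    obtain ⟨s, hs⟩ := exists_mem_runWord (w := collapseWord L) (B := cutRows L B) (x := x) (r := r)
      (by simpa [cutRows, hr] using hx)
    have hs : x ∈ stage L B s := hs
    rw [hB, toRows, Finset.mem_map] at hs
    obtain ⟨y, -, rfl⟩ := hs
    exact y.2
  have hmem : B ∈ BinaryMatrices L n := fun r hr => by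
    rw [← Finset.card_eq_zero, ← card_toRows, Finset.card_eq_zero]
    rcases Nat.eq_zero_or_pos r with rfl | hr'
    · exact h0
    · exact hL r (by rw [Finset.mem_Icc] at hr; omega)
  refine ⟨B, hmem, Prod.ext (toRows_injective ((toRows_rhoN hmem).trans hB)) ?_⟩
  refine (records_rhoQ L (hmem 0 (by simp))).eq ⟨hrec.1, fun i j k hk => ?_⟩
  simp only [hrec.2 i j k hk, hst k hk]

/-- The entries of a tableau with content `κ` are at most the number of parts of `κ`. -/
theorem le_of_mem_SSYTContent {ν μ : YoungDiagram} {T : Filling}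
    (hT : T ∈ SSYTContent ν μ.transpose) (i j : ℕ) : T i j ≤ μ.rowLen 0 := by
  obtain ⟨⟨S, hS, -⟩, hcont⟩ := hT
  by_contra hij
  obtain ⟨k, hk⟩ : ∃ k, T i j = k + 1 := ⟨T i j - 1, by omega⟩
  have h1 := hcont k
  rw [YoungDiagram.rowLen_transpose, colLen_eq_zero μ (by omega), content,
    Set.ncard_eq_zero (ν.cells.finite_toSet.subset fun p hp => ?_)] at h1
  · exact (Set.eq_empty_iff_forall_notMem.1 h1) (i, j) hk
  · by_contra hp'
    have h2 : T p.1 p.2 = k + 1 := hp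
    rw [hS, S.zeros (by simpa using hp')] at h2
    omega

theorem content_eq_zero {L : ℕ} {T : Filling} (h : ∀ i j, T i j ≤ L) {k : ℕ} (hk : L < k) :
    content T k = 0 := by
  have : {p : ℕ × ℕ | T p.1 p.2 = k} = ∅ := Set.eq_empty_of_forall_notMem fun p hp => by
    have h1 := h p.1 p.2
    have h2 : T p.1 p.2 = k := hp
    omega
  rw [content, this, Set.ncard_empty]

/-- A binary matrix is a multiline queue if and only if its recording tableau has the right
content. -/
theorem mem_MLQ_iff {μ : YoungDiagram} {n : ℕ} {B : Arrangement n}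
    (hB : B ∈ BinaryMatrices (μ.rowLen 0) n) :
    B ∈ MLQ μ n ↔ ∀ k, content (rhoQ (μ.rowLen 0) B) (k + 1) = μ.transpose.rowLen k := by
  have h0 : B 0 = ∅ := hB 0 (by simp)
  refine (and_iff_right h0).trans (forall_congr' fun k => ?_)
  rw [YoungDiagram.rowLen_transpose]
  by_cases hk : k + 1 ≤ μ.rowLen 0
  · rw [content_rhoQ h0 hk]
  · rw [content_eq_zero (records_rhoQ _ h0).1 (by omega), colLen_eq_zero μ (by omega),
      hB (k + 1) (by simp; omega)]
    simp

end MLQueue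

open MLQueue
theorem mainTheorem2 :
    (∀ L n : ℕ,
      Set.BijOn (rho L) (BinaryMatrices L n)
        (⋃ μ : YoungDiagram, MLQ₀ μ n ×ˢ SSYTMax μ.transpose L) ∧
      ∀ B ∈ BinaryMatrices L n,
        (∀ k ∈ Finset.Icc 1 L, content (rhoQ L B) k = (B k).card) ∧
        xMonomial L (rhoN L B) = xMonomial L B) ∧
    (∀ (μ : YoungDiagram) (n : ℕ), μ.colLen 0 ≤ n →
      Set.BijOn (rho (μ.rowLen 0)) (MLQ μ n)
        (⋃ ν : YoungDiagram, MLQ₀ ν n ×ˢ SSYTContent ν.transpose μ.transpose) ∧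
      ∀ M ∈ MLQ μ n,
        xMonomial (μ.rowLen 0) (rhoN (μ.rowLen 0) M) = xMonomial (μ.rowLen 0) M ∧
        maj (μ.rowLen 0) M = charge (rhoQ (μ.rowLen 0) M)) := by
  refine ⟨fun L n => ⟨⟨fun B hB => ?_, rho_injOn L n, ?_⟩, fun B hB => ⟨fun k hk => ?_,
    xMonomial_rhoN L B⟩⟩, fun μ n _ => ⟨⟨fun M hM => ?_, (rho_injOn _ n).mono MLQ_subset, ?_⟩,
    fun M hM => ⟨xMonomial_rhoN _ M, maj_eq_charge (MLQ_subset hM) (card_le_of_mem_MLQ hM)⟩⟩⟩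
  · obtain ⟨μ, h⟩ := rho_mem hB
    exact Set.mem_iUnion.2 ⟨μ, h⟩
  · rintro ⟨N, T⟩ h
    obtain ⟨μ, hN, hT⟩ := Set.mem_iUnion.1 h
    exact exists_rho_eq hN hT
  · obtain ⟨h1, h2⟩ := Finset.mem_Icc.1 hk
    obtain ⟨k, rfl⟩ : ∃ k', k = k' + 1 := ⟨k - 1, by omega⟩
    exact content_rhoQ (hB 0 (by simp)) h2
  · obtain ⟨ν, h1, h2⟩ := rho_mem (MLQ_subset hM)
    exact Set.mem_iUnion.2 ⟨ν, h1, h2.1, (mem_MLQ_iff (MLQ_subset hM)).1 hM⟩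
  · rintro ⟨N, T⟩ h
    obtain ⟨ν, hN, hT⟩ := Set.mem_iUnion.1 h
    obtain ⟨B, hB, e⟩ := exists_rho_eq hN ⟨hT.1, le_of_mem_SSYTContent hT⟩
    refine ⟨B, (mem_MLQ_iff hB).2 ?_, e⟩
    rw [show rhoQ (μ.rowLen 0) B = T from congrArg Prod.snd e]
    exact hT.2
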